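/- Let $(M,\sigma)$ be a symplectic manifold (finite-dimensional, smooth, Hausdorff, second countable, without boundary), with Poisson bracket $\{f,g\}=\sigma(X_f,X_g)$, $\sigma(X_f,\cdot)=df$, extended complex-bilinearly to the $*$-algebra $C^\infty(M)$ of smooth complex-valued functions with complex conjugation as involution. Let $\star$ be a Hermitian star product on $(M,\sigma)$, that is, an associative $\mathbb{C}[[\lambda]]$-bilinear multiplication $$f\star g=\sum_{r=0}^\infty \lambda^r C_r(f,g)$$ on $C^\infty(M)[[\lambda]]$ such that the $C_r$ are bidifferential operators, $C_0(f,g)=fg$, $C_1(f,g)-C_1(g,f)=\mathrm{i}\{f,g\}$, $1\star f=f=f\star 1$ and $\overline{f\star g}=\overline{g}\star\overline{f}$ (with $\overline{\lambda}=\lambda$). Order $\mathbb{R}[[\lambda]]$ by declaring a non-zero series positive if its lowest-order non-zero coefficient is positive; for $z\in\mathbb{C}[[\lambda]]$, $z\ge 0$ means that $z\in\mathbb{R}[[\lambda]]$ and that $z$ is zero or positive. A linear functional $\omega$ on a $*$-algebra over $\mathbb{C}$ or $\mathbb{C}[[\lambda]]$ is positive if $\omega(a^*a)\ge 0$ for all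 $a$. A Hermitian deformation $(\mathcal{A}[[\lambda]],\star,{}^*)$ of a $*$-algebra $\mathcal{A}$ over $\mathbb{C}$ is called a positive deformation if for every positive $\mathbb{C}$-linear functional $\omega_0:\mathcal{A}\to\mathbb{C}$ there are $\mathbb{C}$-linear functionals $\omega_1,\omega_2,\dots:\mathcal{A}\to\mathbb{C}$ such that the $\mathbb{C}[[\lambda]]$-linear functional $\omega=\sum_{r\ge 0}\lambda^r\omega_r:\mathcal{A}[[\lambda]]\to\mathbb{C}[[\lambda]]$ is positive with respect to $\star$. It is called a completely positive deformation if, for all $n\in\mathbb{N}$, $M_n(\mathcal{A}[[\lambda]],\star)$, with the conjugate transpose as involution, is a positive deformation of $M_n(\mathcal{A})$. Then $(C^\infty(M)[[\lambda]],\star,\overline{\phantom{x}})$ is a positive deformation of $C^\infty(M)$, and it is even a completely positive deformation. -/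

import Mathlib

open scoped Manifold ContDiff PowerSeries

/-! ### Formal power series and the order on them

The ring `ℂ[[λ]]` is `ℂ⟦X⟧`, and for a `ℂ`-algebra `A` the `ℂ[[λ]]`-module `A[[λ]]` is `A⟦X⟧`. -/

namespace FormalDeformation

/-- `a > 0` in the ordered ring `ℝ[[λ]]`: the lowest order non-zero coefficient is positive. -/
def IsPos (a : ℝ⟦X⟧) : Prop :=
  ∃ r : ℕ, 0 < PowerSeries.coeff r a ∧ ∀ s < r, PowerSeries.coeff s a = 0

/-- `z ≥ 0` for `z ∈ ℂ[[λ]] = ℝ[[λ]] ⊕ i ℝ[[λ]]`: `z` lies in `ℝ[[λ]]` and is zero or positive. -/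
def IsNonneg (z : ℂ⟦X⟧) : Prop :=
  ∃ a : ℝ⟦X⟧, z = PowerSeries.map (algebraMap ℝ ℂ) a ∧ (a = 0 ∨ IsPos a)

section Series

variable {A : Type*} [Ring A]

/-- The involution of `A` applied coefficientwise to `A[[λ]]`; the formal parameter is real. -/
noncomputable def seriesStar [StarRing A] (a : A⟦X⟧) : A⟦X⟧ :=
  PowerSeries.mk fun k => star (PowerSeries.coeff k a)

variable [Algebra ℂ A]

/-- The `ℂ[[λ]]`-bilinear extension to `A[[λ]]` of `(a, b) ↦ ∑ᵣ λʳ Cᵣ(a, b)`. -/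
noncomputable def seriesMul (C : ℕ → A →ₗ[ℂ] A →ₗ[ℂ] A) (a b : A⟦X⟧) : A⟦X⟧ :=
  PowerSeries.mk fun k =>
    ∑ p ∈ Finset.HasAntidiagonal.antidiagonal k, ∑ q ∈ Finset.HasAntidiagonal.antidiagonal p.2,
      C p.1 (PowerSeries.coeff q.1 a) (PowerSeries.coeff q.2 b)

/-- The `ℂ[[λ]]`-linear functional `∑ᵣ λʳ φᵣ : A[[λ]] → ℂ[[λ]]`. -/
noncomputable def seriesFunctional (φ : ℕ → A →ₗ[ℂ] ℂ) (a : A⟦X⟧) : ℂ⟦X⟧ :=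
  PowerSeries.mk fun k =>
    ∑ p ∈ Finset.HasAntidiagonal.antidiagonal k, φ p.1 (PowerSeries.coeff p.2 a)

theorem coeff_seriesMul (C : ℕ → A →ₗ[ℂ] A →ₗ[ℂ] A) (a b : A⟦X⟧) (k : ℕ) :
    PowerSeries.coeff k (seriesMul C a b) =
      ∑ p ∈ Finset.HasAntidiagonal.antidiagonal k, ∑ q ∈ Finset.HasAntidiagonal.antidiagonal p.2,
        C p.1 (PowerSeries.coeff q.1 a) (PowerSeries.coeff q.2 b) := by
  simp [seriesMul]

theorem seriesMul_sum_left {ι : Type*} (C : ℕ → A →ₗ[ℂ] A →ₗ[ℂ] A) (s : Finset ι)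
    (a : ι → A⟦X⟧) (b : A⟦X⟧) :
    seriesMul C (∑ i ∈ s, a i) b = ∑ i ∈ s, seriesMul C (a i) b := by
  ext k
  simp only [coeff_seriesMul, map_sum, LinearMap.sum_apply]
  rw [Finset.sum_comm]
  refine Finset.sum_congr rfl fun p _ => ?_
  rw [Finset.sum_comm]

theorem seriesMul_sum_right {ι : Type*} (C : ℕ → A →ₗ[ℂ] A →ₗ[ℂ] A) (s : Finset ι)
    (a : A⟦X⟧) (b : ι → A⟦X⟧) :
    seriesMul C a (∑ i ∈ s, b i) = ∑ i ∈ s, seriesMul C a (b i) := by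
  ext k
  simp only [coeff_seriesMul, map_sum]
  rw [Finset.sum_comm]
  refine Finset.sum_congr rfl fun p _ => ?_
  rw [Finset.sum_comm]

end Series

section Matrix

variable {A : Type*} [Ring A] {n : ℕ}

/-- The identification of `Mₙ(A)[[λ]]` with `Mₙ(A[[λ]])`, entry by entry. -/
noncomputable def entry (i j : Fin n) (a : (Matrix (Fin n) (Fin n) A)⟦X⟧) : A⟦X⟧ :=
  PowerSeries.mk fun k => PowerSeries.coeff k a i j

theorem entry_ext {a b : (Matrix (Fin n) (Fin n) A)⟦X⟧} (h : ∀ i j, entry i j a = entry i j b) :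
    a = b := by
  ext k i j
  simpa [entry] using congrArg (PowerSeries.coeff k) (h i j)

theorem entry_seriesStar [StarRing A] (a : (Matrix (Fin n) (Fin n) A)⟦X⟧) (i j : Fin n) :
    entry i j (seriesStar a) = seriesStar (entry j i a) := by
  ext k
  simp [entry, seriesStar, Matrix.star_apply]

variable [Algebra ℂ A]

/-- `(a, b) ↦ (∑ₗ B(aᵢₗ, bₗⱼ))ᵢⱼ`, the extension of a bilinear map to matrices. -/
noncomputable def matrixBilin (n : ℕ) (B : A →ₗ[ℂ] A →ₗ[ℂ] A) :
    Matrix (Fin n) (Fin n) A →ₗ[ℂ] Matrix (Fin n) (Fin n) A →ₗ[ℂ] Matrix (Fin n) (Fin n) A :=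
  LinearMap.mk₂ ℂ (fun a b => Matrix.of fun i j => ∑ l, B (a i l) (b l j))
    (fun a a' b => by ext i j; simp [Finset.sum_add_distrib])
    (fun c a b => by ext i j; simp [Finset.smul_sum])
    (fun a b b' => by ext i j; simp [Finset.sum_add_distrib])
    (fun c a b => by ext i j; simp [Finset.smul_sum])

theorem entry_seriesMul (C : ℕ → A →ₗ[ℂ] A →ₗ[ℂ] A) (a b : (Matrix (Fin n) (Fin n) A)⟦X⟧)
    (i j : Fin n) :
    entry i j (seriesMul (fun r => matrixBilin n (C r)) a b) =
      ∑ l, seriesMul C (entry i l a) (entry l j b) := by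
  ext k
  simp only [entry, map_sum, coeff_seriesMul, PowerSeries.coeff_mk, Matrix.sum_apply,
    matrixBilin, LinearMap.mk₂_apply, Matrix.of_apply]
  rw [Finset.sum_comm]
  refine Finset.sum_congr rfl fun p _ => ?_
  rw [Finset.sum_comm]

end Matrix

end FormalDeformation

open FormalDeformation in
/-- A Hermitian deformation `(A[[λ]], ⋆, *)` of the `*`-algebra `A` over `ℂ`:
`a ⋆ b = ∑ᵣ λʳ Cᵣ(a, b)` with `C₀(a, b) = ab` is associative, and the undeformed involution is an
antiautomorphism of it. -/
structure HermitianDeformation (A : Type*) [Ring A] [StarRing A] [Algebra ℂ A] where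
  C : ℕ → A →ₗ[ℂ] A →ₗ[ℂ] A
  C_zero : ∀ a b : A, C 0 a b = a * b
  assoc : ∀ a b c : A⟦X⟧,
    seriesMul C (seriesMul C a b) c = seriesMul C a (seriesMul C b c)
  star_mul : ∀ a b : A⟦X⟧,
    seriesStar (seriesMul C a b) = seriesMul C (seriesStar b) (seriesStar a)

namespace HermitianDeformation

open FormalDeformation

variable {A : Type*} [Ring A] [StarRing A] [Algebra ℂ A]

/-- The deformed product `⋆` on `A[[λ]]`. -/
noncomputable def mul (D : HermitianDeformation A) (a b : A⟦X⟧) : A⟦X⟧ := seriesMul D.C a b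

/-- Every positive `ℂ`-linear functional `φ₀` of `A` is the zeroth order of some
`∑ᵣ λʳ φᵣ : A[[λ]] → ℂ[[λ]]` that is positive with respect to `⋆`. -/
def IsPositive (D : HermitianDeformation A) : Prop :=
  ∀ φ₀ : A →ₗ[ℂ] ℂ, (∀ a : A, ∃ t : ℝ, 0 ≤ t ∧ φ₀ (star a * a) = (t : ℂ)) →
    ∃ φ : ℕ → A →ₗ[ℂ] ℂ, φ 0 = φ₀ ∧
      ∀ a : A⟦X⟧, IsNonneg (seriesFunctional φ (D.mul (seriesStar a) a))

/-- The deformation of `Mₙ(A)` given by matrix multiplication over `(A[[λ]], ⋆)`, with the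
conjugate transpose as involution. -/
noncomputable def matrix (D : HermitianDeformation A) (n : ℕ) :
    HermitianDeformation (Matrix (Fin n) (Fin n) A) where
  C r := matrixBilin n (D.C r)
  C_zero a b := by
    ext i j
    simp [matrixBilin, D.C_zero, Matrix.mul_apply]
  assoc a b c := by
    refine entry_ext fun i j => ?_
    simp only [entry_seriesMul, seriesMul_sum_left, seriesMul_sum_right, D.assoc]
    rw [Finset.sum_comm]
  star_mul a b := by
    refine entry_ext fun i j => ?_
    have hs : ∀ f : Fin n → A⟦X⟧, seriesStar (∑ l, f l) = ∑ l, seriesStar (f l) := fun f => by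
      ext k
      simp [seriesStar]
    simp only [entry_seriesStar, entry_seriesMul, hs, D.star_mul]

/-- For all `n`, the deformation `Mₙ(A[[λ]], ⋆)` of `Mₙ(A)` is positive. -/
def IsCompletelyPositive (D : HermitianDeformation A) : Prop :=
  ∀ n : ℕ, (D.matrix n).IsPositive

end HermitianDeformation

/-! ### Differential operators -/

section DiffOp

variable {A : Type*} [CommRing A] [Algebra ℂ A]

/-- Differential operators of order at most `k` on a commutative algebra: `D` has order at most `0`
if it commutes with all multiplications `a ↦ f * a`, and order at most `k + 1` if all commutators
with multiplications have order at most `k`. On `C^∞(M)` these are the operators that are given in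
charts by finite sums of partial derivatives of order at most `k` with smooth coefficients. -/
def IsDiffOp : ℕ → (A →ₗ[ℂ] A) → Prop
  | 0, D => ∀ f : A, D ∘ₗ LinearMap.mulLeft ℂ f - LinearMap.mulLeft ℂ f ∘ₗ D = 0
  | k + 1, D => ∀ f : A, IsDiffOp k (D ∘ₗ LinearMap.mulLeft ℂ f - LinearMap.mulLeft ℂ f ∘ₗ D)

/-- Bidifferential operators: differential operators of finite order in each argument. -/
def IsBidiffOp (B : A →ₗ[ℂ] A →ₗ[ℂ] A) : Prop :=
  ∃ k : ℕ, (∀ f : A, IsDiffOp k (B f)) ∧ ∀ g : A, IsDiffOp k (B.flip g)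

end DiffOp

/-! ### Symplectic manifolds -/

section Symplectic

variable (E : Type*) [NormedAddCommGroup E] [NormedSpace ℝ E]
variable (M : Type*) [TopologicalSpace M] [ChartedSpace E M]

/-- The `*`-algebra `C^∞(M)` of smooth complex-valued functions, with pointwise operations and
complex conjugation as involution. -/
def SmoothFunctions : StarSubalgebra ℂ (M → ℂ) where
  carrier := {f | ContMDiff 𝓘(ℝ, E) 𝓘(ℝ, ℂ) ∞ f}
  mul_mem' hf hg := contDiff_mul.contMDiff.comp (hf.prodMk_space hg)
  add_mem' hf hg := hf.add hg
  algebraMap_mem' _ := contMDiff_const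
  star_mem' hf := Complex.conjCLE.contDiff.contMDiff.comp hf

variable {E M}

/-- A 2-form on `M`, written in the chart at `x₀` as a 2-form on (the target of the chart in) `E`. -/
noncomputable def chartForm (σ : ∀ x : M, (TangentSpace 𝓘(ℝ, E) x) [⋀^Fin 2]→L[ℝ] ℝ) (x₀ : M)
    (y : E) : E [⋀^Fin 2]→L[ℝ] ℝ :=
  (σ ((chartAt E x₀).symm y)).compContinuousLinearMap
    (mfderiv 𝓘(ℝ, E) 𝓘(ℝ, E) (chartAt E x₀).symm y)

variable (E M)

/-- A symplectic form on `M`: a smooth, closed, non-degenerate 2-form. -/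
structure SymplecticForm where
  form : ∀ x : M, (TangentSpace 𝓘(ℝ, E) x) [⋀^Fin 2]→L[ℝ] ℝ
  smooth : ∀ x₀ : M, ContDiffOn ℝ ∞ (chartForm form x₀) (chartAt E x₀).target
  closed : ∀ x₀ : M, ∀ y ∈ (chartAt E x₀).target, extDeriv (chartForm form x₀) y = 0
  nondegenerate : ∀ (x : M) (v : TangentSpace 𝓘(ℝ, E) x),
    (∀ w : TangentSpace 𝓘(ℝ, E) x, form x ![v, w] = 0) → v = 0

variable {E M}

namespace SymplecticForm

theorem update_one {V : Type*} (v u w : V) : Function.update ![v, u] 1 w = ![v, w] := by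
  ext i
  fin_cases i <;> simp

/-- The map `v ↦ σ(v, ·)` from tangent vectors to covectors. -/
noncomputable def flat (σ : SymplecticForm E M) (x : M) :
    TangentSpace 𝓘(ℝ, E) x →ₗ[ℝ] Module.Dual ℝ (TangentSpace 𝓘(ℝ, E) x) :=
  LinearMap.mk₂ ℝ (fun v w => σ.form x ![v, w])
    (fun v v' w => by simpa using (σ.form x).toMultilinearMap.cons_add ![w] v v')
    (fun c v w => by simpa using (σ.form x).toMultilinearMap.cons_smul ![w] c v)
    (fun v w w' => by
      have h := (σ.form x).map_update_add ![v, 0] 1 w w'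
      rwa [update_one, update_one, update_one] at h)
    (fun c v w => by
      have h := (σ.form x).map_update_smul ![v, 0] 1 c w
      rwa [update_one, update_one] at h)

theorem flat_injective (σ : SymplecticForm E M) (x : M) : Function.Injective (σ.flat x) := by
  refine (injective_iff_map_eq_zero _).2 fun v hv => σ.nondegenerate x v fun w => ?_
  simpa [flat] using LinearMap.congr_fun hv w

variable [FiniteDimensional ℝ E]

/-- The inverse of `flat`: `sharp α` is the vector `v` with `σ(v, ·) = α`. -/
noncomputable def sharp (σ : SymplecticForm E M) (x : M) :
    Module.Dual ℝ (TangentSpace 𝓘(ℝ, E) x) ≃ₗ[ℝ] TangentSpace 𝓘(ℝ, E) x :=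
  haveI : FiniteDimensional ℝ (TangentSpace 𝓘(ℝ, E) x) := inferInstanceAs (FiniteDimensional ℝ E)
  (LinearEquiv.ofInjectiveOfFinrankEq (σ.flat x) (σ.flat_injective x)
    Subspace.dual_finrank_eq.symm).symm

theorem form_sharp (σ : SymplecticForm E M) (x : M)
    (α : Module.Dual ℝ (TangentSpace 𝓘(ℝ, E) x)) (w : TangentSpace 𝓘(ℝ, E) x) :
    σ.form x ![σ.sharp x α, w] = α w := by
  have : FiniteDimensional ℝ (TangentSpace 𝓘(ℝ, E) x) := inferInstanceAs (FiniteDimensional ℝ E)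
  have h : σ.flat x (σ.sharp x α) = α := by
    unfold sharp
    exact LinearEquiv.apply_symm_apply
      (LinearEquiv.ofInjectiveOfFinrankEq (σ.flat x) (σ.flat_injective x) _) α
  simpa [flat] using LinearMap.congr_fun h w

/-- The Hamiltonian vector field of a real function: `σ(X_u, ·) = du`. -/
noncomputable def hamiltonianField (σ : SymplecticForm E M) (u : M → ℝ) (x : M) :
    TangentSpace 𝓘(ℝ, E) x :=
  σ.sharp x (mfderiv 𝓘(ℝ, E) 𝓘(ℝ, ℝ) u x).toLinearMap

/-- The Poisson bracket `{f, g} = σ(X_f, X_g) = df(X_g)`, extended complex-bilinearly to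
complex-valued functions. -/
noncomputable def poissonBracket (σ : SymplecticForm E M) (f g : M → ℂ) (x : M) : ℂ :=
  let df : TangentSpace 𝓘(ℝ, E) x →L[ℝ] ℂ := mfderiv 𝓘(ℝ, E) 𝓘(ℝ, ℂ) f x
  df (σ.hamiltonianField (fun y => (g y).re) x) +
    Complex.I * df (σ.hamiltonianField (fun y => (g y).im) x)

end SymplecticForm

variable [FiniteDimensional ℝ E]

/-- A Hermitian star product on the symplectic manifold `(M, σ)`. Associativity,
`ℂ[[λ]]`-bilinearity, `C₀(f, g) = fg` and compatibility with complex conjugation are part of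
`HermitianDeformation`. -/
structure HermitianStarProduct (σ : SymplecticForm E M) extends
    HermitianDeformation (SmoothFunctions E M) where
  C_one_sub : ∀ (f g : SmoothFunctions E M) (x : M),
    (C 1 f g : M → ℂ) x - (C 1 g f : M → ℂ) x = Complex.I * σ.poissonBracket f g x
  one_mul : ∀ f : (SmoothFunctions E M)⟦X⟧, FormalDeformation.seriesMul C 1 f = f
  mul_one : ∀ f : (SmoothFunctions E M)⟦X⟧, FormalDeformation.seriesMul C f 1 = f
  bidiff : ∀ r : ℕ, IsBidiffOp (C r)

end Symplectic

/-!
Every Hermitian star product on `C^∞(M)` is a completely positive deformation, because each point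
evaluation can be deformed into a positive functional in such a way that the deformation is given
by operators on `C^∞(M)`: there are `ℂ`-linear maps `T₀ = id, T₁, T₂, …` of `C^∞(M)` into itself
such that `a ↦ ∑ᵣ λʳ Tᵣ(a)(x)` is positive for `⋆` at every point `x` (`exists_isNonneg_stateAt`).
A positive functional `φ₀` is then deformed to `∑ᵣ λʳ φ₀ ∘ Tᵣ`, entrywise on matrices.

*Positivity at a point.* Let `y₁, …, y_m` be coordinates centred at `x`. In the algebra
`(C^∞(M)[[λ]], ⋆)` give `λ` the degree `2` and the `yᵢ` the degree `1`; the elements of degree at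
least `d` form a filtration `filt`, and modulo the next step its terms are spanned by `λʲ` times
ordered words in the `yᵢ`. The relations `[yᵢ, yⱼ] = λ cᵢⱼ + …` hold to leading order, with an
antisymmetric, purely imaginary matrix `c`. Field operators on a Fock space with two kinds of
bosons satisfy the same relations exactly, and their vacuum expectation is strictly positive on the
span of ordered words (`sum_vacuumExp_pos`): the second kind of bosons sees the whole word. So a
functional whose value on each ordered word has the leading term `λ^(length / 2)` times the vacuum
expectation (`IsQuasiFree`) gives `⋆`-squares of elements of exact degree `d` a positive
coefficient at `λᵈ` and no lower term (`IsQuasiFree.star_mul_self_nonneg`). Positivity is therefore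
decided in leading order, and no completion or convergence is involved.

*Existence.* The values on words are prescribed by choosing the `Tᵣ` recursively as differential
operators with given symbols; locality of the `Cᵣ` makes the coefficients of long words vanish to
high order at `x`, so that the conditions on each `Tᵣ` have bounded order
(`LocalFrame.exists_isQuasiFree`). Everything depends smoothly on `x`. By Hadamard's lemma a chart
provides the required frame (`chartFrame`), and a partition of unity glues the local operators.

*Integration.* It remains to see that a positive functional `φ` on `Mₙ(C^∞(M))` maps a sequence
`Hₖ` of matrix functions that is non-negative as a formal series at each point to a non-negative
series (`isNonneg_map_of_quad`). By a Cholesky decomposition with smooth entries, `φ` is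
non-negative on pointwise positive definite matrix functions. Compactness of spheres and a
partition of unity yield smooth `cⱼ` with `Hₖ + ε + ∑_{j < k} cⱼ Hⱼ` positive definite. If `φ(H₀) =
⋯ = φ(H_{k-1}) = 0`, then inductively `φ(g Hⱼ) = 0` for all real functions `g` and `j < k`, and
hence `φ(Hₖ) ≥ 0`.
-/

/-! ### Field operators on a bosonic Fock space -/

namespace FormalDeformation

section Fock

open MvPolynomial

variable {ι R : Type*} [Fintype ι] [CommRing R]

/-- The annihilation part `∑ₖ βᵢₖ ∂/∂zₖ + ∂/∂z'ᵢ` of the field operator `fieldOp β β' i`; the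
variables `zₖ` are indexed by `Sum.inl k` and `z'ₖ` by `Sum.inr k`. -/
noncomputable def annihilate (β : ι → ι → R) (i : ι) :
    Derivation R (MvPolynomial (ι ⊕ ι) R) (MvPolynomial (ι ⊕ ι) R) :=
  ∑ k, β i k • pderiv (Sum.inl k) + pderiv (Sum.inr i)

/-- The linear polynomial `∑ₖ β'ᵢₖ zₖ + z'ᵢ`; multiplication by it is the creation part of the
field operator `fieldOp β β' i`. -/
noncomputable def creator (β' : ι → ι → R) (i : ι) : MvPolynomial (ι ⊕ ι) R :=
  ∑ k, β' i k • X (Sum.inl k) + X (Sum.inr i)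

/-- The field operator `ŷᵢ`, on the Fock space of polynomials in `2 |ι|` variables. The variables
`z'` serve only to make the vectors obtained from the vacuum `1` linearly independent. -/
noncomputable def fieldOp (β β' : ι → ι → R) (i : ι) :
    Module.End R (MvPolynomial (ι ⊕ ι) R) :=
  (annihilate β i).toLinearMap + LinearMap.mulLeft R (creator β' i)

/-- The vacuum expectation value of the product of the field operators along a list. -/
noncomputable def vacuumExp (β β' : ι → ι → R) (L : List ι) : R :=
  constantCoeff ((L.map (fieldOp β β')).prod 1)

theorem derivation_sum_apply {A M κ : Type*} [CommRing A] [Algebra R A] [AddCommGroup M]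
    [Module A M] [Module R M] (s : Finset κ) (D : κ → Derivation R A M) (a : A) :
    (∑ k ∈ s, D k) a = ∑ k ∈ s, D k a := by
  classical
  induction s using Finset.induction_on with
  | empty => simp
  | insert k s hk ih => simp [Finset.sum_insert hk, ih]

theorem annihilate_apply (β : ι → ι → R) (i : ι) (p : MvPolynomial (ι ⊕ ι) R) :
    annihilate β i p = ∑ k, β i k • pderiv (Sum.inl k) p + pderiv (Sum.inr i) p := by
  simp [annihilate, derivation_sum_apply]

theorem fieldOp_apply (β β' : ι → ι → R) (i : ι) (p : MvPolynomial (ι ⊕ ι) R) :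
    fieldOp β β' i p = annihilate β i p + creator β' i * p := by
  simp [fieldOp]

theorem annihilate_creator [DecidableEq ι] (β β' : ι → ι → R) (i j : ι) :
    annihilate β i (creator β' j) = C (∑ k, β i k * β' j k + if i = j then 1 else 0) := by
  rw [annihilate_apply, creator]
  have h2 : pderiv (Sum.inr i) (X (Sum.inr j) : MvPolynomial (ι ⊕ ι) R) =
      if i = j then 1 else 0 := by
    by_cases hij : i = j
    · simp [hij]
    · simp [hij, Ne.symm hij]
  simp only [map_add, map_sum, Derivation.map_smul, h2]
  simp [pderiv_X, Pi.single_apply, smul_eq_C_mul]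

theorem annihilate_comm (β : ι → ι → R) (i j : ι) (p : MvPolynomial (ι ⊕ ι) R) :
    annihilate β i (annihilate β j p) = annihilate β j (annihilate β i p) := by
  classical
  have hX : ∀ i s, ∃ c : R, annihilate β i (X s) = C c := by
    rintro i (k | k)
    · exact ⟨β i k, by simp [annihilate_apply, pderiv_X, Pi.single_apply, smul_eq_C_mul]⟩
    · refine ⟨if i = k then 1 else 0, ?_⟩
      by_cases hik : i = k
      · simp [annihilate_apply, hik]
      · simp [annihilate_apply, hik, Ne.symm hik]
  have h0 : ⁅annihilate β i, annihilate β j⁆ = 0 := by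
    refine MvPolynomial.derivation_ext fun s => ?_
    obtain ⟨c, hc⟩ := hX i s
    obtain ⟨c', hc'⟩ := hX j s
    simp [Derivation.commutator_apply, hc, hc']
  have h1 := Derivation.commutator_apply (D1 := annihilate β i) (D2 := annihilate β j) (a := p)
  rw [h0] at h1
  exact sub_eq_zero.1 h1.symm

/-- The canonical commutation relations. -/
theorem fieldOp_comm (β β' : ι → ι → R) (i j : ι) :
    fieldOp β β' i * fieldOp β β' j = fieldOp β β' j * fieldOp β β' i +
      (∑ k, (β i k * β' j k - β j k * β' i k)) • 1 := by
  classical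
  refine LinearMap.ext fun p => ?_
  simp only [Module.End.mul_apply, LinearMap.add_apply, fieldOp_apply, map_add,
    Derivation.leibniz, annihilate_creator, annihilate_comm β i j, LinearMap.smul_apply,
    Module.End.one_apply, Finset.sum_sub_distrib, smul_eq_C_mul, eq_comm (a := i), smul_eq_mul,
    map_sub]
  ring

theorem map_fieldOp {S : Type*} [CommRing S] (φ : R →+* S) (β β' : ι → ι → R) (i : ι)
    (p : MvPolynomial (ι ⊕ ι) R) :
    map φ (fieldOp β β' i p) =
      fieldOp (fun a b => φ (β a b)) (fun a b => φ (β' a b)) i (map φ p) := by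
  simp only [fieldOp_apply, annihilate_apply, creator, smul_eq_C_mul, map_add, map_mul,
    map_sum, map_C, map_X, pderiv_map]

theorem map_vacuumExp {S : Type*} [CommRing S] (φ : R →+* S) (β β' : ι → ι → R) (L : List ι) :
    φ (vacuumExp β β' L) = vacuumExp (fun a b => φ (β a b)) (fun a b => φ (β' a b)) L := by
  have : map φ ((L.map (fieldOp β β')).prod 1) =
      (L.map (fieldOp (fun a b => φ (β a b)) (fun a b => φ (β' a b)))).prod 1 := by
    induction L with
    | nil => simp
    | cons i L ih =>
      simp only [List.map_cons, List.prod_cons, Module.End.mul_apply, map_fieldOp, ih]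
  rw [vacuumExp, vacuumExp, ← this, constantCoeff_map]

theorem vacuumExp_append_swap (β β' : ι → ι → R) (u v : List ι) (i j : ι) :
    vacuumExp β β' (u ++ i :: j :: v) = vacuumExp β β' (u ++ j :: i :: v) +
      (∑ k, (β i k * β' j k - β j k * β' i k)) * vacuumExp β β' (u ++ v) := by
  simp only [vacuumExp, List.map_append, List.prod_append, List.map_cons, List.prod_cons]
  rw [← mul_assoc (fieldOp β β' i), fieldOp_comm]
  simp only [add_mul, mul_add, mul_assoc, LinearMap.add_apply, map_add, smul_mul_assoc, one_mul,
    mul_smul_comm, LinearMap.smul_apply]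
  rw [smul_eq_C_mul, map_mul, constantCoeff_C]

/-- On top degree, the part of `ŷ_L 1` in the variables `z'` is the monomial `z'_L`. -/
theorem coeff_fieldOp_prod [DecidableEq ι] (β β' : ι → ι → R) (L : List ι) :
    (∀ u : (ι ⊕ ι) →₀ ℕ, L.length < u.degree → coeff u ((L.map (fieldOp β β')).prod 1) = 0) ∧
    ∀ t : Multiset ι, L.length ≤ t.card →
      coeff (Multiset.toFinsupp (t.map Sum.inr)) ((L.map (fieldOp β β')).prod 1) =
        if t = L then 1 else 0 := by
  classical
  induction L with
  | nil =>
    refine ⟨fun u hu => ?_, fun t _ => ?_⟩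
    · have : u ≠ 0 := by rintro rfl; simp at hu
      simp [coeff_one, this.symm]
    · by_cases h : t = 0
      · simp [h]
      · have : (0 : (ι ⊕ ι) →₀ ℕ) ≠ Multiset.toFinsupp (t.map Sum.inr) := by
          intro h'
          have := congrArg Finsupp.toMultiset h'
          simp at this
          exact h this
        simp [coeff_one, h, this]
  | cons i L ih =>
    set p := (L.map (fieldOp β β')).prod 1 with hp
    have hexp : ((i :: L).map (fieldOp β β')).prod 1 = fieldOp β β' i p := by
      simp [hp, Module.End.mul_apply]
    have hder : ∀ (u : (ι ⊕ ι) →₀ ℕ) s, L.length ≤ u.degree → coeff u (pderiv s p) = 0 := by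
      intro u s hu
      rw [coeff_pderiv, ih.1, zero_mul]
      simp [map_add]
      omega
    have hann : ∀ (u : (ι ⊕ ι) →₀ ℕ), L.length ≤ u.degree → coeff u (annihilate β i p) = 0 := by
      intro u hu
      simp [annihilate_apply, coeff_sum, hder _ _ hu]
    rw [hexp]
    have hdeg : ∀ (u : (ι ⊕ ι) →₀ ℕ) s, s ∈ u.support →
        (u - Finsupp.single s 1).degree + 1 = u.degree := by
      intro u s hs
      have h1 : Finsupp.single s 1 ≤ u := by
        rw [Finsupp.single_le_iff]
        have := Finsupp.mem_support_iff.1 hs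
        omega
      conv_rhs => rw [← tsub_add_cancel_of_le h1]
      simp [map_add]
    refine ⟨fun u hu => ?_, fun t ht => ?_⟩
    · have hu' : L.length + 1 < u.degree := by simpa using hu
      have hX : ∀ s, coeff u (X s * p) = 0 := by
        intro s
        rw [coeff_X_mul']
        split_ifs with hs
        · exact ih.1 _ (by have := hdeg u s hs; omega)
        · rfl
      simp [fieldOp_apply, hann u (by omega), creator, add_mul, Finset.sum_mul, coeff_sum, hX]
    · have ht' : L.length + 1 ≤ t.card := by simpa using ht
      have hdt : (Multiset.toFinsupp (t.map (Sum.inr : ι → ι ⊕ ι))).degree = t.card := by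
        have := Finsupp.card_toMultiset (Multiset.toFinsupp (t.map (Sum.inr : ι → ι ⊕ ι)))
        simp only [Multiset.toFinsupp_toMultiset, Multiset.card_map] at this
        rw [this]; rfl
      have hl : ∀ k, coeff (Multiset.toFinsupp (t.map Sum.inr)) (X (Sum.inl k) * p) = 0 := by
        intro k
        rw [coeff_X_mul', if_neg]
        simp
      have hr : coeff (Multiset.toFinsupp (t.map Sum.inr)) (X (Sum.inr i) * p) =
          if t = (i :: L : List ι) then 1 else 0 := by
        rw [coeff_X_mul']
        by_cases hi : i ∈ t
        · obtain ⟨t', rfl⟩ := Multiset.exists_cons_of_mem hi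
          have h1 : Multiset.toFinsupp ((i ::ₘ t').map (Sum.inr : ι → ι ⊕ ι)) -
              Finsupp.single (Sum.inr i) 1 = Multiset.toFinsupp (t'.map Sum.inr) := by
            rw [Multiset.map_cons, ← Multiset.singleton_add, Multiset.toFinsupp_add,
              Multiset.toFinsupp_singleton, add_tsub_cancel_left]
          rw [h1, ih.2 t' (by simpa using ht'), if_pos (by simp)]
          simp only [← Multiset.cons_coe, Multiset.cons_inj_right]
        · rw [if_neg (by simpa using hi), if_neg]
          rintro rfl
          simp at hi
      have ha := hann (Multiset.toFinsupp (t.map Sum.inr)) (by omega)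
      simp [fieldOp_apply, ha, creator, add_mul, Finset.sum_mul, coeff_sum,
        hl, hr]

end Fock

section FockInner

open MvPolynomial
open scoped ComplexConjugate ComplexOrder Nat

variable {σ : Type*}

/-- The factorial `s! = ∏ᵢ sᵢ!` of a multi-index. -/
def multiFactorial (s : σ →₀ ℕ) : ℕ := s.prod fun _ n => n !

theorem multiFactorial_pos (s : σ →₀ ℕ) : 0 < multiFactorial s :=
  Finset.prod_pos fun _ _ => Nat.factorial_pos _

theorem multiFactorial_add_single (s : σ →₀ ℕ) (k : σ) :
    multiFactorial (s + Finsupp.single k 1) = multiFactorial s * (s k + 1) := by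
  classical
  have h : ∀ u : σ →₀ ℕ, u.support ⊆ insert k s.support →
      multiFactorial u = (u k)! * ∏ i ∈ s.support.erase k, (u i)! := by
    intro u hu
    rw [multiFactorial, Finsupp.prod_of_support_subset _ hu _ (by simp),
      ← Finset.insert_erase (Finset.mem_insert_self k s.support),
      Finset.prod_insert (by simp), Finset.erase_insert_eq_erase]
  rw [h s (Finset.subset_insert _ _), h (s + Finsupp.single k 1)]
  · have : ∀ i ∈ s.support.erase k, ((s + Finsupp.single k 1 : σ →₀ ℕ) i)! = (s i)! := by
      intro i hi
      simp [Finsupp.single_eq_of_ne (Finset.ne_of_mem_erase hi)]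
    rw [Finset.prod_congr rfl this]
    simp [Nat.factorial_succ]
    ring
  · intro i hi
    by_cases hik : i = k
    · simp [hik]
    · simpa [Finsupp.single_eq_of_ne hik, hik] using hi

/-- The inner product of the bosonic Fock space: distinct monomials are orthogonal, and the square
norm of `z ^ s` is `s!`. -/
noncomputable def fockInner (p q : MvPolynomial σ ℂ) : ℂ :=
  ∑ s ∈ p.support, (multiFactorial s : ℂ) * conj (coeff s p) * coeff s q

theorem fockInner_eq_sum {p q : MvPolynomial σ ℂ} {S : Finset (σ →₀ ℕ)} (h : p.support ⊆ S) :
    fockInner p q = ∑ s ∈ S, (multiFactorial s : ℂ) * conj (coeff s p) * coeff s q := by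
  refine Finset.sum_subset h fun s _ hs => ?_
  simp [notMem_support_iff.1 hs]

theorem fockInner_add_left (p p' q : MvPolynomial σ ℂ) :
    fockInner (p + p') q = fockInner p q + fockInner p' q := by
  classical
  rw [fockInner_eq_sum (support_add (p := p) (q := p')),
    fockInner_eq_sum (p := p) Finset.subset_union_left,
    fockInner_eq_sum (p := p') Finset.subset_union_right, ← Finset.sum_add_distrib]
  refine Finset.sum_congr rfl fun s _ => ?_
  simp
  ring

theorem fockInner_add_right (p q q' : MvPolynomial σ ℂ) :
    fockInner p (q + q') = fockInner p q + fockInner p q' := by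
  simp [fockInner, mul_add, Finset.sum_add_distrib]

theorem fockInner_smul_right (c : ℂ) (p q : MvPolynomial σ ℂ) :
    fockInner p (c • q) = c * fockInner p q := by
  simp only [fockInner, Finset.mul_sum, coeff_smul, smul_eq_mul]
  exact Finset.sum_congr rfl fun s _ => by ring

theorem fockInner_conj_symm (p q : MvPolynomial σ ℂ) : conj (fockInner p q) = fockInner q p := by
  classical
  rw [fockInner_eq_sum (p := p) (q := q) Finset.subset_union_left,
    fockInner_eq_sum (p := q) (q := p) (Finset.subset_union_right (s₁ := p.support)), map_sum]
  refine Finset.sum_congr rfl fun s _ => ?_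
  simp
  ring

theorem fockInner_smul_left (c : ℂ) (p q : MvPolynomial σ ℂ) :
    fockInner (c • p) q = conj c * fockInner p q := by
  rw [← fockInner_conj_symm, fockInner_smul_right, map_mul, fockInner_conj_symm]

theorem fockInner_sum_left {κ : Type*} (S : Finset κ) (p : κ → MvPolynomial σ ℂ)
    (q : MvPolynomial σ ℂ) : fockInner (∑ k ∈ S, p k) q = ∑ k ∈ S, fockInner (p k) q := by
  classical
  induction S using Finset.induction_on with
  | empty => simp [fockInner]
  | insert k S hk ih => rw [Finset.sum_insert hk, Finset.sum_insert hk, fockInner_add_left, ih]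

theorem fockInner_sum_right {κ : Type*} (S : Finset κ) (p : MvPolynomial σ ℂ)
    (q : κ → MvPolynomial σ ℂ) : fockInner p (∑ k ∈ S, q k) = ∑ k ∈ S, fockInner p (q k) := by
  rw [← fockInner_conj_symm, fockInner_sum_left, map_sum]
  simp [fockInner_conj_symm]

theorem fockInner_one_left (p : MvPolynomial σ ℂ) : fockInner 1 p = constantCoeff p := by
  classical
  have h : (1 : MvPolynomial σ ℂ).support = {0} := support_one
  rw [fockInner, h]
  simp [multiFactorial, constantCoeff_eq]

/-- Multiplication by a variable is adjoint to the derivative. -/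
theorem fockInner_X_mul (k : σ) (p q : MvPolynomial σ ℂ) :
    fockInner (X k * p) q = fockInner p (pderiv k q) := by
  classical
  have hmon : ∀ (s : σ →₀ ℕ) (a : ℂ) (q : MvPolynomial σ ℂ),
      fockInner (monomial s a) q = (multiFactorial s : ℂ) * conj a * coeff s q := by
    intro s a q
    rw [fockInner_eq_sum support_monomial_subset]
    simp
  induction p using MvPolynomial.induction_on' with
  | monomial s a =>
    have : X k * monomial s a = monomial (s + Finsupp.single k 1) a := by
      rw [X, monomial_mul, one_mul, add_comm]
    rw [this, hmon, hmon, coeff_pderiv, multiFactorial_add_single]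
    push_cast
    ring
  | add p p' hp hp' => rw [mul_add, fockInner_add_left, hp, hp', fockInner_add_left]

theorem fockInner_self_eq (p : MvPolynomial σ ℂ) :
    fockInner p p = ((∑ s ∈ p.support, (multiFactorial s : ℝ) * ‖coeff s p‖ ^ 2 : ℝ) : ℂ) := by
  rw [fockInner]
  push_cast
  refine Finset.sum_congr rfl fun s _ => ?_
  rw [mul_assoc, Complex.conj_mul']

theorem fockInner_self_pos {p : MvPolynomial σ ℂ} (hp : p ≠ 0) : 0 < fockInner p p := by
  rw [fockInner_self_eq, Complex.zero_lt_real]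
  refine Finset.sum_pos (fun s hs => ?_) (support_nonempty.2 hp)
  have := multiFactorial_pos s
  have h2 : 0 < ‖coeff s p‖ := norm_pos_iff.2 (mem_support_iff.1 hs)
  positivity

variable {ι : Type*} [Fintype ι]

/-- The field operators are symmetric. -/
theorem fockInner_fieldOp (β : ι → ι → ℂ) (i : ι) (p q : MvPolynomial (ι ⊕ ι) ℂ) :
    fockInner (fieldOp β (fun a b => conj (β a b)) i p) q =
      fockInner p (fieldOp β (fun a b => conj (β a b)) i q) := by
  have key : ∀ p q : MvPolynomial (ι ⊕ ι) ℂ,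
      fockInner (creator (fun a b => conj (β a b)) i * p) q = fockInner p (annihilate β i q) := by
    intro p q
    simp only [creator, annihilate_apply, add_mul, Finset.sum_mul, fockInner_add_left,
      fockInner_sum_left, fockInner_add_right, fockInner_sum_right, smul_mul_assoc,
      fockInner_smul_left, fockInner_smul_right, fockInner_X_mul, Complex.conj_conj]
  rw [fieldOp_apply, fieldOp_apply, fockInner_add_left, fockInner_add_right, key,
    ← fockInner_conj_symm, ← key, fockInner_conj_symm, add_comm]

theorem vacuumExp_reverse_append (β : ι → ι → ℂ) (L L' : List ι) :
    vacuumExp β (fun a b => conj (β a b)) (L.reverse ++ L') =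
      fockInner ((L.map (fieldOp β (fun a b => conj (β a b)))).prod 1)
        ((L'.map (fieldOp β (fun a b => conj (β a b)))).prod 1) := by
  induction L generalizing L' with
  | nil => simp [vacuumExp, fockInner_one_left]
  | cons i L ih =>
    rw [List.reverse_cons, List.append_assoc, ih]
    simp only [List.map_append, List.prod_append, List.map_cons, List.prod_cons,
      Module.End.mul_apply, fockInner_fieldOp, List.map_nil, List.prod_nil, Module.End.one_apply]

/-- The vacuum state is faithful on linear combinations of words that are pairwise different as
multisets. -/
theorem sum_vacuumExp_pos (β : ι → ι → ℂ) (w : Multiset ι → List ι)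
    (hw : ∀ s, (w s : Multiset ι) = s) (S : Finset (Multiset ι)) (c : Multiset ι → ℂ)
    (hc : ∃ s ∈ S, c s ≠ 0) :
    0 < ∑ s ∈ S, ∑ t ∈ S, conj (c s) * c t *
      vacuumExp β (fun a b => conj (β a b)) ((w s).reverse ++ w t) := by
  classical
  set v : Multiset ι → MvPolynomial (ι ⊕ ι) ℂ := fun s =>
    ((w s).map (fieldOp β (fun a b => conj (β a b)))).prod 1 with hv
  have hsum : ∑ s ∈ S, ∑ t ∈ S, conj (c s) * c t *
      vacuumExp β (fun a b => conj (β a b)) ((w s).reverse ++ w t) =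
      fockInner (∑ s ∈ S, c s • v s) (∑ s ∈ S, c s • v s) := by
    simp only [fockInner_sum_left]
    simp only [fockInner_sum_right, fockInner_smul_left, fockInner_smul_right,
      vacuumExp_reverse_append, hv]
    exact Finset.sum_congr rfl fun s _ => Finset.sum_congr rfl fun t _ => by ring
  rw [hsum]
  refine fockInner_self_pos fun h0 => ?_
  -- a multiset of maximal size among those with nonzero coefficient
  obtain ⟨s, hs, hmax⟩ := Finset.exists_max_image (S.filter fun s => c s ≠ 0) Multiset.card
    (by obtain ⟨s, hs, hcs⟩ := hc; exact ⟨s, by simp [hs, hcs]⟩)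
  rw [Finset.mem_filter] at hs
  have hz : ∀ t ∈ S, c t * coeff (Multiset.toFinsupp (s.map Sum.inr)) (v t) =
      if t = s then c s else 0 := by
    intro t ht
    by_cases hct : c t = 0
    · rw [hct, zero_mul]
      split_ifs with hts
      · rw [← hts, hct]
      · rfl
    · have hlen : (w t).length = t.card := by
        conv_rhs => rw [← hw t]
        rfl
      rw [(coeff_fieldOp_prod β _ (w t)).2 s (by rw [hlen]; exact hmax t (by simp [ht, hct])), hw]
      by_cases hts : t = s
      · simp [hts]
      · simp [hts, Ne.symm hts]
  have := congrArg (coeff (Multiset.toFinsupp (s.map Sum.inr))) h0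
  rw [coeff_sum] at this
  simp only [coeff_smul, smul_eq_mul, coeff_zero] at this
  rw [Finset.sum_congr rfl hz, Finset.sum_ite_eq' S s, if_pos hs.1] at this
  exact hs.2 this

end FockInner

section Word

variable {W ι : Type*} [Monoid W]

/-- The product of the `y i` along a list. -/
def word (y : ι → W) (L : List ι) : W := (L.map y).prod

theorem word_append (y : ι → W) (L L' : List ι) :
    word y (L ++ L') = word y L * word y L' := by simp [word]

theorem word_cons (y : ι → W) (i : ι) (L : List ι) :
    word y (i :: L) = y i * word y L := by simp [word]

end Word

/-! ### The filtration at a point of a formal deformation -/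

section Filtration

open scoped ComplexConjugate ComplexOrder

variable {W : Type*} [Ring W] [Algebra ℂ W]

/-- The filtration generated by giving elements of the ideal `J` degree `1` and the central
element `l` degree `2`. -/
def filt (l : W) (J : Submodule ℂ W) : ℕ → Submodule ℂ W
  | 0 => ⊤
  | 1 => J
  | d + 2 => J * filt l J (d + 1) ⊔ (filt l J d).map (LinearMap.mulLeft ℂ l)

/-- A point of a formal deformation with ring `W` and formal parameter `l`: `J` plays the role of
the ideal of elements whose classical limit vanishes at the point, and `y` that of a system of
real coordinates centred at the point, with Poisson tensor `κ` at the point (up to a factor). -/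
structure FormalPoint [StarRing W] {ι : Type*} (l : W) (J : Submodule ℂ W) (y : ι → W)
    (κ : ι → ι → ℂ) : Prop where
  comm_l : ∀ a, l * a = a * l
  star_l : star l = l
  star_smul : ∀ (c : ℂ) (a : W), star (c • a) = conj c • star a
  mul_mem_left : ∀ a b, b ∈ J → a * b ∈ J
  mul_mem_right : ∀ a b, a ∈ J → a * b ∈ J
  l_mem : l ∈ J
  star_mem : ∀ a ∈ J, star a ∈ J
  sub_smul_one_mem : ∀ a, ∃ c : ℂ, a - c • 1 ∈ J
  comm : ∀ a b, ∃ c, a * b - b * a = l * c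
  y_mem : ∀ i, y i ∈ J
  star_y : ∀ i, star (y i) = y i
  y_comm : ∀ i j, ∃ c ∈ J, y i * y j - y j * y i = l * (κ i j • 1 + c)
  le_span : J ≤ Submodule.span ℂ (Set.range y) ⊔ filt l J 2

/-- The span of the words of filtration degree `d` that are ordered according to `w`. -/
def orderedWords {ι : Type*} (l : W) (y : ι → W) (w : Multiset ι → List ι) (d : ℕ) :
    Submodule ℂ W :=
  Submodule.span ℂ ((fun s => l ^ ((d - s.card) / 2) * word y (w s)) ''
    {s : Multiset ι | ∃ j, 2 * j + s.card = d})

theorem l_mul_mem_filt {l : W} {J : Submodule ℂ W} {d : ℕ} {a : W} (ha : a ∈ filt l J d) :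
    l * a ∈ filt l J (d + 2) :=
  Submodule.mem_sup_right ⟨a, ha, rfl⟩

theorem mem_orderedWords {ι : Type*} {l : W} {y : ι → W} {w : Multiset ι → List ι}
    {s : Multiset ι} {d j : ℕ} (hj : 2 * j + s.card = d) :
    l ^ j * word y (w s) ∈ orderedWords l y w d := by
  refine Submodule.subset_span ⟨s, ⟨j, hj⟩, ?_⟩
  simp [show (d - s.card) / 2 = j by omega]

theorem l_pow_mul_mem_filt {l : W} {J : Submodule ℂ W} (j : ℕ) {d : ℕ} {a : W}
    (ha : a ∈ filt l J d) :
    l ^ j * a ∈ filt l J (2 * j + d) := by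
  induction j with
  | zero => simpa using ha
  | succ j ih =>
    rw [pow_succ', mul_assoc, show 2 * (j + 1) + d = 2 * j + d + 2 by ring]
    exact l_mul_mem_filt ih

theorem l_mul_mem_orderedWords {ι : Type*} {l : W} {y : ι → W} {w : Multiset ι → List ι}
    {d : ℕ} {a : W} (ha : a ∈ orderedWords l y w d) : l * a ∈ orderedWords l y w (d + 2) := by
  refine Submodule.span_induction (p := fun a _ => l * a ∈ orderedWords l y w (d + 2))
    ?_ (by simp) (fun a b _ _ ha hb => by rw [mul_add]; exact add_mem ha hb)
    (fun c a _ ha => by rw [mul_smul_comm]; exact Submodule.smul_mem _ _ ha) ha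
  rintro _ ⟨s, ⟨j, hj⟩, rfl⟩
  simp only
  rw [← mul_assoc, ← pow_succ']
  exact mem_orderedWords (by omega)

namespace FormalPoint

variable [StarRing W] {ι : Type*} {l : W} {J : Submodule ℂ W} {y : ι → W} {κ : ι → ι → ℂ}
  (h : FormalPoint l J y κ)

include h

theorem l_pow_comm (j : ℕ) (a : W) : l ^ j * a = a * l ^ j :=
  (Commute.pow_left (h.comm_l a) j)

theorem filt_le_ideal (d : ℕ) : filt l J (d + 1) ≤ J := by
  induction d using Nat.strong_induction_on with
  | _ d ih =>
    rcases d with _ | d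
    · exact le_rfl
    · refine sup_le (Submodule.mul_le.2 fun a ha b _ => h.mul_mem_right a b ha) ?_
      rintro _ ⟨a, _, rfl⟩
      exact h.mul_mem_right _ _ h.l_mem

theorem ideal_mul_mem {d : ℕ} {a b : W} (ha : a ∈ J) (hb : b ∈ filt l J d) :
    a * b ∈ filt l J (d + 1) := by
  rcases d with _ | d
  · exact h.mul_mem_right _ _ ha
  · exact Submodule.mem_sup_left (Submodule.mul_mem_mul ha hb)

theorem mul_filt_mem {d : ℕ} (a : W) {b : W} (hb : b ∈ filt l J d) : a * b ∈ filt l J d := by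
  induction d using Nat.strong_induction_on generalizing a b with
  | _ d ih =>
    rcases d with _ | _ | d
    · trivial
    · exact h.mul_mem_left _ _ hb
    · obtain ⟨b₁, hb₁, b₂, ⟨c, hc, rfl⟩, rfl⟩ := Submodule.mem_sup.1 hb
      rw [mul_add]
      refine add_mem ?_ ?_
      · refine Submodule.mul_induction_on hb₁ (fun p hp q hq => ?_) fun p q hp hq => ?_
        · rw [← mul_assoc]
          exact h.ideal_mul_mem (h.mul_mem_left _ _ hp) hq
        · rw [mul_add]; exact add_mem hp hq
      · rw [LinearMap.mulLeft_apply, ← mul_assoc, ← h.comm_l, mul_assoc]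
        exact l_mul_mem_filt (ih d (by omega) _ hc)

theorem filt_mul_mem {i j : ℕ} {a b : W} (ha : a ∈ filt l J i) (hb : b ∈ filt l J j) :
    a * b ∈ filt l J (i + j) := by
  induction i using Nat.strong_induction_on generalizing a j b with
  | _ i ih =>
    rcases i with _ | _ | i
    · rw [zero_add]; exact h.mul_filt_mem _ hb
    · rw [zero_add, add_comm]; exact h.ideal_mul_mem ha hb
    · obtain ⟨a₁, ha₁, a₂, ⟨c, hc, rfl⟩, rfl⟩ := Submodule.mem_sup.1 ha
      rw [add_mul]
      refine add_mem ?_ ?_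
      · refine Submodule.mul_induction_on ha₁ (fun p hp q hq => ?_) fun p q hp hq => ?_
        · rw [mul_assoc]
          have := h.ideal_mul_mem hp (ih (i + 1) (by omega) hq hb)
          rwa [show i + 1 + j + 1 = i + 2 + j by ring] at this
        · rw [add_mul]; exact add_mem hp hq
      · rw [LinearMap.mulLeft_apply, mul_assoc]
        have := l_mul_mem_filt (ih i (by omega) hc hb)
        rwa [show i + j + 2 = i + 2 + j by ring] at this

theorem filt_succ_le (d : ℕ) : filt l J (d + 1) ≤ filt l J d := by
  induction d using Nat.strong_induction_on with
  | _ d ih =>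
    rcases d with _ | _ | d
    · exact le_top
    · exact h.filt_le_ideal 1
    · exact sup_le_sup (mul_le_mul' le_rfl (ih (d + 1) (by omega)))
        (Submodule.map_mono (ih d (by omega)))

theorem filt_antitone : Antitone (filt l J) := antitone_nat_of_succ_le h.filt_succ_le

theorem star_filt {d : ℕ} {a : W} (ha : a ∈ filt l J d) : star a ∈ filt l J d := by
  induction d using Nat.strong_induction_on generalizing a with
  | _ d ih =>
    rcases d with _ | _ | d
    · trivial
    · exact h.star_mem _ ha
    · obtain ⟨a₁, ha₁, a₂, ⟨c, hc, rfl⟩, rfl⟩ := Submodule.mem_sup.1 ha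
      rw [star_add]
      refine add_mem ?_ ?_
      · refine Submodule.mul_induction_on ha₁ (fun p hp q hq => ?_) fun p q hp hq => ?_
        · rw [star_mul]
          exact h.filt_mul_mem (i := d + 1) (j := 1) (ih (d + 1) (by omega) hq) (h.star_mem _ hp)
        · rw [star_add]; exact add_mem hp hq
      · rw [LinearMap.mulLeft_apply, star_mul, h.star_l, ← h.comm_l]
        exact l_mul_mem_filt (ih d (by omega) hc)

theorem word_mem (L : List ι) : word y L ∈ filt l J L.length := by
  induction L with
  | nil => trivial
  | cons i L ih => rw [word_cons]; exact h.ideal_mul_mem (h.y_mem i) ih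

theorem star_word (L : List ι) : star (word y L) = word y L.reverse := by
  induction L with
  | nil => simp [word]
  | cons i L ih =>
    rw [word_cons, star_mul, ih, h.star_y, List.reverse_cons, word_append]
    simp [word]

/-- Reordering a word changes it by `l` times an element of degree lower by two. -/
theorem word_perm {L L' : List ι} (hL : L.Perm L') (u : List ι) :
    ∃ a ∈ filt l J ((u ++ L).length - 2), word y (u ++ L) - word y (u ++ L') = l * a := by
  induction hL generalizing u with
  | nil => exact ⟨0, zero_mem _, by simp⟩
  | @cons i L L' _ ih => simpa using ih (u ++ [i])
  | swap i j v =>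
    obtain ⟨c, hc⟩ := h.comm (y j) (y i)
    refine ⟨word y u * (c * word y v), ?_, ?_⟩
    · have := h.filt_mul_mem (h.word_mem u)
        (h.filt_mul_mem (i := 0) (a := c) trivial (h.word_mem v))
      simpa [show u.length + (v.length + 1 + 1) - 2 = u.length + v.length by omega] using this
    · rw [← mul_assoc, h.comm_l, mul_assoc, ← mul_assoc l, ← hc]
      simp only [word_append, word_cons]
      noncomm_ring
  | trans h₁ _ ih₁ ih₂ =>
    obtain ⟨a, ha, ha'⟩ := ih₁ u
    obtain ⟨b, hb, hb'⟩ := ih₂ u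
    refine ⟨a + b, add_mem ha ?_, by rw [mul_add, ← ha', ← hb']; abel⟩
    rwa [List.length_append, ← h₁.length_eq, ← List.length_append] at hb

/-- Modulo higher degree, the filtration is spanned by ordered words. -/
theorem filt_le {w : Multiset ι → List ι} (hw : ∀ s, (w s : Multiset ι) = s) (d : ℕ) :
    filt l J d ≤ orderedWords l y w d ⊔ filt l J (d + 1) := by
  have hlen : ∀ s, (w s).length = s.card := fun s => by
    conv_rhs => rw [← hw s]
    rfl
  have hw0 : w 0 = [] := by
    rw [← List.length_eq_zero_iff, hlen, Multiset.card_zero]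
  have hw1 : ∀ i, w {i} = [i] := fun i => by
    have := hw {i}
    rwa [Multiset.coe_eq_singleton] at this
  induction d using Nat.strong_induction_on with
  | _ d ih =>
    rcases d with _ | _ | d
    · intro a _
      obtain ⟨c, hc⟩ := h.sub_smul_one_mem a
      refine Submodule.mem_sup.2 ⟨c • 1, ?_, a - c • 1, hc, by abel⟩
      refine Submodule.smul_mem _ _ ?_
      have := mem_orderedWords (l := l) (y := y) (w := w) (s := 0) (d := 0) (j := 0) (by simp)
      simpa [hw0, word] using this
    · refine h.le_span.trans (sup_le_sup_right (Submodule.span_le.2 ?_) _)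
      rintro _ ⟨i, rfl⟩
      have := mem_orderedWords (l := l) (y := y) (w := w) (s := {i}) (d := 1) (j := 0) (by simp)
      simpa [hw1, word] using this
    · have hl : ∀ a ∈ filt l J d, l * a ∈ orderedWords l y w (d + 2) ⊔ filt l J (d + 3) := by
        intro a ha
        obtain ⟨g, hg, f, hf, rfl⟩ := Submodule.mem_sup.1 (ih d (by omega) ha)
        rw [mul_add]
        exact add_mem (Submodule.mem_sup_left (l_mul_mem_orderedWords hg))
          (Submodule.mem_sup_right (l_mul_mem_filt hf))
      refine sup_le (Submodule.mul_le.2 fun a ha b hb => ?_) ?_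
      · -- replace `a` and `b` by their leading parts
        obtain ⟨a₁, ha₁, a₂, ha₂, rfl⟩ := Submodule.mem_sup.1 (h.le_span ha)
        obtain ⟨b₁, hb₁, b₂, hb₂, rfl⟩ := Submodule.mem_sup.1 (ih (d + 1) (by omega) hb)
        have ha₁J : a₁ ∈ J := by
          have := sub_mem ha (h.filt_le_ideal 1 ha₂)
          simpa using this
        have e : (a₁ + a₂) * (b₁ + b₂) = a₁ * b₁ + (a₁ * b₂ + a₂ * (b₁ + b₂)) := by
          noncomm_ring
        rw [e]
        refine add_mem ?_ (Submodule.mem_sup_right (add_mem (h.ideal_mul_mem ha₁J hb₂) ?_))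
        swap
        · have := h.filt_mul_mem ha₂ hb
          rwa [show 2 + (d + 1) = d + 3 by ring] at this
        clear ha hb e
        refine Submodule.span_induction (p := fun a _ =>
          a * b₁ ∈ orderedWords l y w (d + 2) ⊔ filt l J (d + 3)) ?_ (by simp)
          (fun a b _ _ ha hb => by rw [add_mul]; exact add_mem ha hb)
          (fun c a _ ha => by rw [smul_mul_assoc]; exact Submodule.smul_mem _ _ ha) ha₁
        rintro _ ⟨i, rfl⟩
        refine Submodule.span_induction (p := fun b _ =>
          y i * b ∈ orderedWords l y w (d + 2) ⊔ filt l J (d + 3)) ?_ (by simp)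
          (fun a b _ _ ha hb => by rw [mul_add]; exact add_mem ha hb)
          (fun c a _ ha => by rw [mul_smul_comm]; exact Submodule.smul_mem _ _ ha) hb₁
        rintro _ ⟨s, ⟨j, hj⟩, rfl⟩
        have hjs : (d + 1 - s.card) / 2 = j := by omega
        simp only [hjs]
        rw [← mul_assoc, ← h.l_pow_comm, mul_assoc, ← word_cons]
        have hperm : (i :: w s).Perm (w (i ::ₘ s)) := by
          rw [← Multiset.coe_eq_coe, hw, ← Multiset.cons_coe, hw]
        obtain ⟨a, ha, hdiff⟩ := h.word_perm hperm []
        simp only [List.nil_append, List.length_cons, hlen] at ha hdiff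
        rw [sub_eq_iff_eq_add.1 hdiff, mul_add, ← mul_assoc, ← pow_succ, pow_succ', mul_assoc]
        refine add_mem ?_ (Submodule.mem_sup_left (mem_orderedWords (by simp; omega)))
        rcases Nat.eq_zero_or_pos s.card with h0 | h0
        · refine Submodule.mem_sup_right (h.filt_antitone ?_
            (l_mul_mem_filt (l_pow_mul_mem_filt j ha)))
          omega
        · refine hl _ ?_
          have := l_pow_mul_mem_filt j ha
          rwa [show 2 * j + (s.card + 1 - 2) = d by omega] at this
      · rintro _ ⟨a, ha, rfl⟩
        exact hl a ha

theorem orderedWords_le_filt {w : Multiset ι → List ι} (hw : ∀ s, (w s : Multiset ι) = s) (d : ℕ) :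
    orderedWords l y w d ≤ filt l J d := by
  refine Submodule.span_le.2 ?_
  rintro _ ⟨s, ⟨j, hj⟩, rfl⟩
  have hlen : (w s).length = s.card := by
    conv_rhs => rw [← hw s]
    rfl
  have := l_pow_mul_mem_filt j (h.word_mem (w s))
  rw [hlen, hj] at this
  simpa [show (d - s.card) / 2 = j by omega] using this

end FormalPoint

end Filtration

/-! ### Positivity of quasi-free functionals -/

section State

open scoped ComplexConjugate ComplexOrder

variable {W : Type*} [Ring W] [Algebra ℂ W]

/-- A `ℂ[[λ]]`-linear functional on `W` whose leading part at the point given by `J` and `y` is the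
quasi-free state `vacuumExp β (conj β)`; `w` chooses an ordering of each multiset of indices. -/
structure IsQuasiFree {ι : Type*} [Fintype ι] (l : W) (J : Submodule ℂ W) (y : ι → W)
    (w : Multiset ι → List ι) (β : ι → ι → ℂ) (ψ : W →ₗ[ℂ] ℂ⟦X⟧) : Prop where
  map_l_mul : ∀ a, ψ (l * a) = PowerSeries.X * ψ a
  continuous : ∀ r, ∃ N, ∀ a ∈ filt l J N, PowerSeries.coeff r (ψ a) = 0
  coeff_lt : ∀ s r, 2 * r < s.card → PowerSeries.coeff r (ψ (word y (w s))) = 0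
  coeff_eq : ∀ s r, 2 * r = s.card →
    PowerSeries.coeff r (ψ (word y (w s))) = vacuumExp β (fun a b => conj (β a b)) (w s)

namespace IsQuasiFree

variable [StarRing W] {ι : Type*} [Fintype ι] {l : W} {J : Submodule ℂ W} {y : ι → W}
  {w : Multiset ι → List ι} {β : ι → ι → ℂ} {ψ : W →ₗ[ℂ] ℂ⟦X⟧} {κ : ι → ι → ℂ}

omit [StarRing W] in
theorem map_l_pow_mul (hψ : IsQuasiFree l J y w β ψ) (j : ℕ) (a : W) :
    ψ (l ^ j * a) = PowerSeries.X ^ j * ψ a := by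
  induction j with
  | zero => simp
  | succ j ih => rw [pow_succ', mul_assoc, hψ.map_l_mul, ih, pow_succ', mul_assoc]

/-- Elements of degree `d` have expectation values of order at least `d / 2`. -/
theorem coeff_eq_zero (hψ : IsQuasiFree l J y w β ψ) (h : FormalPoint l J y κ)
    (hw : ∀ s, (w s : Multiset ι) = s) {r d : ℕ} (hd : 2 * r < d) {a : W}
    (ha : a ∈ filt l J d) : PowerSeries.coeff r (ψ a) = 0 := by
  induction r using Nat.strong_induction_on generalizing d a with
  | _ r ih =>
    obtain ⟨N, hN⟩ := hψ.continuous r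
    -- push the degree up to `N`, one ordered layer at a time
    induction hk : N - d generalizing d a with
    | zero => exact hN a (h.filt_antitone (by omega) ha)
    | succ k ihk =>
      obtain ⟨g, hg, f, hf, rfl⟩ := Submodule.mem_sup.1 (h.filt_le hw d ha)
      rw [map_add, map_add, ihk (by omega) hf (by omega), add_zero]
      refine Submodule.span_induction (p := fun g _ => PowerSeries.coeff r (ψ g) = 0) ?_ (by simp)
        (fun a b _ _ ha hb => by rw [map_add, map_add, ha, hb, add_zero])
        (fun c a _ ha => by rw [map_smul, map_smul, ha, smul_zero]) hg
      rintro _ ⟨s, ⟨j, hj⟩, rfl⟩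
      have hlen : (w s).length = s.card := by
        conv_rhs => rw [← hw s]
        rfl
      simp only [show (d - s.card) / 2 = j by omega]
      rcases j with _ | j
      · rw [pow_zero, one_mul]
        exact hψ.coeff_lt s r (by omega)
      · rw [pow_succ', mul_assoc, hψ.map_l_mul]
        rcases r with _ | r
        · simp
        · rw [PowerSeries.coeff_succ_X_mul]
          refine ih r (by omega) (d := d - 2) (by omega) ?_
          have := l_pow_mul_mem_filt j (h.word_mem (w s))
          rwa [hlen, show 2 * j + s.card = d - 2 by omega] at this

/-- The leading part of `ψ` on words in any order is given by the vacuum expectation values. -/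
theorem coeff_word (hψ : IsQuasiFree l J y w β ψ) (h : FormalPoint l J y κ)
    (hw : ∀ s, (w s : Multiset ι) = s)
    (hκ : ∀ i j, κ i j = ∑ k, (β i k * conj (β j k) - β j k * conj (β i k)))
    {r : ℕ} {L : List ι} (hL : L.length = 2 * r) :
    PowerSeries.coeff r (ψ (word y L)) = vacuumExp β (fun a b => conj (β a b)) L := by
  induction r using Nat.strong_induction_on generalizing L with
  | _ r ih =>
    have hperm : ∀ {L L' : List ι}, L.Perm L' → ∀ u, (u ++ L).length = 2 * r →
        PowerSeries.coeff r (ψ (word y (u ++ L))) -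
            vacuumExp β (fun a b => conj (β a b)) (u ++ L) =
          PowerSeries.coeff r (ψ (word y (u ++ L'))) -
            vacuumExp β (fun a b => conj (β a b)) (u ++ L') := by
      intro L L' hLL'
      induction hLL' with
      | nil => intro u _; rfl
      | @cons i L L' _ ih => intro u hu; simpa using ih (u ++ [i]) (by simpa using hu)
      | swap i j v =>
        intro u hu
        obtain ⟨c, hc, hcomm⟩ := h.y_comm j i
        simp only [List.length_append, List.length_cons] at hu
        obtain ⟨r', rfl⟩ : ∃ r', r = r' + 1 := ⟨r - 1, by omega⟩
        have e : word y (u ++ j :: i :: v) = word y (u ++ i :: j :: v) +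
            l * (κ j i • word y (u ++ v) + word y u * (c * word y v)) := by
          have e1 : κ j i • word y (u ++ v) + word y u * (c * word y v) =
              word y u * ((κ j i • 1 + c) * word y v) := by
            rw [add_mul, mul_add, smul_mul_assoc, one_mul, mul_smul_comm, word_append]
          rw [e1, ← mul_assoc l, h.comm_l, mul_assoc (word y u), ← mul_assoc l, ← hcomm]
          simp only [word_append, word_cons]
          noncomm_ring
        have hf : word y u * (c * word y v) ∈ filt l J (2 * r' + 1) := by
          have := h.filt_mul_mem (h.word_mem u) (h.ideal_mul_mem hc (h.word_mem v))
          rwa [show u.length + (v.length + 1) = 2 * r' + 1 by omega] at this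
        rw [e, map_add, map_add, hψ.map_l_mul, PowerSeries.coeff_succ_X_mul, map_add, map_add,
          hψ.coeff_eq_zero h hw (by omega) hf, map_smul, map_smul,
          ih r' (by omega) (L := u ++ v) (by rw [List.length_append]; omega),
          vacuumExp_append_swap, hκ]
        simp only [smul_eq_mul]
        ring
      | trans h₁ _ ih₁ ih₂ =>
        intro u hu
        rw [ih₁ u hu, ih₂ u]
        rwa [List.length_append, ← h₁.length_eq, ← List.length_append]
    have hLw : L.Perm (w L) := by rw [← Multiset.coe_eq_coe, hw]
    have := hperm hLw [] (by simpa using hL)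
    simp only [List.nil_append] at this
    rw [hψ.coeff_eq _ r (by simp [hL]), sub_self] at this
    exact sub_eq_zero.1 this

/-- Strict positivity of the leading part of `ψ`. -/
theorem coeff_star_mul_self_pos (hψ : IsQuasiFree l J y w β ψ) (h : FormalPoint l J y κ)
    (hw : ∀ s, (w s : Multiset ι) = s)
    (hκ : ∀ i j, κ i j = ∑ k, (β i k * conj (β j k) - β j k * conj (β i k)))
    {d : ℕ} {a : W} (ha : a ∈ filt l J d) :
    0 < PowerSeries.coeff d (ψ (star a * a)) ∨ a ∈ filt l J (d + 1) := by
  classical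
  have hlen : ∀ s, (w s).length = s.card := fun s => by
    conv_rhs => rw [← hw s]
    rfl
  obtain ⟨g, hg, f, hf, rfl⟩ := Submodule.mem_sup.1 (h.filt_le hw d ha)
  have hgd := h.orderedWords_le_filt hw d hg
  obtain ⟨c, hc, hcg⟩ := (Finsupp.mem_span_image_iff_linearCombination ℂ).1 hg
  by_cases hc0 : c = 0
  · right
    rw [← hcg, hc0, map_zero, zero_add]
    exact hf
  left
  have e : star (g + f) * (g + f) = star g * g + (star g * f + star f * (g + f)) := by
    rw [star_add]; noncomm_ring
  have hrest : star g * f + star f * (g + f) ∈ filt l J (2 * d + 1) := by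
    refine add_mem ?_ ?_
    · have := h.filt_mul_mem (h.star_filt hgd) hf
      rwa [show d + (d + 1) = 2 * d + 1 by ring] at this
    · have := h.filt_mul_mem (h.star_filt hf) ha
      rwa [show d + 1 + d = 2 * d + 1 by ring] at this
  rw [e, map_add, map_add, hψ.coeff_eq_zero h hw (by omega) hrest, add_zero]
  have hsum : PowerSeries.coeff d (ψ (star g * g)) =
      ∑ s ∈ c.support, ∑ t ∈ c.support, conj (c s) * c t *
        vacuumExp β (fun a b => conj (β a b)) ((w s).reverse ++ w t) := by
    rw [← hcg, Finsupp.linearCombination_apply, Finsupp.sum, star_sum, Finset.sum_mul, map_sum,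
      map_sum]
    refine Finset.sum_congr rfl fun s hs => ?_
    rw [Finset.mul_sum, map_sum, map_sum]
    refine Finset.sum_congr rfl fun t ht => ?_
    obtain ⟨i, hi⟩ := hc hs
    obtain ⟨j, hj⟩ := hc ht
    have e2 : star (c s • (l ^ ((d - s.card) / 2) * word y (w s))) *
        c t • (l ^ ((d - t.card) / 2) * word y (w t)) =
        (conj (c s) * c t) • (l ^ (i + j) * word y ((w s).reverse ++ w t)) := by
      rw [show (d - s.card) / 2 = i by omega, show (d - t.card) / 2 = j by omega, h.star_smul,
        star_mul, h.star_word, star_pow, h.star_l, smul_mul_smul_comm, ← h.l_pow_comm, mul_assoc,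
        ← mul_assoc (word y _), ← h.l_pow_comm, word_append, pow_add, mul_assoc, mul_assoc]
    rw [e2, map_smul, map_smul, hψ.map_l_pow_mul, PowerSeries.coeff_X_pow_mul', if_pos (by omega),
      hψ.coeff_word h hw hκ, smul_eq_mul]
    rw [List.length_append, List.length_reverse, hlen, hlen]
    omega
  rw [hsum]
  refine sum_vacuumExp_pos β w hw c.support c ?_
  obtain ⟨s, hs⟩ := Finsupp.support_nonempty_iff.2 hc0
  exact ⟨s, hs, Finsupp.mem_support_iff.1 hs⟩

/-- A functional with quasi-free leading part is positive in the lexicographic sense. -/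
theorem star_mul_self_nonneg (hψ : IsQuasiFree l J y w β ψ) (h : FormalPoint l J y κ)
    (hw : ∀ s, (w s : Multiset ι) = s)
    (hκ : ∀ i j, κ i j = ∑ k, (β i k * conj (β j k) - β j k * conj (β i k))) (a : W) :
    ψ (star a * a) = 0 ∨ ∃ d, 0 < PowerSeries.coeff d (ψ (star a * a)) ∧
      ∀ r < d, PowerSeries.coeff r (ψ (star a * a)) = 0 := by
  have hmul : ∀ {d}, a ∈ filt l J d → ∀ r < d, PowerSeries.coeff r (ψ (star a * a)) = 0 := by
    intro d ha r hr
    refine hψ.coeff_eq_zero h hw (d := d + d) (by omega) (h.filt_mul_mem (h.star_filt ha) ha)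
  by_cases hall : ∀ d, a ∈ filt l J d
  · left
    ext r
    exact hmul (hall (r + 1)) r (by omega)
  · right
    classical
    push Not at hall
    obtain ⟨d, hd, hmin⟩ : ∃ d, a ∉ filt l J d ∧ ∀ e < d, a ∈ filt l J e :=
      ⟨Nat.find hall, Nat.find_spec hall, fun e he => not_not.1 (Nat.find_min hall he)⟩
    rcases d with _ | d
    · exact absurd trivial hd
    have ha := hmin d (by omega)
    exact ⟨d, (hψ.coeff_star_mul_self_pos h hw hκ ha).resolve_right hd, hmul ha⟩

end IsQuasiFree

end State

/-! ### The deformed algebra as a ring -/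

/-- A Hermitian deformation of a commutative algebra by bidifferential operators for which `1` is
still the unit. -/
structure UnitalStarProduct (A : Type*) [CommRing A] [StarRing A] [Algebra ℂ A] extends
    HermitianDeformation A where
  one_mul : ∀ a : A⟦X⟧, seriesMul C 1 a = a
  mul_one : ∀ a : A⟦X⟧, seriesMul C a 1 = a
  bidiff : ∀ r, IsBidiffOp (C r)

/-- The ring `(A[[λ]], ⋆)`. -/
def StarSeries {A : Type*} [CommRing A] [StarRing A] [Algebra ℂ A] (_D : UnitalStarProduct A) :=
  A⟦X⟧

namespace StarSeries

open scoped ComplexConjugate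

variable {A : Type*} [CommRing A] [StarRing A] [Algebra ℂ A] {D : UnitalStarProduct A}

noncomputable instance : AddCommGroup (StarSeries D) := inferInstanceAs (AddCommGroup A⟦X⟧)

noncomputable instance : Module ℂ (StarSeries D) := inferInstanceAs (Module ℂ A⟦X⟧)

/-- The coefficient of `λᵏ`. -/
noncomputable def coeff (D : UnitalStarProduct A) (k : ℕ) : StarSeries D →ₗ[ℂ] A :=
  (PowerSeries.coeff (R := A) k).restrictScalars ℂ

/-- The series with given coefficients. -/
noncomputable def mk (D : UnitalStarProduct A) (f : ℕ → A) : StarSeries D := PowerSeries.mk f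

@[simp]
theorem coeff_mk (k : ℕ) (f : ℕ → A) : coeff D k (mk D f) = f k := PowerSeries.coeff_mk k f

@[ext]
theorem ext {a b : StarSeries D} (h : ∀ k, coeff D k a = coeff D k b) : a = b :=
  PowerSeries.ext h

noncomputable instance : Mul (StarSeries D) := ⟨fun a b => seriesMul D.C a b⟩

noncomputable instance : One (StarSeries D) := ⟨(1 : A⟦X⟧)⟩

theorem coeff_mul (a b : StarSeries D) (k : ℕ) :
    coeff D k (a * b) = ∑ p ∈ Finset.HasAntidiagonal.antidiagonal k,
      ∑ q ∈ Finset.HasAntidiagonal.antidiagonal p.2,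
        D.C p.1 (coeff D q.1 a) (coeff D q.2 b) :=
  coeff_seriesMul D.C a b k

noncomputable instance : Ring (StarSeries D) :=
  { (inferInstance : AddCommGroup (StarSeries D)) with
    mul := (· * ·)
    one := 1
    left_distrib := fun a b c => ext fun k => by
      change coeff D k (a * (b + c)) = coeff D k (a * b + a * c)
      simp only [map_add, coeff_mul, Finset.sum_add_distrib]
    right_distrib := fun a b c => ext fun k => by
      change coeff D k ((a + b) * c) = coeff D k (a * c + b * c)
      simp only [map_add, coeff_mul, Finset.sum_add_distrib, LinearMap.add_apply]
    zero_mul := fun a => ext fun k => by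
      change coeff D k ((0 : StarSeries D) * a) = coeff D k (0 : StarSeries D)
      simp [coeff_mul]
    mul_zero := fun a => ext fun k => by
      change coeff D k (a * (0 : StarSeries D)) = coeff D k (0 : StarSeries D)
      simp [coeff_mul]
    mul_assoc := D.assoc
    one_mul := D.one_mul
    mul_one := D.mul_one }

theorem coeff_zero_mul (a b : StarSeries D) :
    coeff D 0 (a * b) = coeff D 0 a * coeff D 0 b := by
  simp [coeff_mul, D.C_zero]

noncomputable instance : Algebra ℂ (StarSeries D) :=
  Algebra.ofModule
    (fun c a b => ext fun k => by
      simp only [coeff_mul, map_smul, LinearMap.smul_apply, Finset.smul_sum])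
    (fun c a b => ext fun k => by
      simp only [coeff_mul, map_smul, Finset.smul_sum])

noncomputable instance : StarRing (StarSeries D) where
  star a := seriesStar (A := A) a
  star_involutive a := ext fun k => by
    change PowerSeries.coeff k (seriesStar (seriesStar (A := A) a)) = PowerSeries.coeff k a
    simp [seriesStar]
  star_mul := D.star_mul
  star_add a b := ext fun k => by
    change PowerSeries.coeff k (seriesStar (A := A) (a + b : A⟦X⟧)) =
      PowerSeries.coeff k (seriesStar (A := A) a + seriesStar (A := A) b)
    simp only [seriesStar, PowerSeries.coeff_mk, map_add]
    exact (congrArg star (map_add (coeff D k) a b)).trans (star_add _ _)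

@[simp]
theorem coeff_star (a : StarSeries D) (k : ℕ) : coeff D k (star a) = star (coeff D k a) := by
  change PowerSeries.coeff k (PowerSeries.mk fun k => star (PowerSeries.coeff (R := A) k a)) = _
  rw [PowerSeries.coeff_mk]
  rfl

/-- The constant series. -/
noncomputable def const (D : UnitalStarProduct A) : A →ₗ[ℂ] StarSeries D where
  toFun f := mk D fun k => if k = 0 then f else 0
  map_add' f g := ext fun k => by by_cases hk : k = 0 <;> simp [hk]
  map_smul' c f := ext fun k => by by_cases hk : k = 0 <;> simp [hk]

theorem coeff_const (f : A) (k : ℕ) : coeff D k (const D f) = if k = 0 then f else 0 :=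
  coeff_mk k fun k => if k = 0 then f else 0

theorem coeff_one (k : ℕ) : coeff D k 1 = if k = 0 then 1 else 0 :=
  PowerSeries.coeff_one (R := A) k

theorem const_one : const D 1 = 1 := ext fun k => by rw [coeff_const, coeff_one]

theorem coeff_const_mul_const (f g : A) (k : ℕ) :
    coeff D k (const D f * const D g) = D.C k f g := by
  rw [coeff_mul, Finset.sum_eq_single (k, 0)]
  · simp [coeff_const]
  · intro p hp hpk
    refine Finset.sum_eq_zero fun q hq => ?_
    rw [Finset.HasAntidiagonal.mem_antidiagonal] at hp hq
    by_cases h1 : q.1 = 0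
    · have h2 : q.2 ≠ 0 := by
        intro h2
        exact hpk (Prod.ext (by simp; omega) (by simp; omega))
      simp [coeff_const, h2]
    · simp [coeff_const, h1]
  · simp

theorem C_one_left (r : ℕ) (a : A) : D.C r 1 a = if r = 0 then a else 0 := by
  rw [← coeff_const_mul_const, const_one, one_mul, coeff_const]

theorem C_one_right (r : ℕ) (a : A) : D.C r a 1 = if r = 0 then a else 0 := by
  rw [← coeff_const_mul_const, const_one, mul_one, coeff_const]

/-- The formal parameter `λ`. -/
noncomputable def lam (D : UnitalStarProduct A) : StarSeries D :=
  mk D fun k => if k = 1 then 1 else 0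

theorem coeff_lam_mul (a : StarSeries D) (k : ℕ) :
    coeff D k (lam D * a) = if k = 0 then 0 else coeff D (k - 1) a := by
  rw [coeff_mul, Finset.sum_eq_single (0, k)]
  · rcases k with _ | k
    · simp [lam]
    · rw [Finset.sum_eq_single (1, k)]
      · simp [lam, C_one_left]
      · intro q hq hqk
        have h1 : q.1 ≠ 1 := by
          intro h1
          rw [Finset.HasAntidiagonal.mem_antidiagonal] at hq
          exact hqk (Prod.ext h1 (by simp at hq ⊢; omega))
        simp [lam, h1]
      · intro h
        exact absurd (Finset.HasAntidiagonal.mem_antidiagonal.2 (by simp; omega)) h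
  · intro p hp hpk
    refine Finset.sum_eq_zero fun q hq => ?_
    rw [Finset.HasAntidiagonal.mem_antidiagonal] at hp
    have h0 : p.1 ≠ 0 := fun h0 => hpk (Prod.ext h0 (by simp; omega))
    by_cases h1 : q.1 = 1
    · simp [lam, h1, C_one_left, h0]
    · simp [lam, h1]
  · simp

theorem coeff_mul_lam (a : StarSeries D) (k : ℕ) :
    coeff D k (a * lam D) = if k = 0 then 0 else coeff D (k - 1) a := by
  rw [coeff_mul, Finset.sum_eq_single (0, k)]
  · rcases k with _ | k
    · simp [lam]
    · rw [Finset.sum_eq_single (k, 1)]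
      · simp [lam, C_one_right]
      · intro q hq hqk
        have h1 : q.2 ≠ 1 := by
          intro h1
          rw [Finset.HasAntidiagonal.mem_antidiagonal] at hq
          exact hqk (Prod.ext (by simp at hq ⊢; omega) h1)
        simp [lam, h1]
      · intro h
        exact absurd (Finset.HasAntidiagonal.mem_antidiagonal.2 (by simp)) h
  · intro p hp hpk
    refine Finset.sum_eq_zero fun q hq => ?_
    rw [Finset.HasAntidiagonal.mem_antidiagonal] at hp
    have h0 : p.1 ≠ 0 := fun h0 => hpk (Prod.ext h0 (by simp; omega))
    by_cases h1 : q.2 = 1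
    · simp [lam, h1, C_one_right, h0]
    · simp [lam, h1]
  · simp

theorem lam_mul_comm (a : StarSeries D) : lam D * a = a * lam D :=
  ext fun k => by rw [coeff_lam_mul, coeff_mul_lam]

theorem exists_eq_lam_mul {a : StarSeries D} (ha : coeff D 0 a = 0) :
    ∃ b, a = lam D * b ∧ ∀ k, coeff D k b = coeff D (k + 1) a := by
  refine ⟨mk D fun k => coeff D (k + 1) a, ext fun k => ?_, fun k => coeff_mk _ _⟩
  rw [coeff_lam_mul]
  rcases k with _ | k
  · simp [ha]
  · simp

/-- The series whose classical limit lies in the ideal `I`. -/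
noncomputable def idealOf (D : UnitalStarProduct A) (I : Ideal A) : Submodule ℂ (StarSeries D) :=
  (I.restrictScalars ℂ).comap (coeff D 0)

theorem mem_idealOf {I : Ideal A} {a : StarSeries D} : a ∈ idealOf D I ↔ coeff D 0 a ∈ I := Iff.rfl

end StarSeries

/-! ### Differential operators and powers of ideals -/

section DiffOp

variable {A : Type*} [CommRing A] [Algebra ℂ A]

/-- A differential operator of order at most `k` lowers the exponent of powers of an ideal by at
most `k`. -/
theorem IsDiffOp.mem_pow {k : ℕ} {T : A →ₗ[ℂ] A} (hT : IsDiffOp k T) (I : Ideal A) {n : ℕ} {f : A}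
    (hf : f ∈ I ^ (n + k)) : T f ∈ I ^ n := by
  induction k generalizing T n f with
  | zero =>
    have h := LinearMap.congr_fun (hT f) 1
    simp only [LinearMap.sub_apply, LinearMap.comp_apply, LinearMap.mulLeft_apply, mul_one,
      LinearMap.zero_apply, sub_eq_zero] at h
    rw [h]
    exact Ideal.mul_mem_right _ _ hf
  | succ k ihk =>
    induction n generalizing f with
    | zero => simp
    | succ n ihn =>
      rw [show n + 1 + (k + 1) = n + (k + 1) + 1 by ring, pow_succ'] at hf
      refine Submodule.mul_induction_on hf (fun g hg f hf => ?_) fun f f' hf hf' => ?_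
      · have h : T (g * f) = g * T f +
            (T ∘ₗ LinearMap.mulLeft ℂ g - LinearMap.mulLeft ℂ g ∘ₗ T) f := by simp
        rw [h]
        refine add_mem ?_ (ihk (hT g) ?_)
        · rw [pow_succ']
          exact Ideal.mul_mem_mul hg (ihn hf)
        · rwa [show n + 1 + k = n + (k + 1) by ring]
      · rw [map_add]; exact add_mem hf hf'

end DiffOp

namespace StarSeries

variable {A : Type*} [CommRing A] [StarRing A] [Algebra ℂ A] (D : UnitalStarProduct A)

/-- Locality of the star product: up to a loss that depends on the order in `λ` only, elements of
high filtration degree vanish to high order. -/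
theorem exists_coeff_filt_mem : ∃ κ : ℕ → ℕ, ∀ (I : Ideal A) (n : ℕ) (a : StarSeries D),
    a ∈ filt (lam D) (idealOf D I) (2 * n) → ∀ t, coeff D t a ∈ I ^ (n - κ t) := by
  choose k hk using D.bidiff
  set K : ℕ → ℕ := fun r => ∑ j ∈ Finset.range (r + 1), (k j + 1) with hK
  have hkK : ∀ {p t}, p ≤ t → k p + 1 ≤ K t := fun {p t} hpt =>
    Finset.single_le_sum (f := fun j => k j + 1) (fun _ _ => Nat.zero_le _)
      (Finset.mem_range.2 (by omega))
  set κ : ℕ → ℕ := fun t => ∑ j ∈ Finset.range t, K (j + 1) with hκ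
  have hκlt : ∀ {r p t}, r < t → p ≤ t → κ r + k p + 1 ≤ κ t := by
    intro r p t hr hp
    obtain ⟨t, rfl⟩ : ∃ t', t = t' + 1 := ⟨t - 1, by omega⟩
    have h1 : κ (t + 1) = κ t + K (t + 1) := Finset.sum_range_succ _ _
    have h2 : κ r ≤ κ t := Finset.sum_le_sum_of_subset (Finset.range_subset_range.2 (by omega))
    have := hkK hp
    omega
  refine ⟨κ, fun I => ?_⟩
  -- `C p` loses `k p` powers of `I`, but then raises the order in `λ`; `κ` grows fast enough to
  -- absorb this loss
  have hmul : ∀ (n : ℕ) (a b : StarSeries D), a ∈ idealOf D I →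
      (∀ t, coeff D t b ∈ I ^ (n - κ t)) → ∀ t, coeff D t (a * b) ∈ I ^ (n + 1 - κ t) := by
    intro n a b ha hb t
    rw [coeff_mul]
    refine sum_mem fun p hp => sum_mem fun q hq => ?_
    rw [Finset.HasAntidiagonal.mem_antidiagonal] at hp hq
    by_cases h0 : q.2 = t
    · have hp0 : p.1 = 0 := by omega
      have hq0 : q.1 = 0 := by omega
      rw [hp0, D.C_zero, hq0, h0]
      refine Ideal.pow_le_pow_right (show n + 1 - κ t ≤ n - κ t + 1 by omega) ?_
      rw [pow_succ']
      exact Ideal.mul_mem_mul ha (hb t)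
    · have hlt := hκlt (r := q.2) (p := p.1) (t := t) (by omega) (by omega)
      rcases Nat.lt_or_ge (κ t) (n + 1) with h1 | h1
      · refine IsDiffOp.mem_pow ((hk p.1).1 _) I (n := n + 1 - κ t) ?_
        exact Ideal.pow_le_pow_right (by omega) (hb q.2)
      · simp [show n + 1 - κ t = 0 by omega]
  intro n
  induction n with
  | zero => intro a _ t; simp
  | succ n ih =>
    intro a ha
    have hanti : filt (lam D) (idealOf D I) (2 * n + 1) ≤ filt (lam D) (idealOf D I) (2 * n) := by
      have hJ : ∀ d, filt (lam D) (idealOf D I) (d + 1) ≤ filt (lam D) (idealOf D I) d := by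
        intro d
        induction d using Nat.strong_induction_on with
        | _ d ih =>
          rcases d with _ | _ | d
          · exact le_top
          · refine sup_le (Submodule.mul_le.2 fun a ha b _ => ?_) ?_
            · rw [filt, mem_idealOf, coeff_zero_mul]
              exact Ideal.mul_mem_right _ _ ha
            · rintro _ ⟨a, _, rfl⟩
              rw [filt, mem_idealOf, LinearMap.mulLeft_apply, coeff_lam_mul]
              simp
          · exact sup_le_sup (mul_le_mul' le_rfl (ih (d + 1) (by omega)))
              (Submodule.map_mono (ih d (by omega)))
      exact hJ _
    obtain ⟨a₁, ha₁, a₂, ⟨b, hb, rfl⟩, rfl⟩ := Submodule.mem_sup.1 ha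
    intro t
    rw [map_add]
    refine add_mem ?_ (hmul n _ _ ?_ (ih b hb) t)
    · refine Submodule.mul_induction_on ha₁ (fun p hp q hq => ?_) fun p q hp hq => ?_
      · exact hmul n _ _ hp (ih q (hanti hq)) t
      · rw [map_add]; exact add_mem hp hq
    · rw [mem_idealOf]; simp [lam]

end StarSeries

/-! ### Families of functions that depend smoothly on a point -/

section Families

variable {A : Type*} [CommRing A] [Algebra ℂ A] {M : Type*} (ev : M → A →ₐ[ℂ] ℂ)

/-- Families of elements of `A` indexed by `M` of the form `x ↦ ∑ₐ gₐ(x) fₐ`. -/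
def families : Submodule ℂ (M → A) :=
  Submodule.span ℂ {f | ∃ g a : A, f = fun x => ev x g • a}

variable {ev}

theorem smul_mem_families (g a : A) : (fun x => ev x g • a) ∈ families ev :=
  Submodule.subset_span ⟨g, a, rfl⟩

theorem const_mem_families (a : A) : (fun _ => a) ∈ families ev := by
  simpa using smul_mem_families (ev := ev) 1 a

theorem bilin_mem_families (B : A →ₗ[ℂ] A →ₗ[ℂ] A) {f g : M → A} (hf : f ∈ families ev)
    (hg : g ∈ families ev) : (fun x => B (f x) (g x)) ∈ families ev := by
  refine Submodule.span_induction (p := fun f _ => (fun x => B (f x) (g x)) ∈ families ev)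
    ?_ ?_ ?_ ?_ hf
  · rintro _ ⟨u, a, rfl⟩
    refine Submodule.span_induction
      (p := fun g _ => (fun x => B (ev x u • a) (g x)) ∈ families ev) ?_ ?_ ?_ ?_ hg
    · rintro _ ⟨v, b, rfl⟩
      have := smul_mem_families (ev := ev) (v * u) (B a b)
      simpa [smul_smul] using this
    · simp only [Pi.zero_apply, map_zero]; exact zero_mem (families ev)
    · intro g g' _ _ hg hg'
      simp only [Pi.add_apply, map_add]
      exact add_mem hg hg'
    · intro c g _ hg
      simp only [Pi.smul_apply, map_smul] at hg ⊢
      exact Submodule.smul_mem _ c hg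
  · simp only [Pi.zero_apply, map_zero, LinearMap.zero_apply]; exact zero_mem (families ev)
  · intro f f' _ _ hf hf'
    simp only [Pi.add_apply, map_add, LinearMap.add_apply]
    exact add_mem hf hf'
  · intro c f _ hf
    simp only [Pi.smul_apply, map_smul, LinearMap.smul_apply]
    exact Submodule.smul_mem _ c hf

/-- Applying a linear operator to a family and evaluating at the parameter gives an element
of `A`. -/
theorem exists_ev_eq_of_mem_families {f : M → A} (hf : f ∈ families ev) (T : A →ₗ[ℂ] A) :
    ∃ g : A, ∀ x, ev x g = ev x (T (f x)) := by
  refine Submodule.span_induction (p := fun f _ => ∃ g : A, ∀ x, ev x g = ev x (T (f x)))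
    ?_ ?_ ?_ ?_ hf
  · rintro _ ⟨u, a, rfl⟩
    exact ⟨u * T a, fun x => by simp⟩
  · exact ⟨0, fun x => by simp⟩
  · rintro f f' _ _ ⟨g, hg⟩ ⟨g', hg'⟩
    exact ⟨g + g', fun x => by simp [hg, hg']⟩
  · rintro c f _ ⟨g, hg⟩
    exact ⟨c • g, fun x => by simp [hg]⟩

end Families

/-! ### Local frames and differential operators with prescribed values on monomials -/

section Frame

variable {A : Type*} [CommRing A] [StarRing A] [Algebra ℂ A] {M : Type*}

theorem derivation_mem_pow {A : Type*} [CommRing A] [Algebra ℂ A] (I : Ideal A)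
    (X : Derivation ℂ A A) {n : ℕ} {f : A}
    (hf : f ∈ I ^ (n + 1)) : X f ∈ I ^ n := by
  induction n generalizing f with
  | zero => simp
  | succ n ih =>
    rw [pow_succ'] at hf
    refine Submodule.mul_induction_on hf (fun g hg f hf => ?_) fun f f' hf hf' => ?_
    · rw [Derivation.leibniz, smul_eq_mul, smul_eq_mul]
      refine add_mem ?_ (Ideal.mul_mem_right _ _ hf)
      rw [pow_succ']
      exact Ideal.mul_mem_mul hg (ih hf)
    · rw [map_add]; exact add_mem hf hf'

/-- Local coordinates on a set `U` of points: real functions `y i` and derivations `X i`, dual to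
each other on `U`, such that at each point `x` of `U` the functions `y i - y i (x)` span the ideal
of functions vanishing at `x` modulo its square. -/
structure LocalFrame (ev : M → A →ₐ[ℂ] ℂ) (U : Set M) (ι : Type*) [DecidableEq ι] where
  y : ι → A
  X : ι → Derivation ℂ A A
  star_y : ∀ i, star (y i) = y i
  X_y : ∀ x ∈ U, ∀ i j, ev x (X i (y j)) = if i = j then 1 else 0
  le_span : ∀ x ∈ U, ∀ f ∈ RingHom.ker (ev x),
    f ∈ Submodule.span ℂ (Set.range fun i => y i - algebraMap ℂ A (ev x (y i))) ⊔
      (RingHom.ker (ev x) ^ 2 : Ideal A).restrictScalars ℂ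

namespace LocalFrame

variable {ev : M → A →ₐ[ℂ] ℂ} {U : Set M} {ι : Type*} [DecidableEq ι] (F : LocalFrame ev U ι)

/-- The coordinates centred at the point `x`. -/
def centred (x : M) (i : ι) : A := F.y i - algebraMap ℂ A (ev x (F.y i))

theorem centred_mem (x : M) (i : ι) : F.centred x i ∈ RingHom.ker (ev x) := by
  simp [RingHom.mem_ker, centred]

theorem centred_mem_families (i : ι) : (fun x => F.centred x i) ∈ families ev := by
  have := sub_mem (const_mem_families (ev := ev) (F.y i)) (smul_mem_families (F.y i) 1)
  convert this using 1
  funext x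
  simp [centred, Algebra.algebraMap_eq_smul_one]

/-- The monomial in the centred coordinates given by a multiset of indices. -/
def mono (x : M) (s : Multiset ι) : A := (s.map (F.centred x)).prod

theorem mono_cons (x : M) (i : ι) (s : Multiset ι) :
    F.mono x (i ::ₘ s) = F.centred x i * F.mono x s := by simp [mono]

theorem mono_mem (x : M) (s : Multiset ι) : F.mono x s ∈ RingHom.ker (ev x) ^ s.card := by
  induction s using Multiset.induction_on with
  | empty => simp
  | cons i s ih =>
    rw [mono_cons, Multiset.card_cons, pow_succ']
    exact Ideal.mul_mem_mul (F.centred_mem x i) ih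

theorem mono_mem_families (s : Multiset ι) : (fun x => F.mono x s) ∈ families ev := by
  induction s using Multiset.induction_on with
  | empty => simpa [mono] using const_mem_families (ev := ev) 1
  | cons i s ih =>
    have := bilin_mem_families (LinearMap.mul ℂ A) (F.centred_mem_families i) ih
    simpa [mono_cons] using this

/-- The derivations act on monomials as partial derivatives, to leading order. -/
theorem X_mono_sub_mem {x : M} (hx : x ∈ U) (i : ι) (s : Multiset ι) :
    F.X i (F.mono x s) - (s.count i : ℂ) • F.mono x (s.erase i) ∈
      RingHom.ker (ev x) ^ s.card := by
  induction s using Multiset.induction_on with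
  | empty => simp
  | cons j s ih =>
    rw [Multiset.card_cons]
    have hX : F.X i (F.centred x j) = F.X i (F.y j) := by
      simp [centred, Derivation.map_algebraMap]
    -- the error terms of the induction step
    have h1 : F.mono x s * (F.X i (F.y j) - if i = j then 1 else 0) ∈
        RingHom.ker (ev x) ^ (s.card + 1) := by
      rw [pow_succ]
      refine Ideal.mul_mem_mul (F.mono_mem x s) ?_
      rw [RingHom.mem_ker, map_sub, F.X_y x hx]
      split_ifs <;> simp
    have h2 : F.centred x j * (F.X i (F.mono x s) - (s.count i : ℂ) • F.mono x (s.erase i)) ∈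
        RingHom.ker (ev x) ^ (s.card + 1) := by
      rw [pow_succ']
      exact Ideal.mul_mem_mul (F.centred_mem x j) ih
    have h3 : F.centred x j * ((s.count i : ℂ) • F.mono x (s.erase i)) +
        F.mono x s * (if i = j then 1 else 0) =
        ((j ::ₘ s).count i : ℂ) • F.mono x ((j ::ₘ s).erase i) := by
      by_cases hij : i = j
      · subst hij
        rw [Multiset.erase_cons_head, Multiset.count_cons_self, if_pos rfl, mul_smul_comm,
          ← mono_cons]
        push_cast
        rw [add_smul, one_smul, mul_one]
        by_cases his : i ∈ s
        · rw [Multiset.cons_erase his]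
        · simp [Multiset.count_eq_zero_of_notMem his]
      · rw [Multiset.erase_cons_tail _ (Ne.symm hij), Multiset.count_cons_of_ne hij, if_neg hij,
          mul_smul_comm, ← mono_cons]
        simp
    rw [mono_cons, Derivation.leibniz, hX, ← h3]
    have := add_mem h1 h2
    convert this using 1
    simp only [smul_eq_mul]
    ring

variable [Fintype ι]

/-- Differential operators of order at most `N` with prescribed values on monomials of degree `N`
exist. That the order is at most `N` is expressed by `T f` vanishing at `x` if `f` vanishes at `x`
to order `N + 1`. The recursion is Euler's identity: the operator of order `N + 1` is the mean
`(N + 1)⁻¹ ∑ᵢ Tᵢ ∘ Xᵢ`, with `Tᵢ` of order `N`. -/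
theorem exists_top_symbol (N : ℕ) (t : Multiset ι → A) :
    ∃ T : A →ₗ[ℂ] A, (∀ x, ∀ f ∈ RingHom.ker (ev x) ^ (N + 1), ev x (T f) = 0) ∧
      ∀ x ∈ U, ∀ s, s.card = N → ev x (T (F.mono x s)) = ev x (t s) := by
  induction N generalizing t with
  | zero =>
    refine ⟨LinearMap.mulLeft ℂ (t 0), fun x f hf => ?_, fun x _ s hs => ?_⟩
    · rw [zero_add, pow_one, RingHom.mem_ker] at hf
      simp [hf]
    · rw [Multiset.card_eq_zero.1 hs]
      simp [mono]
  | succ N ih =>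
    choose T hT0 hT using fun i => ih fun s => t (i ::ₘ s)
    refine ⟨((N + 1 : ℂ))⁻¹ • ∑ i, T i ∘ₗ (F.X i).toLinearMap, fun x f hf => ?_,
      fun x hx s hs => ?_⟩
    · simp [hT0 _ _ _ (derivation_mem_pow _ (F.X _) hf)]
    · have h1 : ∀ i, ev x (T i (F.X i (F.mono x s))) = (s.count i : ℂ) * ev x (t s) := by
        intro i
        have h := hT0 i x _ (hs ▸ F.X_mono_sub_mem hx i s)
        rw [map_sub, map_sub, sub_eq_zero, map_smul, map_smul, smul_eq_mul] at h
        rw [h]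
        by_cases his : i ∈ s
        · rw [hT i x hx _ (by rw [Multiset.card_erase_of_mem his, hs]; rfl),
            Multiset.cons_erase his]
        · simp [Multiset.count_eq_zero_of_notMem his]
      have h2 : (∑ i, (s.count i : ℂ)) = N + 1 := by
        rw [← Nat.cast_sum, Multiset.sum_count_eq_card (fun a _ => Finset.mem_univ a), hs]
        simp
      simp only [LinearMap.smul_apply, LinearMap.sum_apply, LinearMap.comp_apply,
        Derivation.coeFn_coe, map_smul, map_sum, h1, smul_eq_mul]
      rw [← Finset.sum_mul, h2, inv_mul_cancel_left₀]
      exact_mod_cast Nat.succ_ne_zero N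

/-- Differential operators of order at most `N` with prescribed values on monomials of degree at
most `N` exist: the values in top degree are arranged first, and an operator of lower order corrects
the others. -/
theorem exists_symbol (N : ℕ) (t : Multiset ι → A) :
    ∃ T : A →ₗ[ℂ] A, (∀ x, ∀ f ∈ RingHom.ker (ev x) ^ (N + 1), ev x (T f) = 0) ∧
      ∀ x ∈ U, ∀ s, s.card ≤ N → ev x (T (F.mono x s)) = ev x (t s) := by
  induction N generalizing t with
  | zero =>
    obtain ⟨T, hT0, hT⟩ := F.exists_top_symbol 0 t
    exact ⟨T, hT0, fun x hx s hs => hT x hx s (by omega)⟩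
  | succ N ih =>
    obtain ⟨T, hT0, hT⟩ := F.exists_top_symbol (N + 1) t
    choose g hg using fun s => exists_ev_eq_of_mem_families (F.mono_mem_families s) T
    obtain ⟨T', hT0', hT'⟩ := ih fun s => t s - g s
    refine ⟨T + T', fun x f hf => ?_, fun x hx s hs => ?_⟩
    · rw [LinearMap.add_apply, map_add, hT0 x f hf,
        hT0' x f (Ideal.pow_le_pow_right (by omega) hf), add_zero]
    · rw [LinearMap.add_apply, map_add]
      rcases Nat.lt_or_ge N s.card with h | h
      · rw [hT x hx s (by omega),
          hT0' x _ (Ideal.pow_le_pow_right (by omega) (F.mono_mem x s)), add_zero]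
      · rw [hT' x hx s h, map_sub, hg]
        ring

end LocalFrame

end Frame

/-! ### Quasi-free deformations of the point evaluations -/

section Point

open StarSeries
open scoped ComplexConjugate ComplexOrder

variable {A : Type*} [CommRing A] [StarRing A] [Algebra ℂ A] [StarModule ℂ A] {M : Type*}
  {ev : M → A →ₐ[ℂ] ℂ} {U : Set M} {ι : Type*} [DecidableEq ι]

/-- The Poisson tensor of a star product in a local frame, up to a factor `i`. -/
noncomputable def LocalFrame.poisson (F : LocalFrame ev U ι) (D : UnitalStarProduct A)
    (i j : ι) : A :=
  D.C 1 (F.y i) (F.y j) - D.C 1 (F.y j) (F.y i)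

omit [StarModule ℂ A] in
theorem star_C (D : UnitalStarProduct A) (r : ℕ) (f g : A) :
    star (D.C r f g) = D.C r (star g) (star f) := by
  have hs : ∀ f, star (const D f) = const D (star f) := fun f => StarSeries.ext fun k => by
    rw [coeff_star, coeff_const, coeff_const]
    split_ifs <;> simp
  rw [← coeff_const_mul_const, ← coeff_star, star_mul, hs, hs, coeff_const_mul_const]

omit [StarModule ℂ A] in
theorem LocalFrame.star_poisson (F : LocalFrame ev U ι) (D : UnitalStarProduct A) (i j : ι) :
    star (F.poisson D i j) = -F.poisson D i j := by
  simp [poisson, star_C, F.star_y]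

omit [StarModule ℂ A] in
theorem LocalFrame.poisson_swap (F : LocalFrame ev U ι) (D : UnitalStarProduct A) (i j : ι) :
    F.poisson D j i = -F.poisson D i j := by
  simp [poisson]

/-- The centred coordinates as elements of the deformed algebra. -/
noncomputable def LocalFrame.coord (F : LocalFrame ev U ι) (D : UnitalStarProduct A) (x : M)
    (i : ι) : StarSeries D :=
  const D (F.centred x i)

theorem LocalFrame.formalPoint (F : LocalFrame ev U ι) (D : UnitalStarProduct A)
    (hev : ∀ x f, ev x (star f) = conj (ev x f)) {x : M} (hx : x ∈ U) :
    FormalPoint (lam D) (idealOf D (RingHom.ker (ev x))) (F.coord D x)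
      (fun i j => ev x (F.poisson D i j)) where
  comm_l := lam_mul_comm
  star_l := StarSeries.ext fun k => by
    rw [coeff_star, lam, coeff_mk]
    split_ifs <;> simp
  star_smul c a := StarSeries.ext fun k => by
    rw [coeff_star, map_smul, map_smul, star_smul, coeff_star]
    rfl
  mul_mem_left a b hb := by
    rw [mem_idealOf] at *
    rw [coeff_zero_mul]
    exact Ideal.mul_mem_left _ _ hb
  mul_mem_right a b ha := by
    rw [mem_idealOf] at *
    rw [coeff_zero_mul]
    exact Ideal.mul_mem_right _ _ ha
  l_mem := by simp [mem_idealOf, lam]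
  star_mem a ha := by
    rw [mem_idealOf, RingHom.mem_ker] at *
    rw [coeff_star, hev, ha, map_zero]
  sub_smul_one_mem a := by
    refine ⟨ev x (coeff D 0 a), ?_⟩
    rw [mem_idealOf, RingHom.mem_ker, map_sub, map_smul, coeff_one]
    simp
  comm a b := by
    obtain ⟨c, hc, -⟩ := exists_eq_lam_mul (D := D) (a := a * b - b * a) (by
      rw [map_sub, coeff_zero_mul, coeff_zero_mul]; ring)
    exact ⟨c, hc⟩
  y_mem i := by
    rw [mem_idealOf, LocalFrame.coord, coeff_const, if_pos rfl]
    exact F.centred_mem x i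
  star_y i := StarSeries.ext fun k => by
    rw [coeff_star, LocalFrame.coord, coeff_const]
    split_ifs
    · rw [LocalFrame.centred, star_sub, F.star_y, Algebra.algebraMap_eq_smul_one, star_smul,
        star_one]
      congr 2
      rw [← starRingEnd_apply, ← hev, F.star_y]
    · simp
  y_comm i j := by
    obtain ⟨c, hc, hck⟩ := exists_eq_lam_mul (D := D)
      (a := F.coord D x i * F.coord D x j - F.coord D x j * F.coord D x i) (by
      rw [map_sub, coeff_zero_mul, coeff_zero_mul]; ring)
    refine ⟨c - ev x (F.poisson D i j) • 1, ?_, by rw [hc]; congr 1; abel⟩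
    have h1 : coeff D 1 (F.coord D x i * F.coord D x j - F.coord D x j * F.coord D x i) =
        F.poisson D i j := by
      rw [map_sub, LocalFrame.coord, LocalFrame.coord, coeff_const_mul_const,
        coeff_const_mul_const]
      simp [LocalFrame.centred, Algebra.algebraMap_eq_smul_one, C_one_left, C_one_right,
        LocalFrame.poisson]
    rw [mem_idealOf, RingHom.mem_ker, map_sub, hck, h1, map_smul, coeff_one]
    simp
  le_span := by
    have hlam : ∀ a, coeff D 0 a = 0 →
        a ∈ filt (lam D) (idealOf D (RingHom.ker (ev x))) 2 := by
      intro a ha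
      obtain ⟨b, rfl, -⟩ := exists_eq_lam_mul ha
      exact l_mul_mem_filt (d := 0) trivial
    have hsq : ∀ f ∈ (RingHom.ker (ev x) ^ 2 : Ideal A),
        const D f ∈ filt (lam D) (idealOf D (RingHom.ker (ev x))) 2 := by
      intro f hf
      rw [pow_two] at hf
      refine Submodule.mul_induction_on hf (fun g hg f hf => ?_) fun f f' hf hf' => ?_
      · have e : const D (g * f) =
            const D g * const D f + (const D (g * f) - const D g * const D f) := by abel
        rw [e]
        refine add_mem (Submodule.mem_sup_left (Submodule.mul_mem_mul ?_ ?_)) (hlam _ ?_)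
        · rw [mem_idealOf, coeff_const, if_pos rfl]; exact hg
        · rw [filt, mem_idealOf, coeff_const, if_pos rfl]; exact hf
        · rw [map_sub, coeff_zero_mul, coeff_const, coeff_const, coeff_const]; simp
      · rw [map_add]; exact add_mem hf hf'
    intro a ha
    obtain ⟨g, hg, f, hf, hgf⟩ := Submodule.mem_sup.1 (F.le_span x hx _ ha)
    have e : a = const D g + (const D f + (a - const D (coeff D 0 a))) := by
      rw [← hgf, map_add]; abel
    rw [e]
    refine add_mem (Submodule.mem_sup_left ?_) (Submodule.mem_sup_right (add_mem (hsq f hf)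
      (hlam _ ?_)))
    · have h1 := Submodule.mem_map_of_mem (f := const D) hg
      rw [Submodule.map_span, ← Set.range_comp] at h1
      exact h1
    · rw [map_sub, coeff_const]; simp

/-- Recursive construction of a sequence each of whose terms is chosen according to the previous
ones. -/
theorem exists_seq_of_step {α : Type*} (a₀ : α) (P : ℕ → (ℕ → α) → Prop)
    (hloc : ∀ r T T', (∀ q ≤ r, T q = T' q) → P r T → P r T')
    (h0 : ∀ T, T 0 = a₀ → P 0 T)
    (hstep : ∀ r T, T 0 = a₀ → (∀ q ≤ r, P q T) → ∃ a, P (r + 1) (Function.update T (r + 1) a)) :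
    ∃ T, T 0 = a₀ ∧ ∀ r, P r T := by
  have hS : ∀ n (T : {T : ℕ → α // T 0 = a₀ ∧ ∀ q ≤ n, P q T}),
      ∃ T' : {T : ℕ → α // T 0 = a₀ ∧ ∀ q ≤ n + 1, P q T}, ∀ q ≤ n, T'.1 q = T.1 q := by
    rintro n ⟨T, hT0, hT⟩
    obtain ⟨a, ha⟩ := hstep n T hT0 hT
    have hup : ∀ q ≤ n, Function.update T (n + 1) a q = T q := fun q hq =>
      Function.update_of_ne (by omega) _ _
    refine ⟨⟨Function.update T (n + 1) a, by rw [hup 0 (by omega), hT0], fun q hq => ?_⟩, hup⟩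
    rcases Nat.lt_or_ge n q with h | h
    · rwa [show q = n + 1 by omega]
    · exact hloc q T _ (fun p hp => (hup p (by omega)).symm) (hT q h)
  choose next hnext using hS
  let S : ∀ n, {T : ℕ → α // T 0 = a₀ ∧ ∀ q ≤ n, P q T} := fun n =>
    Nat.rec ⟨fun _ => a₀, rfl, fun q hq => by
      obtain rfl : q = 0 := Nat.le_zero.1 hq
      exact h0 _ rfl⟩ (fun n T => next n T) n
  have hSn : ∀ n k q, q ≤ n → (S (n + k)).1 q = (S n).1 q := by
    intro n k q hq
    induction k with
    | zero => rfl
    | succ k ih => rw [← ih]; exact hnext (n + k) (S (n + k)) q (by omega)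
  refine ⟨fun n => (S n).1 n, (S 0).2.1, fun r => ?_⟩
  refine hloc r (S r).1 _ (fun q hq => ?_) ((S r).2.2 r le_rfl)
  obtain ⟨k, rfl⟩ := Nat.exists_eq_add_of_le hq
  exact hSn q k q le_rfl

variable [Fintype ι]

/-- The coefficients `β = 1 + c / 4` of the annihilation parts of the field operators that reproduce
the Poisson tensor `c`, see `sum_beta`. They are polynomial in `c`, hence smooth, as no square root
of `c` is taken. -/
noncomputable def LocalFrame.beta (F : LocalFrame ev U ι) (D : UnitalStarProduct A)
    (i j : ι) : A :=
  (if i = j then 1 else 0) + (4⁻¹ : ℂ) • F.poisson D i j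

omit [StarModule ℂ A] in
theorem LocalFrame.sum_beta (F : LocalFrame ev U ι) (D : UnitalStarProduct A)
    (hev : ∀ x f, ev x (star f) = conj (ev x f)) (x : M) (i j : ι) :
    ev x (F.poisson D i j) =
      ∑ k, (ev x (F.beta D i k) * conj (ev x (F.beta D j k)) -
        ev x (F.beta D j k) * conj (ev x (F.beta D i k))) := by
  have h1 : ∀ i j, ev x (F.beta D i j) =
      (if i = j then 1 else 0) + 4⁻¹ * ev x (F.poisson D i j) := by
    intro i j
    rw [beta, map_add, map_smul, smul_eq_mul]
    split_ifs <;> simp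
  have h2 : ∀ i j, conj (ev x (F.beta D i j)) =
      (if i = j then 1 else 0) - 4⁻¹ * ev x (F.poisson D i j) := by
    intro i j
    rw [h1, map_add, map_mul, ← hev, F.star_poisson, map_neg, map_inv₀, map_ofNat, apply_ite conj,
      map_one, map_zero]
    ring
  have h3 : ∀ k, ev x (F.beta D i k) * conj (ev x (F.beta D j k)) -
      ev x (F.beta D j k) * conj (ev x (F.beta D i k)) =
      (if j = k then 2⁻¹ * ev x (F.poisson D i k) else 0) -
        if i = k then 2⁻¹ * ev x (F.poisson D j k) else 0 := by
    intro k
    rw [h2, h2, h1, h1]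
    split_ifs <;> ring
  simp only [h3, Finset.sum_sub_distrib, Finset.sum_ite_eq, Finset.mem_univ, if_true]
  rw [F.poisson_swap D i j, map_neg]
  ring

/-- The functional `a ↦ ∑ᵣ λʳ Tᵣ(a)(x)`. -/
noncomputable def stateAt (ev : M → A →ₐ[ℂ] ℂ) (D : UnitalStarProduct A) (T : ℕ → A →ₗ[ℂ] A)
    (x : M) : StarSeries D →ₗ[ℂ] ℂ⟦X⟧ where
  toFun a := PowerSeries.mk fun k =>
    ∑ p ∈ Finset.HasAntidiagonal.antidiagonal k, ev x (T p.1 (coeff D p.2 a))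
  map_add' a b := by
    ext k
    simp [Finset.sum_add_distrib]
  map_smul' c a := by
    ext k
    simp [Finset.mul_sum]

omit [StarModule ℂ A] in
theorem coeff_stateAt (D : UnitalStarProduct A) (T : ℕ → A →ₗ[ℂ] A) (x : M) (a : StarSeries D)
    (k : ℕ) : PowerSeries.coeff k (stateAt ev D T x a) =
      ∑ p ∈ Finset.HasAntidiagonal.antidiagonal k, ev x (T p.1 (coeff D p.2 a)) :=
  PowerSeries.coeff_mk k fun k =>
    ∑ p ∈ Finset.HasAntidiagonal.antidiagonal k, ev x (T p.1 (coeff D p.2 a))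

end Point

section QuasiFree

open StarSeries
open scoped ComplexConjugate ComplexOrder

variable {A : Type*} [CommRing A] [StarRing A] [Algebra ℂ A] {M : Type*}
  {ev : M → A →ₐ[ℂ] ℂ} {U : Set M} {ι : Type*} [DecidableEq ι]

theorem coeff_mul_mem_families {D : UnitalStarProduct A} {a b : M → StarSeries D}
    (ha : ∀ k, (fun x => coeff D k (a x)) ∈ families ev)
    (hb : ∀ k, (fun x => coeff D k (b x)) ∈ families ev) (k : ℕ) :
    (fun x => coeff D k (a x * b x)) ∈ families ev := by
  simp only [coeff_mul]
  have : (fun x => ∑ p ∈ Finset.HasAntidiagonal.antidiagonal k,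
      ∑ q ∈ Finset.HasAntidiagonal.antidiagonal p.2,
        D.C p.1 (coeff D q.1 (a x)) (coeff D q.2 (b x))) =
      ∑ p ∈ Finset.HasAntidiagonal.antidiagonal k,
      ∑ q ∈ Finset.HasAntidiagonal.antidiagonal p.2,
        fun x => D.C p.1 (coeff D q.1 (a x)) (coeff D q.2 (b x)) := by
    funext x
    simp only [Finset.sum_apply]
  rw [this]
  exact sum_mem fun p _ => sum_mem fun q _ => bilin_mem_families _ (ha _) (hb _)

theorem LocalFrame.coeff_word_mem_families (F : LocalFrame ev U ι) (D : UnitalStarProduct A)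
    (L : List ι) (k : ℕ) : (fun x => coeff D k (word (F.coord D x) L)) ∈ families ev := by
  induction L generalizing k with
  | nil =>
    simp only [word, List.map_nil, List.prod_nil]
    exact const_mem_families _
  | cons i L ih =>
    simp only [word_cons]
    refine coeff_mul_mem_families (fun k => ?_) ih k
    simp only [coord, coeff_const]
    split_ifs
    · exact F.centred_mem_families i
    · exact zero_mem (families ev)

theorem LocalFrame.coeff_zero_word (F : LocalFrame ev U ι) (D : UnitalStarProduct A) (x : M)
    (L : List ι) : coeff D 0 (word (F.coord D x) L) = F.mono x L := by
  induction L with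
  | nil => simp [word, coeff_one, mono]
  | cons i L ih =>
    rw [word_cons, coeff_zero_mul, ih, ← Multiset.cons_coe, mono_cons, coord, coeff_const,
      if_pos rfl]

variable [StarModule ℂ A]

/-- The coefficients of words of large length are killed by operators of bounded order. -/
theorem LocalFrame.exists_coeff_word_mem (F : LocalFrame ev U ι) (D : UnitalStarProduct A)
    (hev : ∀ x f, ev x (star f) = conj (ev x f)) (p k : ℕ) :
    ∃ N, ∀ x ∈ U, ∀ L : List ι, N ≤ L.length →
      coeff D p (word (F.coord D x) L) ∈ RingHom.ker (ev x) ^ k := by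
  obtain ⟨κ, hκ⟩ := exists_coeff_filt_mem D
  refine ⟨2 * (κ p + k), fun x hx L hL => ?_⟩
  have h := F.formalPoint D hev hx
  have := hκ _ (κ p + k) _ (h.filt_antitone hL (h.word_mem L)) p
  simpa using this

variable [Fintype ι]

/-- There are operators `Tᵣ` with `T₀ = id` such that the functionals `a ↦ ∑ᵣ λʳ Tᵣ(a)(x)` are
quasi-free at all points of `U`; `Tᵣ` is obtained by recursion on `r`. -/
theorem LocalFrame.exists_isQuasiFree (F : LocalFrame ev U ι) (D : UnitalStarProduct A)
    (hev : ∀ x f, ev x (star f) = conj (ev x f)) (w : Multiset ι → List ι)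
    (hw : ∀ s, (w s : Multiset ι) = s) :
    ∃ T : ℕ → A →ₗ[ℂ] A, T 0 = LinearMap.id ∧ ∀ x ∈ U,
      IsQuasiFree (lam D) (idealOf D (RingHom.ker (ev x))) (F.coord D x) w
        (fun i j => ev x (F.beta D i j)) (stateAt ev D T x) := by
  have hlen : ∀ s, (w s).length = s.card := fun s => by
    conv_rhs => rw [← hw s]
    rfl
  have hw0 : w 0 = [] := by
    rw [← List.length_eq_zero_iff, hlen, Multiset.card_zero]
  set m : Multiset ι → A := fun s =>
    vacuumExp (F.beta D) (fun i j => star (F.beta D i j)) (w s) with hm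
  have hmev : ∀ x s, ev x (m s) = vacuumExp (fun i j => ev x (F.beta D i j))
      (fun i j => conj (ev x (F.beta D i j))) (w s) := by
    intro x s
    have := map_vacuumExp (ev x : A →+* ℂ) (F.beta D) (fun i j => star (F.beta D i j)) (w s)
    simpa only [RingHom.coe_coe, hev] using this
  have hseq : ∃ T : ℕ → A →ₗ[ℂ] A, T 0 = LinearMap.id ∧ ∀ r,
      (∃ k, ∀ x, ∀ f ∈ RingHom.ker (ev x) ^ (k + 1), ev x (T r f) = 0) ∧
      ∀ x ∈ U, ∀ s : Multiset ι, ∑ p ∈ Finset.HasAntidiagonal.antidiagonal r,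
        ev x (T p.1 (coeff D p.2 (word (F.coord D x) (w s)))) =
          if 2 * r = s.card then ev x (m s) else 0 := by
    refine exists_seq_of_step (LinearMap.id : A →ₗ[ℂ] A)
      (fun r T => (∃ k, ∀ x, ∀ f ∈ RingHom.ker (ev x) ^ (k + 1), ev x (T r f) = 0) ∧
      ∀ x ∈ U, ∀ s : Multiset ι, ∑ p ∈ Finset.HasAntidiagonal.antidiagonal r,
        ev x (T p.1 (coeff D p.2 (word (F.coord D x) (w s)))) =
          if 2 * r = s.card then ev x (m s) else 0) ?_ ?_ ?_
    · rintro r T T' hTT' ⟨⟨k, hk⟩, h⟩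
      refine ⟨⟨k, by rw [← hTT' r le_rfl]; exact hk⟩, fun x hx s => ?_⟩
      rw [← h x hx s]
      refine Finset.sum_congr rfl fun p hp => ?_
      rw [hTT' p.1]
      rw [Finset.HasAntidiagonal.mem_antidiagonal] at hp
      omega
    · intro T hT
      refine ⟨⟨0, fun x f hf => ?_⟩, fun x hx s => ?_⟩
      · rw [zero_add, pow_one] at hf
        rw [hT]
        exact hf
      · rw [show Finset.HasAntidiagonal.antidiagonal 0 = {((0 : ℕ), (0 : ℕ))} from rfl,
          Finset.sum_singleton, hT, F.coeff_zero_word, hw, LinearMap.id_apply]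
        split_ifs with h
        · obtain rfl : s = 0 := Multiset.card_eq_zero.1 (by omega)
          rw [hmev, hw0]
          simp [vacuumExp, mono]
        · obtain ⟨i, hi⟩ := Multiset.exists_mem_of_ne_zero (s := s) (by
            rintro rfl; simp at h)
          obtain ⟨s', rfl⟩ := Multiset.exists_cons_of_mem hi
          rw [mono_cons, map_mul, RingHom.mem_ker.1 (F.centred_mem x i), zero_mul]
    · intro r T hT0 hT
      choose k hk using fun q : Fin (r + 1) => (hT q (by omega)).1
      choose g hg using fun (p : ℕ × ℕ) s =>
        exists_ev_eq_of_mem_families (F.coeff_word_mem_families D (w s) p.2) (T p.1)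
      -- beyond this length all prescribed values vanish
      choose N hN using fun (q : Fin (r + 1)) (p : ℕ) =>
        F.exists_coeff_word_mem D hev p (k q + 1)
      set N' := 2 * (r + 1) + ∑ q, ∑ p ∈ Finset.range (r + 2), N q p with hN'
      set t : Multiset ι → A := fun s => (if 2 * (r + 1) = s.card then m s else 0) -
        ∑ p ∈ (Finset.HasAntidiagonal.antidiagonal (r + 1)).erase (r + 1, 0), g p s with ht
      obtain ⟨T', hT'0, hT'⟩ := F.exists_symbol N' t
      refine ⟨T', ⟨N', fun x f hf => by simpa using hT'0 x f hf⟩, fun x hx s => ?_⟩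
      have hmem : ((r + 1, 0) : ℕ × ℕ) ∈ Finset.HasAntidiagonal.antidiagonal (r + 1) :=
        Finset.HasAntidiagonal.mem_antidiagonal.2 (by simp)
      have hlt : ∀ p ∈ (Finset.HasAntidiagonal.antidiagonal (r + 1)).erase ((r + 1, 0) : ℕ × ℕ),
          p.1 < r + 1 ∧ p.2 < r + 2 := by
        intro p hp
        rw [Finset.mem_erase, Finset.HasAntidiagonal.mem_antidiagonal] at hp
        refine ⟨lt_of_not_ge fun h => hp.1 (Prod.ext (by simp; omega) (by simp; omega)), by omega⟩
      rw [← Finset.add_sum_erase _ _ hmem]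
      have hold : ∑ p ∈ (Finset.HasAntidiagonal.antidiagonal (r + 1)).erase ((r + 1, 0) : ℕ × ℕ),
          ev x (Function.update T (r + 1) T' p.1 (coeff D p.2 (word (F.coord D x) (w s)))) =
          ∑ p ∈ (Finset.HasAntidiagonal.antidiagonal (r + 1)).erase ((r + 1, 0) : ℕ × ℕ),
            ev x (g p s) := by
        refine Finset.sum_congr rfl fun p hp => ?_
        rw [Function.update_of_ne (hlt p hp).1.ne, hg]
      rw [hold, Function.update_self, F.coeff_zero_word, hw]
      rcases le_or_gt s.card N' with hs | hs
      · rw [hT' x hx s hs, ht]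
        simp only [map_sub, map_sum, apply_ite (ev x), map_zero]
        ring
      · rw [hT'0 x _ (Ideal.pow_le_pow_right hs (F.mono_mem x s)), zero_add, if_neg (by omega)]
        refine Finset.sum_eq_zero fun p hp => ?_
        have hp' := hlt p hp
        rw [hg]
        refine hk ⟨p.1, hp'.1⟩ x _ (hN ⟨p.1, hp'.1⟩ p.2 x hx (w s) ?_)
        have h1 : N ⟨p.1, hp'.1⟩ p.2 ≤ ∑ p' ∈ Finset.range (r + 2), N ⟨p.1, hp'.1⟩ p' :=
          Finset.single_le_sum (f := fun p' => N ⟨p.1, hp'.1⟩ p') (fun _ _ => Nat.zero_le _)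
            (Finset.mem_range.2 hp'.2)
        have h2 : ∑ p' ∈ Finset.range (r + 2), N ⟨p.1, hp'.1⟩ p' ≤
            ∑ q, ∑ p' ∈ Finset.range (r + 2), N q p' :=
          Finset.single_le_sum (f := fun q => ∑ p' ∈ Finset.range (r + 2), N q p')
            (fun _ _ => Nat.zero_le _) (Finset.mem_univ _)
        rw [hlen]
        omega
  obtain ⟨T, hT0, hT⟩ := hseq
  refine ⟨T, hT0, fun x hx => ⟨fun a => ?_, fun r => ?_, fun s r hr => ?_, fun s r hr => ?_⟩⟩
  · ext k
    rcases k with _ | k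
    · rw [coeff_stateAt, PowerSeries.coeff_zero_X_mul]
      refine Finset.sum_eq_zero fun p hp => ?_
      rw [Finset.HasAntidiagonal.mem_antidiagonal] at hp
      rw [coeff_lam_mul, if_pos (by omega)]
      simp
    · rw [coeff_stateAt, PowerSeries.coeff_succ_X_mul, coeff_stateAt,
        Finset.Nat.sum_antidiagonal_succ']
      simp [coeff_lam_mul]
  · obtain ⟨κ, hκ⟩ := exists_coeff_filt_mem D
    choose k hk using fun q => (hT q).1
    refine ⟨2 * ∑ q ∈ Finset.range (r + 1), (κ q + ∑ q' ∈ Finset.range (r + 1), (k q' + 1)),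
      fun a ha => ?_⟩
    rw [coeff_stateAt]
    refine Finset.sum_eq_zero fun p hp => hk p.1 x _ ?_
    rw [Finset.HasAntidiagonal.mem_antidiagonal] at hp
    refine Ideal.pow_le_pow_right ?_ (hκ _ _ a ha p.2)
    have h1 := Finset.single_le_sum (f := fun q' => k q' + 1) (fun _ _ => Nat.zero_le _)
      (Finset.mem_range.2 (show p.1 < r + 1 by omega))
    have h2 := Finset.single_le_sum
      (f := fun q => κ q + ∑ q' ∈ Finset.range (r + 1), (k q' + 1)) (fun _ _ => Nat.zero_le _)
      (Finset.mem_range.2 (show p.2 < r + 1 by omega))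
    omega
  · rw [coeff_stateAt, (hT r).2 x hx s, if_neg (by omega)]
  · rw [coeff_stateAt, (hT r).2 x hx s, if_pos hr, hmev]

/-- Near each point there are operators `Tᵣ` with `T₀ = id` such that the functionals
`a ↦ ∑ᵣ λʳ Tᵣ(a)(x)` are positive for the star product. -/
theorem LocalFrame.exists_isNonneg (F : LocalFrame ev U ι) (D : UnitalStarProduct A)
    (hev : ∀ x f, ev x (star f) = conj (ev x f)) :
    ∃ T : ℕ → A →ₗ[ℂ] A, T 0 = LinearMap.id ∧ ∀ x ∈ U, ∀ a : StarSeries D,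
      IsNonneg (stateAt ev D T x (star a * a)) := by
  obtain ⟨T, hT0, hT⟩ := F.exists_isQuasiFree D hev (fun s => s.toList)
    (fun s => s.coe_toList)
  -- the real part of the functional is still a deformation of the evaluation
  let T' : ℕ → A →ₗ[ℂ] A := fun r =>
    { toFun := fun f => (2⁻¹ : ℂ) • (T r f + star (T r (star f)))
      map_add' := fun f g => by
        simp only [star_add, map_add, smul_add]; abel
      map_smul' := fun c f => by
        simp only [star_smul, map_smul, star_star, RingHom.id_apply, smul_comm _ c, ← smul_add] }
  refine ⟨T', ?_, fun x hx a => ?_⟩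
  · ext f
    simp only [T', hT0, LinearMap.coe_mk, AddHom.coe_mk, LinearMap.id_apply, star_star,
      ← two_smul ℂ f, smul_smul]
    norm_num
  have hre : ∀ k, PowerSeries.coeff k (stateAt ev D T' x (star a * a)) =
      (((PowerSeries.coeff k (stateAt ev D T x (star a * a))).re : ℝ) : ℂ) := by
    intro k
    rw [coeff_stateAt, coeff_stateAt, Complex.re_sum, Complex.ofReal_sum]
    refine Finset.sum_congr rfl fun p _ => ?_
    have hs : star (coeff D p.2 (star a * a)) = coeff D p.2 (star a * a) := by
      rw [← coeff_star, star_mul, star_star]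
    simp only [T', LinearMap.coe_mk, AddHom.coe_mk, hs, map_smul, map_add, hev, smul_eq_mul,
      Complex.add_conj]
    push_cast
    ring
  refine ⟨PowerSeries.mk fun k => (PowerSeries.coeff k (stateAt ev D T x (star a * a))).re,
    ?_, ?_⟩
  · ext k
    rw [hre, PowerSeries.coeff_map, PowerSeries.coeff_mk]
    rfl
  · rcases (hT x hx).star_mul_self_nonneg (F.formalPoint D hev hx) (fun s => s.coe_toList)
      (F.sum_beta D hev x) a with h | ⟨d, hd, hlt⟩
    · left
      ext k
      simp [h]
    · right
      refine ⟨d, ?_, fun r hr => ?_⟩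
      · rw [PowerSeries.coeff_mk]
        exact (Complex.lt_def.1 hd).1
      · rw [PowerSeries.coeff_mk, hlt r hr]
        rfl

end QuasiFree

/-! ### Local frames on manifolds -/

section Hadamard

open MeasureTheory Set

variable {E : Type*} [NormedAddCommGroup E] [NormedSpace ℝ E]

theorem contDiff_integral_segment {h : E → ℂ} (hh : ContDiff ℝ ∞ h) (u₀ : E) :
    ContDiff ℝ ∞ fun u => ∫ t in (0 : ℝ)..1, h (u₀ + t • (u - u₀)) := by
  -- the integral is a convolution, evaluated at `0`, with a compactly supported kernel
  let χ : ContDiffBump (0 : ℝ) := ⟨2, 3, by norm_num, by norm_num⟩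
  let f : ℝ → ℝ := indicator (Ioc 0 1) 1
  let g : E → ℝ → ℂ := fun u t => χ t • h (u₀ - t • (u - u₀))
  have hf : LocallyIntegrable f volume :=
    ((integrable_indicator_iff measurableSet_Ioc).2
      (integrableOn_const (by simp) (by simp))).locallyIntegrable
  have hg : ContDiff ℝ ∞ (Function.uncurry g) := by
    refine (χ.contDiff.comp contDiff_snd).smul (hh.comp ?_)
    exact contDiff_const.sub (contDiff_snd.smul (contDiff_fst.sub contDiff_const))
  have h1 := contDiffOn_convolution_right_with_param_comp (𝕜 := ℝ) (n := ⊤) (μ := volume)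
    (ContinuousLinearMap.lsmul ℝ ℝ : ℝ →L[ℝ] ℂ →L[ℝ] ℂ) (s := (univ : Set E))
    (v := fun _ => (0 : ℝ)) contDiffOn_const (f := f) (g := g) isOpen_univ
    (isCompact_closedBall (0 : ℝ) 3)
    (fun p x _ hx => by
      have : χ x = 0 := χ.zero_of_le_dist (le_of_not_ge fun h => hx h)
      simp [g, this]) hf hg.contDiffOn
  rw [contDiffOn_univ] at h1
  convert h1 using 2 with u
  rw [intervalIntegral.integral_of_le zero_le_one, ← integral_indicator measurableSet_Ioc,
    convolution_def]
  congr 1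
  funext t
  by_cases ht : t ∈ Ioc (0 : ℝ) 1
  · have hχ : χ (-t) = 1 := χ.one_of_mem_closedBall (by
      rw [mem_closedBall_zero_iff, norm_neg, Real.norm_of_nonneg ht.1.le]
      exact ht.2.trans (by norm_num [χ]))
    simp [f, g, ht, hχ]
  · simp [f, ht]

/-- Hadamard's lemma. -/
theorem exists_eq_sum_coord_mul {ι : Type*} [Fintype ι] [FiniteDimensional ℝ E]
    (b : Module.Basis ι ℝ E)
    {f : E → ℂ} (hf : ContDiff ℝ ∞ f) (u₀ : E) :
    ∃ g : ι → E → ℂ, (∀ i, ContDiff ℝ ∞ (g i)) ∧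
      ∀ u, f u = f u₀ + ∑ i, ((b.repr u i - b.repr u₀ i : ℝ) : ℂ) * g i u := by
  refine ⟨fun i u => ∫ t in (0 : ℝ)..1, fderiv ℝ f (u₀ + t • (u - u₀)) (b i),
    fun i => contDiff_integral_segment
      (h := fun u => fderiv ℝ f u (b i))
      ((hf.fderiv_right (by norm_num)).clm_apply contDiff_const) u₀, fun u => ?_⟩
  have hcont : ∀ v, Continuous fun t : ℝ => fderiv ℝ f (u₀ + t • (u - u₀)) v := fun v =>
    ((hf.continuous_fderiv (by simp)).comp (by fun_prop)).clm_apply continuous_const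
  have hder : ∀ t ∈ uIcc (0 : ℝ) 1, HasDerivAt (fun t : ℝ => f (u₀ + t • (u - u₀)))
      (fderiv ℝ f (u₀ + t • (u - u₀)) (u - u₀)) t := by
    intro t _
    have h1 : HasDerivAt (fun t : ℝ => u₀ + t • (u - u₀)) (u - u₀) t := by
      simpa using ((hasDerivAt_id t).smul_const (u - u₀)).const_add u₀
    exact ((hf.differentiable (by simp)) _).hasFDerivAt.comp_hasDerivAt t h1
  have h := intervalIntegral.integral_eq_sub_of_hasDerivAt hder
    ((hcont _).intervalIntegrable _ _)
  simp only [one_smul, zero_smul, add_zero, add_sub_cancel] at h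
  rw [← sub_eq_iff_eq_add', ← h]
  have hsum : ∀ t : ℝ, fderiv ℝ f (u₀ + t • (u - u₀)) (u - u₀) =
      ∑ i, ((b.repr u i - b.repr u₀ i : ℝ) : ℂ) * fderiv ℝ f (u₀ + t • (u - u₀)) (b i) := by
    intro t
    have hL : ∀ L : E →L[ℝ] ℂ, L (u - u₀) =
        ∑ i, ((b.repr u i - b.repr u₀ i : ℝ) : ℂ) * L (b i) := by
      intro L
      conv_lhs => rw [← b.sum_repr (u - u₀), map_sum]
      simp
    exact hL _
  simp only [hsum]
  have hint : ∀ i ∈ Finset.univ, IntervalIntegrable (fun t : ℝ =>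
      ((b.repr u i - b.repr u₀ i : ℝ) : ℂ) * fderiv ℝ f (u₀ + t • (u - u₀)) (b i)) volume 0 1 :=
    fun i _ => (continuous_const.mul (hcont _)).intervalIntegrable _ _
  rw [intervalIntegral.integral_finsetSum hint]
  simp only [intervalIntegral.integral_const_mul]

end Hadamard

section Manifold

open Set Topology

variable {E : Type*} [NormedAddCommGroup E] [NormedSpace ℝ E]
variable {M : Type*} [TopologicalSpace M] [ChartedSpace E M]

/-- Evaluation of smooth functions at a point. -/
noncomputable def evalAt (x : M) : SmoothFunctions E M →ₐ[ℂ] ℂ :=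
  (Pi.evalAlgHom ℂ (fun _ : M => ℂ) x).comp (SmoothFunctions E M).subtype.toAlgHom

@[simp]
theorem evalAt_apply (x : M) (f : SmoothFunctions E M) : evalAt x f = (f : M → ℂ) x := rfl

theorem evalAt_star (x : M) (f : SmoothFunctions E M) :
    evalAt x (star f) = starRingEnd ℂ (evalAt x f) := rfl

theorem SmoothFunctions.ext_evalAt {f g : SmoothFunctions E M}
    (h : ∀ x, evalAt x f = evalAt x g) : f = g :=
  Subtype.ext (funext h)

variable [IsManifold 𝓘(ℝ, E) ∞ M]

theorem contDiffOn_comp_chart_symm (x₀ : M) (f : SmoothFunctions E M) :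
    ContDiffOn ℝ ∞ ((f : M → ℂ) ∘ (chartAt E x₀).symm) (chartAt E x₀).target := by
  rw [← contMDiffOn_iff_contDiffOn]
  exact ContMDiff.comp_contMDiffOn (I' := 𝓘(ℝ, E)) f.2 contMDiffOn_chart_symm

theorem differentiableAt_comp_chart_symm {x₀ x : M} (hx : x ∈ (chartAt E x₀).source)
    (f : SmoothFunctions E M) :
    DifferentiableAt ℝ ((f : M → ℂ) ∘ (chartAt E x₀).symm) (chartAt E x₀ x) :=
  ((contDiffOn_comp_chart_symm x₀ f).contDiffAt ((chartAt E x₀).open_target.mem_nhds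
    ((chartAt E x₀).map_source hx))).differentiableAt (by simp)

theorem contMDiffOn_comp_chart {x₀ : M} {g : E → ℂ}
    (hg : ContDiffOn ℝ ∞ g (chartAt E x₀).target) :
    ContMDiffOn 𝓘(ℝ, E) 𝓘(ℝ, ℂ) ∞ (g ∘ chartAt E x₀) (chartAt E x₀).source :=
  hg.contMDiffOn.comp contMDiffOn_chart (chartAt E x₀).mapsTo

variable [FiniteDimensional ℝ E] [T2Space M]

/-- The product of a bump function with a function that is smooth on the chart domain. -/
noncomputable def bumpMul {x₀ : M} (χ : SmoothBumpFunction 𝓘(ℝ, E) x₀) (g : M → ℂ)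
    (hg : ContMDiffOn 𝓘(ℝ, E) 𝓘(ℝ, ℂ) ∞ g (chartAt E x₀).source) : SmoothFunctions E M :=
  ⟨fun x => χ x • g x, χ.contMDiff_smul hg⟩

/-- A coordinate vector field, cut off by a bump function. -/
noncomputable def chartDerivation {x₀ : M} (χ : SmoothBumpFunction 𝓘(ℝ, E) x₀) (v : E) :
    Derivation ℂ (SmoothFunctions E M) (SmoothFunctions E M) :=
  Derivation.mk'
    { toFun := fun f => bumpMul χ
        ((fun u => fderiv ℝ ((f : M → ℂ) ∘ (chartAt E x₀).symm) u v) ∘ chartAt E x₀)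
        (contMDiffOn_comp_chart (((contDiffOn_comp_chart_symm x₀ f).fderiv_of_isOpen
          (chartAt E x₀).open_target (by norm_num)).clm_apply contDiffOn_const))
      map_add' := fun f g => Subtype.ext (funext fun x => by
        by_cases hx : x ∈ (chartAt E x₀).source
        · have := fderiv_add (differentiableAt_comp_chart_symm hx f)
            (differentiableAt_comp_chart_symm hx g)
          have h2 := congrArg (fun L => χ x • L v) this
          rw [_root_.add_apply, smul_add] at h2
          exact h2
        · have : χ x = 0 := by
            by_contra h
            exact hx (χ.support_subset_source h)
          simp [bumpMul, this])
      map_smul' := fun c f => Subtype.ext (funext fun x => by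
        by_cases hx : x ∈ (chartAt E x₀).source
        · have := fderiv_const_smul (differentiableAt_comp_chart_symm hx f) c
          have h2 := congrArg (fun L => χ x • L v) this
          rw [_root_.smul_apply, smul_comm] at h2
          exact h2
        · have : χ x = 0 := by
            by_contra h
            exact hx (χ.support_subset_source h)
          simp [bumpMul, this]) }
    (fun f g => Subtype.ext (funext fun x => by
        by_cases hx : x ∈ (chartAt E x₀).source
        · have := fderiv_mul (differentiableAt_comp_chart_symm hx f)
            (differentiableAt_comp_chart_symm hx g)
          have h2 := congrArg (fun L => χ x • L v) this
          simp only [Function.comp_apply, (chartAt E x₀).left_inv hx,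
            _root_.add_apply, _root_.smul_apply, smul_add] at h2
          rw [smul_comm, smul_comm (χ x)] at h2
          exact h2
        · have : χ x = 0 := by
            by_contra h
            exact hx (χ.support_subset_source h)
          simp [bumpMul, this]))

theorem chartDerivation_apply {x₀ : M} (χ : SmoothBumpFunction 𝓘(ℝ, E) x₀) (v : E)
    (f : SmoothFunctions E M) (x : M) : evalAt x (chartDerivation χ v f) =
      χ x • fderiv ℝ ((f : M → ℂ) ∘ (chartAt E x₀).symm) (chartAt E x₀ x) v := rfl

end Manifold

section Frames

open Set Topology

variable {E : Type*} [NormedAddCommGroup E] [NormedSpace ℝ E] [FiniteDimensional ℝ E]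
variable {M : Type*} [TopologicalSpace M] [ChartedSpace E M] [IsManifold 𝓘(ℝ, E) ∞ M] [T2Space M]

theorem bumpMul_apply_of_eq_one {x₀ x : M} {χ : SmoothBumpFunction 𝓘(ℝ, E) x₀} (hx : χ x = 1)
    {g : M → ℂ} (hg : ContMDiffOn 𝓘(ℝ, E) 𝓘(ℝ, ℂ) ∞ g (chartAt E x₀).source) :
    evalAt x (bumpMul χ g hg) = g x := by
  change χ x • g x = g x
  rw [hx, one_smul]

/-- A real coordinate function, as a complex-valued function on the model space. -/
noncomputable def modelCoord (i : Fin (Module.finrank ℝ E)) : E →L[ℝ] ℂ :=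
  Complex.ofRealCLM.comp (LinearMap.toContinuousLinearMap ((Module.finBasis ℝ E).coord i))

theorem modelCoord_apply (i : Fin (Module.finrank ℝ E)) (u : E) :
    modelCoord i u = (((Module.finBasis ℝ E).repr u i : ℝ) : ℂ) := rfl

/-- A chart coordinate, cut off by a bump function. -/
noncomputable def chartCoord {x₀ : M} (χ : SmoothBumpFunction 𝓘(ℝ, E) x₀)
    (i : Fin (Module.finrank ℝ E)) : SmoothFunctions E M :=
  bumpMul χ (modelCoord i ∘ chartAt E x₀) (contMDiffOn_comp_chart
    (modelCoord i).contDiff.contDiffOn)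

omit [IsManifold 𝓘(ℝ, E) ∞ M] [T2Space M] in
theorem eq_one_of_mem_interior {x₀ x : M} {χ : SmoothBumpFunction 𝓘(ℝ, E) x₀}
    (hx : x ∈ interior {z | χ z = 1}) : χ x = 1 :=
  interior_subset (s := {z | χ z = 1}) hx

omit [IsManifold 𝓘(ℝ, E) ∞ M] [T2Space M] in
theorem mem_source_of_eq_one {x₀ x : M} {χ : SmoothBumpFunction 𝓘(ℝ, E) x₀} (hx : χ x = 1) :
    x ∈ (chartAt E x₀).source :=
  χ.support_subset_source (by rw [Function.mem_support, hx]; exact one_ne_zero)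

/-- By Hadamard's lemma, the functions vanishing at `x` are generated by the coordinates, up to
the square of the vanishing ideal. -/
theorem mem_span_chartCoord_sup {x₀ x : M} (χ : SmoothBumpFunction 𝓘(ℝ, E) x₀)
    (hx : x ∈ interior {z | χ z = 1}) {f : SmoothFunctions E M}
    (hf : f ∈ RingHom.ker (evalAt (E := E) x)) :
    f ∈ Submodule.span ℂ (range fun i => chartCoord χ i -
        algebraMap ℂ (SmoothFunctions E M) (evalAt x (chartCoord χ i))) ⊔
      (RingHom.ker (evalAt (E := E) x) ^ 2 : Ideal (SmoothFunctions E M)).restrictScalars ℂ := by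
  set e := chartAt E x₀ with he
  have hU1 : ∀ z ∈ interior {z | χ z = 1}, χ z = 1 := fun z hz => eq_one_of_mem_interior hz
  have hUs : interior {z | χ z = 1} ⊆ e.source := fun z hz => mem_source_of_eq_one (hU1 z hz)
  have hxs := hUs hx
  have hopen : IsOpen (e '' interior {z | χ z = 1}) :=
    e.isOpen_image_of_subset_source isOpen_interior hUs
  obtain ⟨ε, hε, hball⟩ := Metric.nhds_basis_closedBall.mem_iff.1
    (hopen.mem_nhds (mem_image_of_mem e hx))
  -- a bump function on the model space supported where the chart is trivialised by `χ`
  let ρ : ContDiffBump (e x) := ⟨ε / 2, ε, by positivity, by linarith⟩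
  have hρt : tsupport ρ ⊆ e.target := by
    rw [ρ.tsupport_eq]
    refine hball.trans ?_
    rintro _ ⟨z, hz, rfl⟩
    exact e.map_source (hUs hz)
  let F : E → ℂ := fun u => ρ u • (f : M → ℂ) (e.symm u)
  have hF : ContDiff ℝ ∞ F := by
    refine contDiff_iff_contDiffAt.2 fun u => ?_
    by_cases hu : u ∈ tsupport ρ
    · exact ρ.contDiff.contDiffAt.smul ((contDiffOn_comp_chart_symm x₀ f).contDiffAt
        (e.open_target.mem_nhds (hρt hu)))
    · refine (contDiffAt_const (c := (0 : ℂ))).congr_of_eventuallyEq ?_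
      filter_upwards [(isClosed_tsupport ρ).isOpen_compl.mem_nhds hu] with v hv
      simp [F, image_eq_zero_of_notMem_tsupport hv]
  obtain ⟨G, hG, hFG⟩ := exists_eq_sum_coord_mul (Module.finBasis ℝ E) hF (e x)
  have hfx : (f : M → ℂ) x = 0 := hf
  have hF0 : F (e x) = 0 := by simp [F, e.left_inv hxs, hfx]
  let d : SmoothFunctions E M := bumpMul χ ((fun u => (ρ u : ℂ)) ∘ e)
    (contMDiffOn_comp_chart (Complex.ofRealCLM.contDiff.comp ρ.contDiff).contDiffOn)
  let g : Fin (Module.finrank ℝ E) → SmoothFunctions E M := fun i =>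
    d * bumpMul χ (G i ∘ e) (contMDiffOn_comp_chart (hG i).contDiffOn)
  let y : Fin (Module.finrank ℝ E) → SmoothFunctions E M := fun i =>
    chartCoord χ i - algebraMap ℂ (SmoothFunctions E M) (evalAt x (chartCoord χ i))
  have hd : ∀ z, evalAt z d ≠ 0 → χ z = 1 := by
    intro z hz
    have hz' : χ z • (ρ (e z) : ℂ) ≠ 0 := hz
    have h1 : z ∈ e.source := χ.support_subset_source fun h => hz' (by rw [h, zero_smul])
    have h2 : e z ∈ Metric.closedBall (e x) ε := by
      have : e z ∈ Function.support ρ := fun h => hz' (by simp [h])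
      rw [ρ.support_eq] at this
      exact Metric.ball_subset_closedBall this
    obtain ⟨w, hw, hwz⟩ := hball h2
    rw [← e.injOn (hUs hw) h1 hwz]
    exact hU1 w hw
  have hdx : evalAt x d = 1 := by
    rw [bumpMul_apply_of_eq_one (hU1 x hx)]
    simp [ρ.one_of_mem_closedBall (Metric.mem_closedBall_self (by positivity))]
  have hy : ∀ i, y i ∈ RingHom.ker (evalAt (E := E) x) := fun i => by
    simp [y, RingHom.mem_ker, -evalAt_apply]
  have hdec : f = (1 - d * d) * f + ∑ i, y i * g i := by
    refine SmoothFunctions.ext_evalAt fun z => ?_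
    rw [map_add, map_mul, map_sub, map_one, map_mul, map_sum]
    by_cases hz : evalAt z d = 0
    · simp [g, hz, -evalAt_apply]
    · have h1 := hd z hz
      have h2 := hFG (e z)
      rw [hF0, zero_add] at h2
      simp only [F, e.left_inv (mem_source_of_eq_one h1)] at h2
      have h3 : evalAt z d * evalAt z f =
          ∑ i, evalAt z (y i) *
            evalAt z (bumpMul χ (G i ∘ e) (contMDiffOn_comp_chart (hG i).contDiffOn)) := by
        rw [bumpMul_apply_of_eq_one h1]
        simp only [Function.comp_apply]
        rw [← Complex.real_smul, evalAt_apply, h2]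
        refine Finset.sum_congr rfl fun i _ => ?_
        rw [bumpMul_apply_of_eq_one h1, map_sub, AlgHom.commutes, chartCoord,
          bumpMul_apply_of_eq_one h1, bumpMul_apply_of_eq_one (hU1 x hx)]
        simp [modelCoord_apply, e]
      simp only [g, map_mul]
      have h4 : ∀ i, evalAt z (y i) * (evalAt z d *
            evalAt z (bumpMul χ (G i ∘ e) (contMDiffOn_comp_chart (hG i).contDiffOn))) =
          evalAt z d * (evalAt z (y i) *
            evalAt z (bumpMul χ (G i ∘ e) (contMDiffOn_comp_chart (hG i).contDiffOn))) :=
        fun i => by ring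
      rw [Finset.sum_congr rfl fun i _ => h4 i, ← Finset.mul_sum, ← h3]
      ring
  rw [hdec]
  refine add_mem (Submodule.mem_sup_right ?_) (sum_mem fun i _ => ?_)
  · rw [Submodule.restrictScalars_mem, pow_two]
    refine Ideal.mul_mem_mul ?_ hf
    simp [RingHom.mem_ker, hdx, -evalAt_apply]
  · have h1 : y i * g i = evalAt x (g i) • y i +
        y i * (g i - algebraMap ℂ (SmoothFunctions E M) (evalAt x (g i))) := by
      rw [Algebra.smul_def]
      ring
    rw [h1]
    refine add_mem (Submodule.mem_sup_left (Submodule.smul_mem _ _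
      (Submodule.subset_span ⟨i, rfl⟩))) (Submodule.mem_sup_right ?_)
    rw [Submodule.restrictScalars_mem, pow_two]
    refine Ideal.mul_mem_mul (hy i) ?_
    simp [RingHom.mem_ker, -evalAt_apply]

/-- The coordinates of a chart and the corresponding vector fields, cut off by a bump function,
form a frame where the bump function is `1`. -/
noncomputable def chartFrame {x₀ : M} (χ : SmoothBumpFunction 𝓘(ℝ, E) x₀) :
    LocalFrame (A := SmoothFunctions E M) evalAt (interior {z : M | χ z = 1})
      (Fin (Module.finrank ℝ E)) where
  y := chartCoord χ
  X i := chartDerivation χ (Module.finBasis ℝ E i)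
  star_y i := SmoothFunctions.ext_evalAt fun x => by
    rw [evalAt_star]
    change starRingEnd ℂ (χ x • (((Module.finBasis ℝ E).repr (chartAt E x₀ x) i : ℝ) : ℂ)) =
      χ x • (((Module.finBasis ℝ E).repr (chartAt E x₀ x) i : ℝ) : ℂ)
    simp
  X_y x hx i j := by
    have h1 : χ x = 1 := eq_one_of_mem_interior hx
    have hxs := mem_source_of_eq_one h1
    have hev : ((chartCoord χ j : SmoothFunctions E M) : M → ℂ) ∘ (chartAt E x₀).symm
        =ᶠ[𝓝 (chartAt E x₀ x)] modelCoord j := by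
      have h2 : (chartAt E x₀).symm ⁻¹' interior {z : M | χ z = 1} ∈ 𝓝 (chartAt E x₀ x) :=
        ((chartAt E x₀).continuousAt_symm ((chartAt E x₀).map_source hxs))
          (by rw [(chartAt E x₀).left_inv hxs]; exact isOpen_interior.mem_nhds hx)
      filter_upwards [h2, (chartAt E x₀).open_target.mem_nhds ((chartAt E x₀).map_source hxs)]
        with u hu hut
      have h3 : χ ((chartAt E x₀).symm u) = 1 := eq_one_of_mem_interior hu
      have h4 := bumpMul_apply_of_eq_one h3 (contMDiffOn_comp_chart
        (modelCoord j).contDiff.contDiffOn)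
      rw [Function.comp_apply, (chartAt E x₀).right_inv hut] at h4
      exact h4
    rw [chartDerivation_apply, h1, one_smul, hev.fderiv_eq, ContinuousLinearMap.fderiv,
      modelCoord_apply, Module.Basis.repr_self, Finsupp.single_apply]
    split_ifs <;> simp
  le_span x hx f hf := mem_span_chartCoord_sup χ hx hf

end Frames

/-! ### The cone of non-negative power series -/

section Nonneg

/-- A series is non-negative if and only if it is real and each of its coefficients that is
preceded by zeros only is non-negative. -/
theorem isNonneg_iff {z : ℂ⟦X⟧} : IsNonneg z ↔ (∀ k, (PowerSeries.coeff k z).im = 0) ∧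
    ∀ k, (∀ j < k, PowerSeries.coeff j z = 0) → 0 ≤ (PowerSeries.coeff k z).re := by
  constructor
  · rintro ⟨a, rfl, ha⟩
    refine ⟨fun k => by simp, fun k hk => ?_⟩
    simp only [PowerSeries.coeff_map, Complex.coe_algebraMap, Complex.ofReal_eq_zero,
      Complex.ofReal_re] at hk ⊢
    rcases ha with rfl | ⟨r, hr, hr0⟩
    · simp
    · rcases lt_trichotomy k r with h | rfl | h
      · exact (hr0 k h).ge
      · exact hr.le
      · exact absurd (hk r h) hr.ne'
  · rintro ⟨him, hre⟩
    have hz : ∀ k, PowerSeries.coeff k z = (((PowerSeries.coeff k z).re : ℝ) : ℂ) := fun k =>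
      Complex.ext rfl (by simp [him])
    refine ⟨PowerSeries.mk fun k => (PowerSeries.coeff k z).re, ?_, ?_⟩
    · ext k
      rw [PowerSeries.coeff_map, PowerSeries.coeff_mk]
      exact hz k
    · by_cases h : ∃ k, PowerSeries.coeff k z ≠ 0
      · right
        classical
        refine ⟨Nat.find h, ?_, fun s hs => ?_⟩
        · rw [PowerSeries.coeff_mk]
          refine (hre _ fun j hj => by simpa using Nat.find_min h hj).lt_of_ne fun h0 => ?_
          have h1 := Nat.find_spec h
          rw [hz, ← h0] at h1
          exact h1 rfl
        · rw [PowerSeries.coeff_mk]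
          have h1 : PowerSeries.coeff s z = 0 := by simpa using Nat.find_min h hs
          rw [h1, Complex.zero_re]
      · left
        push Not at h
        ext k
        simp [h]

theorem isNonneg_zero : IsNonneg 0 := isNonneg_iff.2 ⟨by simp, by simp⟩

theorem IsNonneg.add {z w : ℂ⟦X⟧} (hz : IsNonneg z) (hw : IsNonneg w) : IsNonneg (z + w) := by
  rw [isNonneg_iff] at *
  refine ⟨fun k => by simp [hz.1, hw.1], fun k hk => ?_⟩
  have h : ∀ j ≤ k, ∀ i < j, PowerSeries.coeff i z = 0 ∧ PowerSeries.coeff i w = 0 := by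
    intro j
    induction j with
    | zero => intro _ i hi; omega
    | succ j ih =>
      intro hj i hi
      rcases Nat.lt_succ_iff_lt_or_eq.1 hi with hi | rfl
      · exact ih (by omega) i hi
      · have h1 := hz.2 i fun l hl => (ih (by omega) l hl).1
        have h2 := hw.2 i fun l hl => (ih (by omega) l hl).2
        have h3 := congrArg Complex.re (hk i (by omega))
        rw [map_add, Complex.add_re, Complex.zero_re] at h3
        exact ⟨Complex.ext (by rw [Complex.zero_re]; linarith) (hz.1 i),
          Complex.ext (by rw [Complex.zero_re]; linarith) (hw.1 i)⟩
  rw [map_add, Complex.add_re]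
  exact add_nonneg (hz.2 k fun j hj => (h k le_rfl j hj).1)
    (hw.2 k fun j hj => (h k le_rfl j hj).2)

theorem IsNonneg.smul {z : ℂ⟦X⟧} (hz : IsNonneg z) {c : ℝ} (hc : 0 ≤ c) :
    IsNonneg ((c : ℂ) • z) := by
  rcases hc.eq_or_lt with rfl | hc
  · simpa using isNonneg_zero
  rw [isNonneg_iff] at *
  refine ⟨fun k => by simp [hz.1], fun k hk => ?_⟩
  rw [map_smul, smul_eq_mul, Complex.re_ofReal_mul]
  refine mul_nonneg hc.le (hz.2 k fun j hj => ?_)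
  simpa [hc.ne'] using hk j hj

theorem IsNonneg.sum {ι : Type*} {s : Finset ι} {z : ι → ℂ⟦X⟧} (hz : ∀ i ∈ s, IsNonneg (z i)) :
    IsNonneg (∑ i ∈ s, z i) :=
  Finset.sum_induction _ IsNonneg (fun _ _ => IsNonneg.add) isNonneg_zero hz

end Nonneg

/-! ### Gluing local deformations of the point evaluations -/

section Gluing

open Set Topology

variable {E : Type*} [NormedAddCommGroup E] [NormedSpace ℝ E] [FiniteDimensional ℝ E]
variable {M : Type*} [TopologicalSpace M] [ChartedSpace E M] [IsManifold 𝓘(ℝ, E) ∞ M] [T2Space M]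

/-- The point evaluations on a manifold deform, smoothly in the point, to positive functionals of
the star product. -/
theorem exists_isNonneg_stateAt [SigmaCompactSpace M]
    (D : UnitalStarProduct (SmoothFunctions E M)) :
    ∃ T : ℕ → SmoothFunctions E M →ₗ[ℂ] SmoothFunctions E M, T 0 = LinearMap.id ∧
      ∀ x, ∀ a : StarSeries D, IsNonneg (stateAt evalAt D T x (star a * a)) := by
  let χ : ∀ x : M, SmoothBumpFunction 𝓘(ℝ, E) x := fun x =>
    Classical.choice inferInstance
  let U : M → Set M := fun x => interior {z | χ x z = 1}
  have hU : ∀ x, x ∈ U x := fun x => mem_interior_iff_mem_nhds.2 (χ x).eventuallyEq_one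
  choose T hT0 hT using fun x : M => (chartFrame (χ x)).exists_isNonneg D evalAt_star
  obtain ⟨ρ, hρ⟩ := SmoothPartitionOfUnity.exists_isSubordinate 𝓘(ℝ, E) (isClosed_univ (X := M)) U
    (fun _ => isOpen_interior) (fun x _ => mem_iUnion.2 ⟨x, hU x⟩)
  let T' : ℕ → SmoothFunctions E M →ₗ[ℂ] SmoothFunctions E M := fun r =>
    { toFun := fun f => ⟨fun x => ∑ᶠ i, ρ i x • evalAt x (T i r f),
        ρ.contMDiff_finsum_smul fun i x _ => (T i r f).2.contMDiffAt⟩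
      map_add' := fun f g => SmoothFunctions.ext_evalAt fun x => by
        change ∑ᶠ i, ρ i x • evalAt x (T i r (f + g)) =
          ∑ᶠ i, ρ i x • evalAt x (T i r f) + ∑ᶠ i, ρ i x • evalAt x (T i r g)
        rw [← ρ.sum_finsupport_smul_eq_finsum x (fun i x => evalAt x (T i r (f + g))),
          ← ρ.sum_finsupport_smul_eq_finsum x (fun i x => evalAt x (T i r f)),
          ← ρ.sum_finsupport_smul_eq_finsum x (fun i x => evalAt x (T i r g)),
          ← Finset.sum_add_distrib]
        simp only [map_add, smul_add]
      map_smul' := fun c f => SmoothFunctions.ext_evalAt fun x => by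
        change ∑ᶠ i, ρ i x • evalAt x (T i r (c • f)) = c * ∑ᶠ i, ρ i x • evalAt x (T i r f)
        rw [← ρ.sum_finsupport_smul_eq_finsum x (fun i x => evalAt x (T i r (c • f))),
          ← ρ.sum_finsupport_smul_eq_finsum x (fun i x => evalAt x (T i r f)), Finset.mul_sum]
        simp only [map_smul, smul_eq_mul, mul_smul_comm] }
  have hT' : ∀ r f x, evalAt x (T' r f) =
      ∑ i ∈ ρ.finsupport x, (ρ i x : ℂ) * evalAt x (T i r f) := by
    intro r f x
    change ∑ᶠ i, ρ i x • evalAt x (T i r f) = _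
    rw [← ρ.sum_finsupport_smul_eq_finsum x (fun i x => evalAt x (T i r f))]
    simp only [Complex.real_smul]
  refine ⟨T', LinearMap.ext fun f => SmoothFunctions.ext_evalAt fun x => ?_, fun x a => ?_⟩
  · rw [hT']
    simp only [hT0, LinearMap.id_apply]
    rw [← Finset.sum_mul, ← Complex.ofReal_sum, ρ.sum_finsupport x (mem_univ x), Complex.ofReal_one,
      one_mul]
  · have h : stateAt evalAt D T' x (star a * a) =
        ∑ i ∈ ρ.finsupport x, (ρ i x : ℂ) • stateAt evalAt D (T i) x (star a * a) := by
      ext k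
      simp only [coeff_stateAt, map_sum, map_smul, hT', smul_eq_mul, Finset.mul_sum]
      rw [Finset.sum_comm]
    rw [h]
    refine IsNonneg.sum fun i hi => (hT i x ?_ a).smul (ρ.nonneg i x)
    exact hρ i (subset_closure ((ρ.mem_finsupport x).1 hi))

end Gluing

/-! ### Positive functionals on matrices of smooth functions -/

section MatrixPositivity

open Set Topology Matrix
open scoped ComplexConjugate ComplexOrder

variable {n : ℕ}

/-- The quadratic form `v ↦ ⟨v, B v⟩` of a complex matrix. -/
noncomputable def quad (B : Matrix (Fin n) (Fin n) ℂ) (v : Fin n → ℂ) : ℂ :=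
  star v ⬝ᵥ (B *ᵥ v)

theorem quad_add (B C : Matrix (Fin n) (Fin n) ℂ) (v : Fin n → ℂ) :
    quad (B + C) v = quad B v + quad C v := by
  rw [quad, quad, quad, add_mulVec, dotProduct_add]

theorem quad_smul (c : ℂ) (B : Matrix (Fin n) (Fin n) ℂ) (v : Fin n → ℂ) :
    quad (c • B) v = c * quad B v := by
  rw [quad, quad, smul_mulVec, dotProduct_smul, smul_eq_mul]

theorem quad_sum {ι : Type*} (s : Finset ι) (B : ι → Matrix (Fin n) (Fin n) ℂ) (v : Fin n → ℂ) :
    quad (∑ i ∈ s, B i) v = ∑ i ∈ s, quad (B i) v := by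
  rw [quad, sum_mulVec, dotProduct_sum]
  rfl

theorem quad_one (v : Fin n → ℂ) : quad 1 v = ((∑ i, ‖v i‖ ^ 2 : ℝ) : ℂ) := by
  rw [quad, one_mulVec, dotProduct, Complex.ofReal_sum]
  refine Finset.sum_congr rfl fun i _ => ?_
  rw [Pi.star_apply, ← starRingEnd_apply, Complex.conj_mul', Complex.ofReal_pow]

theorem quad_real_smul (B : Matrix (Fin n) (Fin n) ℂ) (c : ℝ) (v : Fin n → ℂ) :
    quad B ((c : ℂ) • v) = ((c ^ 2 : ℝ) : ℂ) * quad B v := by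
  rw [quad, quad, mulVec_smul, star_smul, smul_dotProduct, dotProduct_smul, smul_eq_mul,
    smul_eq_mul, ← mul_assoc, ← starRingEnd_apply, Complex.conj_ofReal]
  push_cast
  ring

theorem quad_eq_sum (B : Matrix (Fin n) (Fin n) ℂ) (v : Fin n → ℂ) :
    quad B v = ∑ i, ∑ j, conj (v i) * (B i j * v j) := by
  simp only [quad, dotProduct, mulVec, Finset.mul_sum]
  rfl

theorem continuous_quad : Continuous fun p : Matrix (Fin n) (Fin n) ℂ × (Fin n → ℂ) =>
    quad p.1 p.2 := by
  simp only [quad]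
  fun_prop

/-- A complex matrix whose quadratic form is real is Hermitian. -/
theorem isHermitian_of_quad_im {B : Matrix (Fin n) (Fin n) ℂ} (h : ∀ v, (quad B v).im = 0) :
    B.IsHermitian := by
  ext i j
  have hexp : ∀ c : ℂ, quad B (Pi.single i 1 + Pi.single j c) =
      B i i + c * B i j + conj c * B j i + conj c * c * B j j := by
    intro c
    simp only [quad, mulVec_add, star_add, add_dotProduct, dotProduct_add, Pi.star_single,
      star_one, single_dotProduct, mulVec_single, Pi.smul_apply, col_apply,
      MulOpposite.smul_eq_mul_unop, MulOpposite.unop_op, one_mul]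
    rw [← starRingEnd_apply]
    ring
  have h0 := h (Pi.single i 1)
  have hii : (B i i).im = 0 := by
    have := hexp 0
    rw [Pi.single_zero, add_zero] at this
    rw [this] at h0
    simpa using h0
  have hjj : (B j j).im = 0 := by
    have := h (Pi.single j 1)
    simpa [quad, mulVec_single] using this
  have h1 := h (Pi.single i 1 + Pi.single j 1)
  have h2 := h (Pi.single i 1 + Pi.single j Complex.I)
  rw [hexp] at h1 h2
  simp [hii, hjj] at h1 h2
  rw [conjTranspose_apply]
  refine Complex.ext ?_ ?_
  · simp
    linarith
  · simp
    linarith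

variable {E : Type*} [NormedAddCommGroup E] [NormedSpace ℝ E]
variable {M : Type*} [TopologicalSpace M] [ChartedSpace E M]

/-- The value of a matrix of smooth functions at a point. -/
noncomputable def matrixAt (x : M) (G : Matrix (Fin n) (Fin n) (SmoothFunctions E M)) :
    Matrix (Fin n) (Fin n) ℂ :=
  G.map (evalAt x)

theorem continuous_matrixAt (G : Matrix (Fin n) (Fin n) (SmoothFunctions E M)) :
    Continuous fun x => matrixAt x G :=
  continuous_matrix fun i j => (G i j).2.continuous

theorem matrixAt_add (x : M) (G H : Matrix (Fin n) (Fin n) (SmoothFunctions E M)) :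
    matrixAt x (G + H) = matrixAt x G + matrixAt x H :=
  Matrix.map_add _ (map_add (evalAt x)) G H

theorem matrixAt_smul (x : M) (g : SmoothFunctions E M)
    (G : Matrix (Fin n) (Fin n) (SmoothFunctions E M)) :
    matrixAt x (g • G) = evalAt x g • matrixAt x G := by
  ext i j
  simp [matrixAt, -evalAt_apply]

theorem matrixAt_one (x : M) :
    matrixAt x (1 : Matrix (Fin n) (Fin n) (SmoothFunctions E M)) = 1 :=
  Matrix.map_one _ (map_zero (evalAt x)) (map_one (evalAt x))

theorem matrixAt_sum {ι : Type*} (x : M) (s : Finset ι)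
    (G : ι → Matrix (Fin n) (Fin n) (SmoothFunctions E M)) :
    matrixAt x (∑ i ∈ s, G i) = ∑ i ∈ s, matrixAt x (G i) := by
  ext i j
  simp [matrixAt, Matrix.sum_apply, -evalAt_apply]

theorem star_eq_of_matrixAt {G : Matrix (Fin n) (Fin n) (SmoothFunctions E M)}
    (h : ∀ x, (matrixAt x G).IsHermitian) : star G = G := by
  ext1 i j
  refine SmoothFunctions.ext_evalAt fun x => ?_
  rw [Matrix.star_apply, evalAt_star]
  exact (h x).apply i j

/-- A positive smooth function has a smooth inverse square root. -/
theorem exists_inv_sqrt {a : SmoothFunctions E M} (ha : ∀ x, 0 < evalAt x a) :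
    ∃ s : SmoothFunctions E M, star s = s ∧ s * s * a = 1 := by
  refine ⟨⟨fun x => (((Real.sqrt (evalAt x a).re)⁻¹ : ℝ) : ℂ), fun x => ?_⟩, ?_, ?_⟩
  · have h1 : ContMDiff 𝓘(ℝ, E) 𝓘(ℝ, ℝ) ∞ fun x => (evalAt x a).re :=
      Complex.reCLM.contDiff.contMDiff.comp a.2
    have h2 : ContDiffAt ℝ ∞ (fun t : ℝ => (((Real.sqrt t)⁻¹ : ℝ) : ℂ)) (evalAt x a).re := by
      have h0 := (Complex.lt_def.1 (ha x)).1
      exact Complex.ofRealCLM.contDiff.contDiffAt.comp _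
        ((Real.contDiffAt_sqrt h0.ne').inv (Real.sqrt_ne_zero'.2 h0))
    exact h2.contMDiffAt.comp x h1.contMDiffAt
  · exact SmoothFunctions.ext_evalAt fun x => Complex.conj_ofReal _
  · refine SmoothFunctions.ext_evalAt fun x => ?_
    obtain ⟨hre, him⟩ := Complex.lt_def.1 (ha x)
    rw [Complex.zero_re] at hre
    rw [Complex.zero_im] at him
    have h1 : evalAt x a = (((evalAt x a).re : ℝ) : ℂ) :=
      Complex.ext rfl (by rw [Complex.ofReal_im, ← him])
    rw [map_mul, map_mul, h1]
    change (((Real.sqrt (evalAt x a).re)⁻¹ : ℝ) : ℂ) * (((Real.sqrt (evalAt x a).re)⁻¹ : ℝ) : ℂ) *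
      _ = 1
    rw [← Complex.ofReal_mul, ← Complex.ofReal_mul, ← mul_inv, Real.mul_self_sqrt hre.le,
      inv_mul_cancel₀ hre.ne', Complex.ofReal_one]

variable {φ : Matrix (Fin n) (Fin n) (SmoothFunctions E M) →ₗ[ℂ] ℂ}

/-- A positive functional is non-negative on pointwise positive definite matrices of functions.
The proof is a Cholesky decomposition: subtracting from `G` the square of a multiple of its `k`-th
row clears the `k`-th row and column, and leaves the Schur complement. -/
theorem nonneg_of_quad_pos (hφ : ∀ a, 0 ≤ φ (star a * a)) (s : Finset (Fin n))
    {G : Matrix (Fin n) (Fin n) (SmoothFunctions E M)} (hG : star G = G)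
    (hs : ∀ i ∉ s, ∀ j, G i j = 0)
    (hpos : ∀ x v, (∃ i ∈ s, v i ≠ 0) → 0 < quad (matrixAt x G) v) : 0 ≤ φ G := by
  induction s using Finset.induction_on generalizing G with
  | empty =>
    have : G = 0 := by
      ext1 i j
      exact hs i (Finset.notMem_empty i) j
    rw [this, map_zero]
  | insert k s hk ih =>
    have hstar : ∀ i j, star (G i j) = G j i := fun i j => by
      conv_rhs => rw [← hG, Matrix.star_apply]
    have hkk : ∀ x, 0 < evalAt x (G k k) := fun x => by
      have := hpos x (Pi.single k 1) ⟨k, Finset.mem_insert_self k s, by simp⟩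
      simpa [quad, mulVec_single, matrixAt, -evalAt_apply] using this
    obtain ⟨r, hr, hra⟩ := exists_inv_sqrt hkk
    set B : Matrix (Fin n) (Fin n) (SmoothFunctions E M) :=
      Matrix.of fun l j => if l = k then r * G k j else 0 with hB
    have hBB : ∀ i j, (star B * B) i j = r * r * G i k * G k j := by
      intro i j
      rw [Matrix.mul_apply, Finset.sum_eq_single k]
      · simp only [Matrix.star_apply, hB, Matrix.of_apply, if_pos, star_mul, hr, hstar]
        ring
      · intro l _ hl
        simp [hB, hl]
      · simp
    set G' := G - star B * B with hG'
    have hG'k : ∀ j, G' k j = 0 := fun j => by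
      rw [hG', Matrix.sub_apply, hBB, hra, one_mul, sub_self]
    have hG'h : star G' = G' := by
      rw [hG', star_sub, hG, star_mul, star_star]
    have hG'k' : ∀ i, G' i k = 0 := fun i => by
      rw [← hG'h, Matrix.star_apply, hG'k, star_zero]
    have hsum : G = G' + star B * B := by rw [hG', sub_add_cancel]
    rw [hsum, map_add]
    refine add_nonneg (ih hG'h (fun i hi j => ?_) fun x v hv => ?_) (hφ B)
    · by_cases hik : i = k
      · rw [hik, hG'k]
      · have h0 := hs i (by simp [hik, hi])
        rw [hG', Matrix.sub_apply, hBB, h0, h0]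
        ring
    · obtain ⟨i, hi, hvi⟩ := hv
      have hik : i ≠ k := fun h => hk (h ▸ hi)
      -- change the `k`-th entry of `v` so that `B v = 0`
      set w : Fin n → ℂ := Function.update v k
        (-(evalAt x (G k k))⁻¹ * ∑ j ∈ Finset.univ.erase k, evalAt x (G k j) * v j) with hw
      have hGw : ∑ j, evalAt x (G k j) * w j = 0 := by
        have hwj : ∀ j ∈ Finset.univ.erase k,
            evalAt x (G k j) * w j = evalAt x (G k j) * v j := fun j hj => by
          rw [hw, Function.update_of_ne (Finset.ne_of_mem_erase hj)]
        rw [← Finset.add_sum_erase _ _ (Finset.mem_univ k), Finset.sum_congr rfl hwj, hw,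
          Function.update_self]
        have := (hkk x).ne'
        field_simp
        ring
      have hBw : matrixAt x B *ᵥ w = 0 := by
        ext l
        simp only [mulVec, dotProduct, matrixAt, Matrix.map_apply, hB, Matrix.of_apply,
          Pi.zero_apply]
        by_cases hl : l = k
        · simp only [hl, if_pos, map_mul, mul_assoc, ← Finset.mul_sum, hGw, mul_zero]
        · simp [hl]
      have hvw : quad (matrixAt x G') v = quad (matrixAt x G') w := by
        rw [quad_eq_sum, quad_eq_sum]
        refine Finset.sum_congr rfl fun i _ => Finset.sum_congr rfl fun j _ => ?_
        rcases eq_or_ne i k with rfl | h1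
        · simp [matrixAt, hG'k]
        rcases eq_or_ne j k with rfl | h2
        · simp [matrixAt, hG'k']
        rw [hw, Function.update_of_ne h1, Function.update_of_ne h2]
      have hquad : quad (matrixAt x G) w = quad (matrixAt x G') w := by
        conv_lhs => rw [hsum, matrixAt_add, quad_add]
        rw [add_eq_left, quad, show matrixAt x (star B * B) = matrixAt x (star B) * matrixAt x B
          from Matrix.map_mul, ← mulVec_mulVec, hBw, mulVec_zero, dotProduct_zero]
      rw [hvw, ← hquad]
      refine hpos x w ⟨i, Finset.mem_insert_of_mem hi, ?_⟩
      rw [hw, Function.update_of_ne hik]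
      exact hvi

/-- Positive functionals are real on Hermitian matrices. -/
theorem im_eq_zero_of_star_eq (hφ : ∀ a, 0 ≤ φ (star a * a))
    {G : Matrix (Fin n) (Fin n) (SmoothFunctions E M)} (hG : star G = G) : (φ G).im = 0 := by
  have h1 := (Complex.le_def.1 (hφ (G + 1))).2
  have h2 := (Complex.le_def.1 (hφ (G - 1))).2
  have h3 : (4 : ℂ) • G = star (G + 1) * (G + 1) - star (G - 1) * (G - 1) := by
    rw [star_add, star_sub, star_one, hG, show (4 : ℂ) = ((4 : ℕ) : ℂ) by norm_num,
      Nat.cast_smul_eq_nsmul]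
    simp only [add_mul, sub_mul, mul_add, mul_sub, mul_one, one_mul]
    abel
  have h4 := congrArg (fun z => (φ z).im) h3
  simp only [map_smul, map_sub, smul_eq_mul, Complex.sub_im, ← h1, ← h2] at h4
  simpa using h4

end MatrixPositivity

/-! ### Integration of non-negative series of matrix functions -/

section Integration

open Set Topology Matrix
open scoped ComplexConjugate ComplexOrder

theorem exists_add_mul_pos {X : Type*} [TopologicalSpace X] {K : Set X} (hK : IsCompact K)
    {f g : X → ℝ} (hf : Continuous f) (hg : Continuous g) (hg0 : ∀ v ∈ K, 0 ≤ g v)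
    (h : ∀ v ∈ K, g v = 0 → 0 < f v) : ∃ c : ℝ, ∀ v ∈ K, 0 < f v + c * g v := by
  -- only the part of `K` where `f ≤ 0` needs the help of `g`
  have hK' : IsCompact (K ∩ {v | f v ≤ 0}) := hK.inter_right (isClosed_le hf continuous_const)
  rcases (K ∩ {v | f v ≤ 0}).eq_empty_or_nonempty with he | hne
  · refine ⟨0, fun v hv => ?_⟩
    rw [zero_mul, add_zero]
    by_contra h0
    exact he.le ⟨hv, not_lt.1 h0⟩
  · obtain ⟨u, ⟨huK, hu0⟩, hu⟩ := hK'.exists_isMinOn hne hg.continuousOn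
    obtain ⟨w, ⟨-, hw0⟩, hw⟩ := hK'.exists_isMinOn hne hf.continuousOn
    have hgu : 0 < g u := (hg0 u huK).lt_of_ne fun h0 => (h u huK h0.symm).not_ge hu0
    refine ⟨(1 - f w) / g u, fun v hv => ?_⟩
    have hc : 0 ≤ (1 - f w) / g u := div_nonneg (by linarith [show f w ≤ 0 from hw0]) hgu.le
    rcases lt_or_ge 0 (f v) with h0 | h0
    · have := mul_nonneg hc (hg0 v hv)
      linarith
    · have h1 : g u ≤ g v := hu ⟨hv, h0⟩
      have h2 : f w ≤ f v := hw ⟨hv, h0⟩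
      have h3 := mul_le_mul_of_nonneg_left h1 hc
      rw [div_mul_cancel₀ _ hgu.ne'] at h3
      linarith

/-- If `f` is positive where a lexicographically non-negative sequence of functions vanishes, then
it can be made positive everywhere by adding multiples of these functions. -/
theorem exists_add_sum_mul_pos {X : Type*} [TopologicalSpace X] {K : Set X} (hK : IsCompact K)
    {q : ℕ → X → ℝ} (hq : ∀ j, Continuous (q j)) (k : ℕ)
    (hlex : ∀ v ∈ K, ∀ m < k, (∀ j < m, q j v = 0) → 0 ≤ q m v) {f : X → ℝ} (hf : Continuous f)
    (hf0 : ∀ v ∈ K, (∀ j < k, q j v = 0) → 0 < f v) :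
    ∃ c : ℕ → ℝ, ∀ v ∈ K, 0 < f v + ∑ j ∈ Finset.range k, c j * q j v := by
  induction k generalizing f with
  | zero => exact ⟨0, fun v hv => by simpa using hf0 v hv (by simp)⟩
  | succ k ih =>
    have hcl : IsClosed {v | ∀ j < k, q j v = 0} := by
      simp only [ofPred_forall]
      exact isClosed_iInter fun j => isClosed_iInter fun _ => isClosed_eq (hq j) continuous_const
    obtain ⟨c, hc⟩ := exists_add_mul_pos (hK.inter_right hcl) hf (hq k)
      (fun v hv => hlex v hv.1 k (by omega) hv.2) fun v hv h0 => hf0 v hv.1 fun j hj => by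
        rcases Nat.lt_succ_iff_lt_or_eq.1 hj with h | rfl
        · exact hv.2 j h
        · exact h0
    obtain ⟨c', hc'⟩ := ih (fun v hv m hm => hlex v hv m (by omega))
      (f := fun v => f v + c * q k v) (hf.add (continuous_const.mul (hq k)))
      fun v hv h0 => hc v ⟨hv, h0⟩
    refine ⟨Function.update c' k c, fun v hv => ?_⟩
    rw [Finset.sum_range_succ, Function.update_self, Finset.sum_congr rfl fun j hj => by
      rw [Function.update_of_ne (Finset.mem_range.1 hj).ne]]
    linarith [hc' v hv]

variable {n : ℕ} {E : Type*} [NormedAddCommGroup E] [NormedSpace ℝ E]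
variable {M : Type*} [TopologicalSpace M] [ChartedSpace E M]

/-- A matrix function that is the `k`-th term of a lexicographically non-negative sequence becomes
positive definite, up to `ε`, by adding multiples of the previous terms. -/
theorem exists_quad_add_pos [FiniteDimensional ℝ E] [IsManifold 𝓘(ℝ, E) ∞ M] [T2Space M]
    [SigmaCompactSpace M] {H : ℕ → Matrix (Fin n) (Fin n) (SmoothFunctions E M)}
    (hH : ∀ x v, IsNonneg (PowerSeries.mk fun k => quad (matrixAt x (H k)) v))
    (k : ℕ) {ε : ℝ} (hε : 0 < ε) :
    ∃ c : Fin k → SmoothFunctions E M, (∀ j, star (c j) = c j) ∧ ∀ x, ∀ v ≠ 0,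
      0 < quad (matrixAt x (H k + (algebraMap ℂ (SmoothFunctions E M) ε) • 1 +
        ∑ j, c j • H j)) v := by
  have him : ∀ x v k, (quad (matrixAt x (H k)) v).im = 0 := fun x v k => by
    simpa using (isNonneg_iff.1 (hH x v)).1 k
  have hlex : ∀ x v m, (∀ j < m, (quad (matrixAt x (H j)) v).re = 0) →
      0 ≤ (quad (matrixAt x (H m)) v).re := fun x v m h => by
    have := (isNonneg_iff.1 (hH x v)).2 m fun j hj => by
      rw [PowerSeries.coeff_mk]
      exact Complex.ext (h j hj) (him x v j)
    simpa using this
  have hcont : ∀ j, Continuous fun p : M × (Fin n → ℂ) => (quad (matrixAt p.1 (H j)) p.2).re :=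
    fun j => Complex.continuous_re.comp (continuous_quad.comp
      (((continuous_matrixAt (H j)).comp continuous_fst).prodMk continuous_snd))
  let P : M → (Fin k → ℝ) → (Fin n → ℂ) → ℝ := fun x c v =>
    (quad (matrixAt x (H k)) v).re + ε * ∑ i, ‖v i‖ ^ 2 +
      ∑ j : Fin k, c j * (quad (matrixAt x (H j)) v).re
  have hP : ∀ c, Continuous fun p : M × (Fin n → ℂ) => P p.1 c p.2 := fun c =>
    ((hcont k).add (by fun_prop)).add
      (continuous_finsetSum _ fun j _ => continuous_const.mul (hcont j))
  have hnorm : ∀ v : Fin n → ℂ, v ≠ 0 → 0 < ∑ i, ‖v i‖ ^ 2 := by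
    intro v hv
    obtain ⟨i, hi⟩ := Function.ne_iff.1 hv
    have hi' : v i ≠ 0 := hi
    exact Finset.sum_pos' (fun i _ => sq_nonneg _) ⟨i, Finset.mem_univ i, by positivity⟩
  have hS : IsCompact (Metric.sphere (0 : Fin n → ℂ) 1) := isCompact_sphere 0 1
  have hS0 : ∀ v ∈ Metric.sphere (0 : Fin n → ℂ) 1, v ≠ 0 :=
    fun v hv => Metric.ne_of_mem_sphere hv one_ne_zero
  obtain ⟨c, hc⟩ := exists_contMDiffMap_forall_mem_convex_of_local_const 𝓘(ℝ, E) (n := ⊤)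
    (t := fun x : M => {c : Fin k → ℝ | ∀ v ∈ Metric.sphere (0 : Fin n → ℂ) 1, 0 < P x c v})
    (fun x => by
      intro c hc c' hc' a b ha hb hab v hv
      have h1 := hc v hv
      have h2 := hc' v hv
      have h3 : P x (a • c + b • c') v = a * P x c v + b * P x c' v := by
        simp only [P, Pi.add_apply, Pi.smul_apply, smul_eq_mul, add_mul, Finset.sum_add_distrib,
          mul_assoc, ← Finset.mul_sum]
        linear_combination (-(quad (matrixAt x (H k)) v).re - ε * ∑ i, ‖v i‖ ^ 2) * hab
      rw [h3]
      rcases ha.eq_or_lt with rfl | ha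
      · rw [zero_add] at hab
        rw [hab]
        linarith
      · have := mul_pos ha h1
        have := mul_nonneg hb h2.le
        linarith)
    (fun x => by
      obtain ⟨c, hc⟩ := exists_add_sum_mul_pos hS
        (q := fun j v => (quad (matrixAt x (H j)) v).re)
        (fun j => (hcont j).comp (Continuous.prodMk_right x)) k (fun v _ m _ h => hlex x v m h)
        (f := fun v => (quad (matrixAt x (H k)) v).re + ε * ∑ i, ‖v i‖ ^ 2)
        (((hcont k).comp (Continuous.prodMk_right x)).add (by fun_prop))
        fun v hv h => by
          have h1 := hlex x v k h
          have h2 := mul_pos hε (hnorm v (hS0 v hv))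
          linarith
      refine ⟨fun j => c j, hS.eventually_forall_of_forall_eventually fun v hv => ?_⟩
      refine (hP _).continuousAt.eventually (lt_mem_nhds ?_)
      have := hc v hv
      rw [Finset.sum_range] at this
      exact this)
  let c' : Fin k → SmoothFunctions E M := fun j =>
    ⟨fun x => ((c x j : ℝ) : ℂ), Complex.ofRealCLM.contDiff.contMDiff.comp
      ((contDiff_apply ℝ ℝ j).contMDiff.comp c.contMDiff)⟩
  refine ⟨c', fun j => SmoothFunctions.ext_evalAt fun x => Complex.conj_ofReal _,
    fun x v hv => ?_⟩
  have hquad : ∀ v, quad (matrixAt x (H k + (algebraMap ℂ (SmoothFunctions E M) ε) • 1 +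
      ∑ j, c' j • H j)) v = (P x (c x) v : ℂ) := by
    intro v
    have hre : ∀ j, quad (matrixAt x (H j)) v = (((quad (matrixAt x (H j)) v).re : ℝ) : ℂ) :=
      fun j => Complex.ext rfl (by rw [him, Complex.ofReal_im])
    simp only [matrixAt_add, matrixAt_sum, matrixAt_smul, matrixAt_one, quad_add, quad_smul,
      quad_sum, quad_one, AlgHom.commutes]
    simp only [P, Complex.ofReal_add, Complex.ofReal_mul, Complex.ofReal_sum, ← hre]
    rfl
  have hv0 : 0 < ‖v‖ := norm_pos_iff.2 hv
  have hv1 : ((‖v‖⁻¹ : ℝ) : ℂ) • v ∈ Metric.sphere (0 : Fin n → ℂ) 1 := by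
    rw [mem_sphere_zero_iff_norm, norm_smul, Complex.norm_real, norm_inv, norm_norm,
      inv_mul_cancel₀ hv0.ne']
  have h1 := hc x _ hv1
  have h2 := quad_real_smul (matrixAt x (H k + (algebraMap ℂ (SmoothFunctions E M) ε) • 1 +
      ∑ j, c' j • H j)) ‖v‖⁻¹ v
  rw [hquad, hquad, ← Complex.ofReal_mul, Complex.ofReal_inj] at h2
  rw [h2] at h1
  rw [hquad]
  exact_mod_cast pos_of_mul_pos_right h1 (by positivity)

/-- Integration of non-negativity: a positive functional maps a sequence of matrix functions that
is non-negative as a formal power series at each point to a non-negative formal power series. -/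
theorem isNonneg_map_of_quad [FiniteDimensional ℝ E] [IsManifold 𝓘(ℝ, E) ∞ M] [T2Space M]
    [SigmaCompactSpace M] {φ : Matrix (Fin n) (Fin n) (SmoothFunctions E M) →ₗ[ℂ] ℂ}
    (hφ : ∀ a, 0 ≤ φ (star a * a)) {H : ℕ → Matrix (Fin n) (Fin n) (SmoothFunctions E M)}
    (hH : ∀ x v, IsNonneg (PowerSeries.mk fun k => quad (matrixAt x (H k)) v)) :
    IsNonneg (PowerSeries.mk fun k => φ (H k)) := by
  have hstar : ∀ k, star (H k) = H k := fun k => star_eq_of_matrixAt fun x =>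
    isHermitian_of_quad_im fun v => by simpa using (isNonneg_iff.1 (hH x v)).1 k
  have him : ∀ k, (φ (H k)).im = 0 := fun k => im_eq_zero_of_star_eq hφ (hstar k)
  -- a term all of whose predecessors are annihilated is non-negative, even after localisation
  have hstep : ∀ k, (∀ j < k, ∀ g : SmoothFunctions E M, star g = g → (φ (g • H j)).re = 0) →
      ∀ g : SmoothFunctions E M, star g = g → (∀ x, 0 < evalAt x g) → 0 ≤ (φ (g • H k)).re := by
    intro k hk g hg hg0
    have hε : ∀ ε : ℝ, 0 < ε → 0 ≤ (φ (g • H k)).re + ε * (φ (g • 1)).re := by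
      intro ε hε
      obtain ⟨c, hc, hpos⟩ := exists_quad_add_pos hH k hε
      have hG : 0 ≤ φ (g • (H k + (algebraMap ℂ (SmoothFunctions E M) ε) • 1 +
          ∑ j, c j • H j)) := by
        have hpos' : ∀ x, ∀ v ≠ 0, 0 < quad (matrixAt x (g • (H k +
            (algebraMap ℂ (SmoothFunctions E M) ε) • 1 + ∑ j, c j • H j))) v := fun x v hv => by
          rw [matrixAt_smul, quad_smul]
          exact mul_pos (hg0 x) (hpos x v hv)
        refine nonneg_of_quad_pos hφ Finset.univ ?_ (by simp) fun x v ⟨i, _, hi⟩ =>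
          hpos' x v fun h => hi (by rw [h]; rfl)
        refine star_eq_of_matrixAt fun x => isHermitian_of_quad_im fun v => ?_
        by_cases hv : v = 0
        · simp [hv, quad]
        · exact (Complex.lt_def.1 (hpos' x v hv)).2.symm
      have hsum : φ (g • (H k + (algebraMap ℂ (SmoothFunctions E M) ε) • 1 + ∑ j, c j • H j)) =
          φ (g • H k) + ε * φ (g • 1) + ∑ j, φ ((g * c j) • H j) := by
        rw [smul_add, smul_add, map_add, map_add, Finset.smul_sum, map_sum]
        simp only [smul_smul]
        rw [mul_comm g, ← smul_smul, algebraMap_smul, map_smul φ (ε : ℂ), smul_eq_mul]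
      have hre := (Complex.le_def.1 hG).1
      rw [hsum, Complex.add_re, Complex.add_re, Complex.re_sum, Complex.re_ofReal_mul,
        Finset.sum_eq_zero fun (j : Fin k) _ => hk j j.2 (g * c j)
          (by rw [star_mul, hg, hc, mul_comm]), add_zero] at hre
      exact hre
    by_contra! hneg
    have h1 : 0 ≤ (φ (g • (1 : Matrix (Fin n) (Fin n) (SmoothFunctions E M)))).re := by
      by_contra! h1
      have := hε 1 one_pos
      linarith
    have h2 := hε (-(φ (g • H k)).re / ((φ (g • 1)).re + 1) / 2)
      (by apply div_pos (div_pos (by linarith) (by linarith)) two_pos)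
    have h3 : -(φ (g • H k)).re / ((φ (g • 1)).re + 1) * (φ (g • 1)).re ≤ -(φ (g • H k)).re := by
      rw [div_mul_eq_mul_div, div_le_iff₀ (by linarith)]
      nlinarith
    linarith
  -- if moreover the term itself is annihilated, then so are all its localisations
  have hzero : ∀ k, (∀ j < k, φ (H j) = 0) →
      ∀ j < k, ∀ g : SmoothFunctions E M, star g = g → (φ (g • H j)).re = 0 := by
    intro k hk j
    induction j using Nat.strong_induction_on with
    | _ j ih =>
      intro hj g hg
      have h1 : ∀ g : SmoothFunctions E M, star g = g → 0 ≤ (φ ((g * g) • H j)).re := by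
        intro g hg
        have h2 := hstep j (fun i hi => ih i hi (by omega)) (g * g + 1)
          (by rw [star_add, star_mul, hg, star_one]) fun x => by
            rw [map_add, map_one, map_mul]
            have h3 : starRingEnd ℂ (evalAt x g) = evalAt x g := by rw [← evalAt_star, hg]
            have h4 : 0 ≤ evalAt x g * evalAt x g := by
              conv_rhs => rw [← h3, mul_comm]
              conv_rhs => arg 1; rw [← h3, Complex.conj_conj]
              exact mul_star_self_nonneg _
            exact add_pos_of_nonneg_of_pos h4 one_pos
        rw [add_smul, one_smul, map_add, hk j hj, add_zero] at h2
        exact h2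
      have h2 : ∀ t : ℝ, 0 ≤ (φ ((g * g) • H j)).re * (t * t) + 2 * (φ (g • H j)).re * t + 0 := by
        intro t
        have h3 := h1 (1 + algebraMap ℂ (SmoothFunctions E M) t * g) (by
          rw [star_add, star_one, star_mul, hg, mul_comm, ← algebraMap_star_comm]
          congr 2
          rw [← starRingEnd_apply, Complex.conj_ofReal])
        have h4 : (1 + algebraMap ℂ (SmoothFunctions E M) t * g) *
            (1 + algebraMap ℂ (SmoothFunctions E M) t * g) =
            1 + (2 * t : ℂ) • g + (t * t : ℂ) • (g * g) := by
          simp only [Algebra.smul_def, map_mul, map_ofNat]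
          ring
        rw [h4, add_smul, add_smul, one_smul, smul_assoc, smul_assoc, map_add, map_add,
          map_smul φ (2 * t : ℂ), map_smul φ (t * t : ℂ), hk j hj, zero_add, smul_eq_mul,
          smul_eq_mul, Complex.add_re] at h3
        norm_cast at h3
        rw [Complex.re_ofReal_mul, Complex.re_ofReal_mul] at h3
        linarith
      have h3 := discrim_le_zero h2
      rw [discrim] at h3
      nlinarith [sq_nonneg (φ (g • H j)).re]
  refine isNonneg_iff.2 ⟨fun k => by simpa using him k, fun k hk => ?_⟩
  simp only [PowerSeries.coeff_mk] at hk ⊢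
  have := hstep k (hzero k hk) 1 (star_one _) fun x => by rw [map_one]; exact one_pos
  rwa [one_smul] at this

end Integration

/-! ### Complete positivity -/

section CompletePositivity

open Matrix
open scoped ComplexConjugate ComplexOrder

/-- A deformation is positive if the corresponding deformation of the `1 × 1` matrices is. -/
theorem isPositive_of_matrix_one {A : Type*} [Ring A] [StarRing A] [Algebra ℂ A]
    {D : HermitianDeformation A} (h : (D.matrix 1).IsPositive) : D.IsPositive := by
  intro φ₀ hφ₀
  let up : A →ₗ[ℂ] Matrix (Fin 1) (Fin 1) A :=
    { toFun := fun f => Matrix.of fun _ _ => f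
      map_add' := fun f g => rfl
      map_smul' := fun c f => rfl }
  obtain ⟨ψ, hψ0, hψ⟩ := h (φ₀ ∘ₗ Matrix.entryLinearMap ℂ A 0 0) fun a => by
    obtain ⟨t, ht, hφ⟩ := hφ₀ (a 0 0)
    exact ⟨t, ht, by simpa [Matrix.mul_apply, Matrix.star_apply] using hφ⟩
  refine ⟨fun r => ψ r ∘ₗ up, ?_, fun a => ?_⟩
  · change ψ 0 ∘ₗ up = φ₀
    rw [hψ0]
    rfl
  · let ups : A⟦X⟧ → (Matrix (Fin 1) (Fin 1) A)⟦X⟧ := fun a =>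
      PowerSeries.mk fun k => up (PowerSeries.coeff k a)
    have hentry : ∀ a i j, entry i j (ups a) = a := by
      intro a i j
      ext k
      rw [entry, PowerSeries.coeff_mk, PowerSeries.coeff_mk]
      rfl
    have hmul : (D.matrix 1).mul (seriesStar (ups a)) (ups a) = ups (D.mul (seriesStar a) a) := by
      refine entry_ext fun i j => ?_
      rw [hentry]
      refine (entry_seriesMul D.C _ _ i j).trans ?_
      rw [Fin.sum_univ_one, entry_seriesStar, hentry, hentry]
      rfl
    have := hψ (ups a)
    rw [hmul] at this
    convert this using 1
    ext k
    simp [seriesFunctional, ups]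

variable {E : Type*} [NormedAddCommGroup E] [NormedSpace ℝ E] [FiniteDimensional ℝ E]
variable {M : Type*} [TopologicalSpace M] [ChartedSpace E M] [IsManifold 𝓘(ℝ, E) ∞ M] [T2Space M]
  [SigmaCompactSpace M]

/-- Composing a positive functional with the entrywise action of the deformed point evaluations
gives a positive deformation. -/
theorem isCompletelyPositive (D : UnitalStarProduct (SmoothFunctions E M)) :
    D.toHermitianDeformation.IsCompletelyPositive := by
  obtain ⟨T, hT0, hT⟩ := exists_isNonneg_stateAt D
  intro n φ₀ hφ₀
  have hφ : ∀ a, 0 ≤ φ₀ (star a * a) := fun a => by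
    obtain ⟨t, ht, h⟩ := hφ₀ a
    rw [h]
    exact_mod_cast ht
  refine ⟨fun r => φ₀ ∘ₗ (T r).mapMatrix, ?_, fun a => ?_⟩
  · ext B
    simp only [hT0, LinearMap.comp_apply]
    congr 1
  have hss : ∀ (c : ℂ) (a : StarSeries D), star (c • a) = conj c • star a := fun c a =>
    StarSeries.ext fun k => by
      rw [StarSeries.coeff_star, map_smul, map_smul, star_smul, StarSeries.coeff_star]
      rfl
  let w : (Matrix (Fin n) (Fin n) (SmoothFunctions E M))⟦X⟧ :=
    (D.toHermitianDeformation.matrix n).mul (seriesStar a) a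
  let b : Fin n → Fin n → StarSeries D := fun i j => entry i j a
  have hw : ∀ i j, (entry i j w : StarSeries D) = ∑ l, star (b l i) * b l j := fun i j => by
    refine (entry_seriesMul D.C (seriesStar a) a i j).trans ?_
    simp only [entry_seriesStar]
    rfl
  let H : ℕ → Matrix (Fin n) (Fin n) (SmoothFunctions E M) := fun k =>
    ∑ p ∈ Finset.HasAntidiagonal.antidiagonal k, (T p.1).mapMatrix (PowerSeries.coeff p.2 w)
  have hH : ∀ x v, (PowerSeries.mk fun k => quad (matrixAt x (H k)) v) =
      ∑ l, stateAt evalAt D T x (star (∑ j, v j • b l j) * ∑ j, v j • b l j) := by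
    intro x v
    have h1 : ∑ l, stateAt evalAt D T x (star (∑ j, v j • b l j) * ∑ j, v j • b l j) =
        ∑ i, ∑ j, (conj (v i) * v j) • stateAt evalAt D T x (entry i j w : StarSeries D) := by
      have h2 : ∀ l, stateAt evalAt D T x (star (∑ j, v j • b l j) * ∑ j, v j • b l j) =
          ∑ i, ∑ j, (conj (v i) * v j) • stateAt evalAt D T x (star (b l i) * b l j) := by
        intro l
        rw [star_sum, Finset.sum_mul_sum]
        simp only [hss, map_sum, smul_mul_smul_comm, map_smul]
      simp only [h2, hw, map_sum, Finset.smul_sum]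
      rw [Finset.sum_comm]
      exact Finset.sum_congr rfl fun i _ => Finset.sum_comm
    rw [h1]
    ext k
    simp only [PowerSeries.coeff_mk, quad_eq_sum, map_sum, map_smul, H,
      matrixAt_sum, Matrix.sum_apply, smul_eq_mul]
    refine Finset.sum_congr rfl fun i _ => Finset.sum_congr rfl fun j _ => ?_
    rw [mul_assoc, mul_comm (v j)]
    congr 2
    refine Eq.trans (Finset.sum_congr rfl fun p _ => ?_)
      (coeff_stateAt D T x (entry i j w : StarSeries D) k).symm
    simp only [matrixAt, Matrix.map_apply, LinearMap.mapMatrix_apply]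
    congr 2
    exact (PowerSeries.coeff_mk p.2 fun k => PowerSeries.coeff k w i j).symm
  have hφH := isNonneg_map_of_quad hφ (H := H) fun x v => by
    rw [hH]
    exact IsNonneg.sum fun l _ => hT x _
  convert hφH using 1
  ext k
  simp [seriesFunctional, H, w]

end CompletePositivity

end FormalDeformation

theorem mainTheorem2
    {E : Type*} [NormedAddCommGroup E] [NormedSpace ℝ E] [FiniteDimensional ℝ E]
    {M : Type*} [TopologicalSpace M] [T2Space M] [SecondCountableTopology M]
    [ChartedSpace E M] [IsManifold 𝓘(ℝ, E) ∞ M]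
    (σ : SymplecticForm E M) (S : HermitianStarProduct σ) :
    S.toHermitianDeformation.IsPositive ∧ S.toHermitianDeformation.IsCompletelyPositive := by
  have : LocallyCompactSpace M := ChartedSpace.locallyCompactSpace E M
  have h := FormalDeformation.isCompletelyPositive
    ⟨S.toHermitianDeformation, S.one_mul, S.mul_one, S.bidiff⟩
  exact ⟨FormalDeformation.isPositive_of_matrix_one (h 1), h⟩
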